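/- Let $\mathbb{T}^2=\mathbb{R}^2/\mathbb{Z}^2$ with fundamental domain $[-\tfrac12,\tfrac12]^2$; functions on $\mathbb{T}^2$ are $\mathbb{Z}^2$-periodic functions on $\mathbb{R}^2$, $(K\star f)(x)=\int_{\mathbb{T}^2}K(x-y)f(y)\,dy$, and $\nabla^{\perp}=(-\partial_2,\partial_1)$, with components $\nabla^\perp_1,\nabla^\perp_2$. A *Coulomb potential* on $\mathbb{T}^2$ is a periodic function $V\in C^\infty(\mathbb{R}^2\setminus\mathbb{Z}^2)$ such that (a) for every $\varrho\in L^\infty(\mathbb{T}^2)$ with $\int_{\mathbb{T}^2}\varrho=0$ the function $\Phi=V\star\varrho$ is in $C^1(\mathbb{T}^2)$, has mean zero, and solves $-\Delta\Phi=\varrho$ in the sense of distributions on $\mathbb{T}^2$; and (b) $V(x)=V_0(x)-\frac1{2\pi}\log|x|$ on $\mathbb{R}^2\setminus\mathbb{Z}^2$ for some $V_0\in C^\infty((\mathbb{R}^2\setminus\mathbb{Z}^2)\cup\{0\})$. (Such a $V$ is determined, off $\mathbb{Z}^2$, up to an additive constant, which plays no role below.) For $f\in L^1(\mathbb{T}^2)$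 let $$\|f\|_{\mathrm{BMO}(\mathbb{T}^2)}=\sup_Q\frac1{|Q|}\int_Q\Big|f(x)-\frac1{|Q|}\int_Q f\Big|\,dx,$$ the supremum being over all cubes $Q\subset\mathbb{R}^2$ with edges parallel to the axes and side length at most $1$ (that is, the cubes of $\mathbb{T}^2$, in particular all those contained in $[-\frac12,\frac12]^2$). For $\omega\in L^\infty(\mathbb{T}^2)$ and $k,j\in\{1,2\}$ let $T_{kj}\omega=\nabla_k\nabla_j^{\perp}V\star\omega$, the convolution of $\omega$ with the distribution $\nabla_k\nabla_j^\perp V$ on $\mathbb{T}^2$, i.e. the distributional derivative $\partial_k(\nabla_j^{\perp}V\star\omega)$. Let $\omega_0\in L^\infty(\mathbb{T}^2)$. A *Yudovich solution* on $[0,T]$ with datum $\omega_0$ is a measurable $\omega\in L^\infty([0,T];L^\infty(\mathbb{T}^2))$, with $\omega(t,\cdot)\in L^1(\mathbb{T}^2)$ for every $t\in[0,T]$, that is a weak solution of $\partial_t\omega+\mathrm{div}(\omega u)=0$ with velocity field $u=-\nabla^{\perp}V\star\omega$: for all $\varphi\in C^\infty(\mathbb{R}\times\mathbb{T}^2)$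 and all $t\in[0,T]$, $$\int_{\mathbb{T}^2}\omega(t,x)\varphi(t,x)\,dx=\int_{\mathbb{T}^2}\omega_0(x)\varphi(0,x)\,dx+\int_0^t\!\!\int_{\mathbb{T}^2}\omega\,\partial_s\varphi\,dx\,ds+\int_0^t\!\!\int_{\mathbb{T}^2}\nabla\varphi\cdot u\;\omega\,dx\,ds .$$ **Theorem.** Coulomb potentials on $\mathbb{T}^2$ exist. For every Coulomb potential $V$ there is a constant $A>0$ such that: 1. for all $k,j\in\{1,2\}$ and all $\omega\in L^\infty(\mathbb{T}^2)$, the distribution $T_{kj}\omega$ is a function in $L^1(\mathbb{T}^2)$ and $$\|T_{kj}\omega\|_{\mathrm{BMO}(\mathbb{T}^2)}\le A\,\|\omega\|_{L^\infty(\mathbb{T}^2)};$$ 2. for every $T$, every $\omega_0\in L^\infty(\mathbb{T}^2)$ and every Yudovich solution $\omega$ on $[0,T]$ with datum $\omega_0$ and velocity field $u$, the distributional derivatives $\partial_k u_j(t,\cdot)$ are functions in $L^1(\mathbb{T}^2)$ for every $t\in[0,T]$, and $$\sup_{t\in[0,T]}\|\partial_k u_j(t,\cdot)\|_{\mathrm{BMO}(\mathbb{T}^2)}\le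 A\,\|\omega(0,\cdot)\|_{L^\infty(\mathbb{T}^2)}\qquad(k,j\in\{1,2\}).$$ -/

import Mathlib

open MeasureTheory

noncomputable section

namespace TorusEuler

/-- The plane `ℝ²` with its Euclidean norm. -/
abbrev Plane : Type := EuclideanSpace ℝ (Fin 2)

/-- The lattice `ℤ²` in `ℝ²`. -/
def lattice : Set Plane := {x | ∀ i, ∃ n : ℤ, x i = n}

/-- Functions on `𝕋²` are `ℤ²`-periodic functions on `ℝ²`. -/
def IsPeriodic (f : Plane → ℝ) : Prop :=
  ∀ (n : Fin 2 → ℤ) (x : Plane), f (x + WithLp.toLp 2 (fun i => (n i : ℝ))) = f x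

/-- The fundamental domain `[-1/2, 1/2]²`. -/
def unitSquare : Set Plane := {x | ∀ i, x i ∈ Set.Icc (-1 / 2 : ℝ) (1 / 2)}

/-- Lebesgue measure on the fundamental domain, i.e. the measure of `𝕋²`. -/
def torusMeasure : Measure Plane := volume.restrict unitSquare

/-- The norm of `L^∞(𝕋²)`, with value `⊤` if `f` is essentially unbounded. -/
def linfNorm (f : Plane → ℝ) : ENNReal := eLpNorm f ⊤ torusMeasure

/-- `f ∈ L^∞(𝕋²)`. -/
structure MemLinf (f : Plane → ℝ) : Prop where
  periodic : IsPeriodic f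
  memLp : MemLp f ⊤ torusMeasure

/-- The classical partial derivative in direction `i`. -/
def pderiv (i : Fin 2) (f : Plane → ℝ) (x : Plane) : ℝ :=
  fderiv ℝ f x (EuclideanSpace.single i 1)

/-- The components of the rotated gradient `∇^⊥ f = (-∂₂ f, ∂₁ f)`. -/
def perpGrad (f : Plane → ℝ) (j : Fin 2) (x : Plane) : ℝ :=
  (![-pderiv 1 f x, pderiv 0 f x] : Fin 2 → ℝ) j

/-- Convolution on the torus, `(K ⋆ f)(x) = ∫_{𝕋²} K(x - y) f(y) dy`. -/
def torusConv (K f : Plane → ℝ) (x : Plane) : ℝ :=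
  ∫ y, K (x - y) * f y ∂torusMeasure

/-- `C^∞(𝕋²)`. -/
structure IsTest (φ : Plane → ℝ) : Prop where
  smooth : ContDiff ℝ (⊤ : ℕ∞) φ
  periodic : IsPeriodic φ

/-- `V` is a Coulomb potential on `𝕋²`: a periodic function, smooth off the lattice, for which
`Φ = V ⋆ ϱ` is a `C¹` solution of mean zero of `-ΔΦ = ϱ` (in the sense of distributions on `𝕋²`)
for every `ϱ ∈ L^∞(𝕋²)` of mean zero, and which differs from `-(1/2π) log |x|` by a function that
is smooth on `(ℝ² \ ℤ²) ∪ {0}`. (Such a `V` is determined up to an additive constant, off the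
lattice.) -/
structure IsCoulombPotential (V : Plane → ℝ) : Prop where
  smooth : ContDiffOn ℝ (⊤ : ℕ∞) V latticeᶜ
  periodic : IsPeriodic V
  poisson : ∀ ϱ : Plane → ℝ, MemLinf ϱ → ∫ x, ϱ x ∂torusMeasure = 0 →
    ContDiff ℝ 1 (torusConv V ϱ) ∧ IsPeriodic (torusConv V ϱ) ∧
    ∫ x, torusConv V ϱ x ∂torusMeasure = 0 ∧
    ∀ φ : Plane → ℝ, IsTest φ →
      -∫ x, torusConv V ϱ x * Laplacian.laplacian φ x ∂torusMeasure = ∫ x, ϱ x * φ x ∂torusMeasure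
  log_singularity : ∃ V₀ : Plane → ℝ, ContDiffOn ℝ (⊤ : ℕ∞) V₀ (latticeᶜ ∪ {0}) ∧
    ∀ x ∈ latticeᶜ, V x = V₀ x + -(1 / (2 * Real.pi)) * Real.log ‖x‖

/-- `g = ∂_k h` in the sense of distributions on `𝕋²`, with `h, g ∈ L¹(𝕋²)`. -/
structure IsWeakDeriv (k : Fin 2) (h g : Plane → ℝ) : Prop where
  periodic_left : IsPeriodic h
  periodic_right : IsPeriodic g
  integrable_left : LocallyIntegrable h volume
  integrable_right : LocallyIntegrable g volume
  integral_eq : ∀ φ : Plane → ℝ, IsTest φ →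
    ∫ x, h x * pderiv k φ x ∂torusMeasure = -∫ x, g x * φ x ∂torusMeasure

/-- `g = T_{kj} ω = ∇_k ∇^⊥_j V ⋆ ω`, the convolution of `ω` with the distribution
`∇_k ∇^⊥_j V` on `𝕋²`; as `∇^⊥_j V` is integrable, this is the distributional derivative
`∂_k (∇^⊥_j V ⋆ ω)`. It determines `g` almost everywhere. -/
def IsCZ (V : Plane → ℝ) (k j : Fin 2) (ω g : Plane → ℝ) : Prop :=
  IsWeakDeriv k (torusConv (perpGrad V j) ω) g

/-- The closed cube with lower corner `a` and side `r`, with edges parallel to the axes. -/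
def cube (a : Plane) (r : ℝ) : Set Plane := {x | ∀ i, x i ∈ Set.Icc (a i) (a i + r)}

/-- The BMO norm on `𝕋²` of a periodic locally integrable function: the supremum of the mean
oscillation over all cubes of side at most `1` in `ℝ²`. These are the cubes of `ℝ²/ℤ²`; in
particular all cubes contained in `[-1/2, 1/2]²` are among them. -/
def bmoNorm (f : Plane → ℝ) : ENNReal :=
  ⨆ (a : Plane) (r : ℝ) (_ : 0 < r) (_ : r ≤ 1),
    (volume (cube a r))⁻¹ *
      ∫⁻ x in cube a r, ‖f x - (volume (cube a r)).toReal⁻¹ * ∫ y in cube a r, f y‖ₑ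

/-- The velocity field `u = -∇^⊥ V ⋆ ω` (component `j`), that is `u = ∇^⊥ ψ` with
`ψ = -V ⋆ ω`. -/
def velocity (V ω : Plane → ℝ) (j : Fin 2) (x : Plane) : ℝ :=
  -torusConv (perpGrad V j) ω x

/-- `ω ∈ L^∞([0,T]; L^∞(𝕋²))` is a weak solution on `[0,T]` of the Euler equation
`∂ₜω + div (ω u) = 0`, `u = -∇^⊥ V ⋆ ω`, with initial datum `ω₀ ∈ L^∞(𝕋²)`. The weak formulation
is required at every time `t`, so each `ω t` is taken to be integrable. -/
structure IsYudovichSolution (V : Plane → ℝ) (T : ℝ) (ω₀ : Plane → ℝ) (ω : ℝ → Plane → ℝ) :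
    Prop where
  initial : MemLinf ω₀
  periodic : ∀ t ∈ Set.Icc 0 T, IsPeriodic (ω t)
  measurable : AEStronglyMeasurable (fun p : ℝ × Plane => ω p.1 p.2)
    ((volume.restrict (Set.Icc 0 T)).prod torusMeasure)
  integrable : ∀ t ∈ Set.Icc 0 T, Integrable (ω t) torusMeasure
  bounded : ∃ M : NNReal, ∀ᵐ t ∂(volume.restrict (Set.Icc 0 T)), linfNorm (ω t) ≤ M
  weak_form : ∀ φ : ℝ → Plane → ℝ,
    ContDiff ℝ (⊤ : ℕ∞) (fun p : ℝ × Plane => φ p.1 p.2) → (∀ t, IsPeriodic (φ t)) →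
    ∀ t ∈ Set.Icc 0 T,
      ∫ x, ω t x * φ t x ∂torusMeasure =
        ∫ x, ω₀ x * φ 0 x ∂torusMeasure
        + (∫ s in (0 : ℝ)..t, ∫ x, ω s x * deriv (fun r => φ r x) s ∂torusMeasure)
        + ∫ s in (0 : ℝ)..t, ∫ x,
            (∑ j : Fin 2, pderiv j (φ s) x * velocity V (ω s) j x) * ω s x ∂torusMeasure

end TorusEuler

end

open MeasureTheory

noncomputable section

namespace TorusEuler

open Set Filter Topology
open scoped Convolution

attribute [local instance] instMeasureSpaceUnitAddCircle

/-! Existence. The theta function of the lattice ℤ + iℤ has simple zeros exactly at the lattice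
points, so −(1/2π) times the logarithm of its modulus is harmonic off the lattice and has the
required singularity. A quadratic polynomial in the second coordinate repairs the quasi-periodicity
and makes the Laplacian equal to 1 (`laplacian_thetaPotential`). Poisson's equation follows by two
integrations by parts against φ − φ(0), which vanishes at the singularity
(`integral_thetaPotential_mul_laplacian`).

From L^∞ to BMO. Poisson's equation tested on characters forces the Fourier coefficients of every
Coulomb potential to be 1/(4π²|n|²) for n ≠ 0 (`IsCoulombPotential.coef_eq`). Hence T_kj is a
Fourier multiplier bounded by 1, and Parseval bounds it on L² (`exists_weakDeriv`). On a cube of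
side r ≤ 1/16 the density is split at distance 4r from a corner. The near part is supported in a
cube of side 8r, so the L² bound and Cauchy–Schwarz suffice. On the cube the far part is an honest
convolution (`ae_eq_torusConv_farPart`) with a kernel whose differences are O(|v| |z|⁻³); integrated
over |z| ≥ 4r with |v| ≤ 2r, this is a bounded oscillation (`HasSing.exists_oscillation_bound`).
Larger cubes need only the L² bound. The two cases meet in `exists_bmoNorm_le`.

Euler. It remains to see that ‖ω(t)‖_∞ ≤ ‖ω(0)‖_∞ at every time. The vorticity is renormalised in
the manner of DiPerna and Lions: its mollification solves the transport equation up to a commutator.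
The Fourier coefficients give ‖u(· + z) − u‖ ≤ 2|z| ‖ω‖ in L² (`integral_sq_torusConv_sub_le`), and
translations are continuous in L², so the commutator tends to zero in L¹
(`integral_abs_commutator_le`). For a smooth β ≥ 0 vanishing exactly on [−M₀, M₀], with M₀ = ‖ω₀‖_∞,
the integral of β of the mollified vorticity therefore tends to zero, and Fatou's lemma gives
β(ω(t)) = 0 almost everywhere (`IsYudovichSolution.ae_abs_le`). -/

instance : (volume : Measure UnitAddCircle).IsAddHaarMeasure :=
  inferInstanceAs (AddCircle.haarAddCircle.IsAddHaarMeasure)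

/-! ### Periodic functions and the passage between plane and torus. -/

/-- The lattice vector with integer coordinates `n`. -/
def latticeVec (n : Fin 2 → ℤ) : Plane := WithLp.toLp 2 (fun i => (n i : ℝ))

@[simp] lemma latticeVec_apply (n : Fin 2 → ℤ) (i : Fin 2) : latticeVec n i = n i := rfl

/-- Lattice periodicity for functions with values in any type. -/
def LatticePeriodic {E : Type*} (f : Plane → E) : Prop :=
  ∀ (n : Fin 2 → ℤ) (x : Plane), f (x + latticeVec n) = f x

lemma IsPeriodic.latticePeriodic {f : Plane → ℝ} (hf : IsPeriodic f) : LatticePeriodic f := hf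

lemma LatticePeriodic.comp {E F : Type*} {f : Plane → E} (hf : LatticePeriodic f) (g : E → F) :
    LatticePeriodic (fun x => g (f x)) := fun n x => congrArg g (hf n x)

lemma LatticePeriodic.comp₂ {E F G : Type*} {f : Plane → E} {g : Plane → F}
    (hf : LatticePeriodic f) (hg : LatticePeriodic g) (op : E → F → G) :
    LatticePeriodic (fun x => op (f x) (g x)) := fun n x => congrArg₂ op (hf n x) (hg n x)

lemma LatticePeriodic.add_right {E : Type*} {f : Plane → E} (hf : LatticePeriodic f) (y : Plane) :
    LatticePeriodic (fun x => f (x + y)) := fun n x => by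
  simp only [add_right_comm, hf n (x + y)]

lemma LatticePeriodic.sub_right {E : Type*} {f : Plane → E} (hf : LatticePeriodic f) (y : Plane) :
    LatticePeriodic (fun x => f (x - y)) := fun n x => by
  simp only [add_sub_right_comm, hf n (x - y)]

lemma latticeVec_neg (n : Fin 2 → ℤ) : latticeVec (-n) = -latticeVec n := by
  ext i; simp

lemma LatticePeriodic.sub_left {E : Type*} {f : Plane → E} (hf : LatticePeriodic f) (y : Plane) :
    LatticePeriodic (fun x => f (y - x)) := fun n x => by
  simp only [← sub_sub, sub_eq_add_neg _ (latticeVec n), ← latticeVec_neg, hf (-n) (y - x)]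

/-- The projection from the plane to the torus. -/
def toTorus (x : Plane) : UnitAddTorus (Fin 2) := fun i => (x i : UnitAddCircle)

/-- The representative of a point of the torus in the half-open unit square. -/
def ofTorus (t : UnitAddTorus (Fin 2)) : Plane :=
  WithLp.toLp 2 (fun i => ((AddCircle.equivIoc 1 (-1 / 2) (t i)).1 : ℝ))

lemma toTorus_ofTorus (t : UnitAddTorus (Fin 2)) : toTorus (ofTorus t) = t := by
  funext i
  exact AddCircle.coe_equivIoc

lemma exists_latticeVec_of_toTorus_eq {x y : Plane} (h : toTorus x = toTorus y) :
    ∃ n, x = y + latticeVec n := by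
  have h' : ∀ i, ∃ n : ℤ, x i = y i + n := fun i => by
    have h1 : ((x i : ℝ) : UnitAddCircle) = (y i : ℝ) := congrFun h i
    rw [← sub_eq_zero, ← AddCircle.coe_sub, AddCircle.coe_eq_zero_iff] at h1
    obtain ⟨n, hn⟩ := h1
    exact ⟨n, by simp at hn; linarith⟩
  choose n hn using h'
  exact ⟨n, by ext i; simp [hn i]⟩

lemma LatticePeriodic.apply_ofTorus {E : Type*} {f : Plane → E} (hf : LatticePeriodic f)
    (x : Plane) : f (ofTorus (toTorus x)) = f x := by
  obtain ⟨n, hn⟩ := exists_latticeVec_of_toTorus_eq (toTorus_ofTorus (toTorus x))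
  rw [hn, hf]

lemma measurable_toTorus : Measurable toTorus :=
  measurable_pi_lambda _ fun i => AddCircle.measurable_mk'.comp (by fun_prop)

lemma toTorus_add_latticeVec (n : Fin 2 → ℤ) (x : Plane) :
    toTorus (x + latticeVec n) = toTorus x := by
  funext i
  simp [toTorus]

/-- The half-open unit cube with lower corner `a`. -/
def halfBox (a : Plane) : Set Plane := {x | ∀ i, x i ∈ Ioc (a i) (a i + 1)}

lemma measurableEmbedding_ofLp :
    MeasurableEmbedding (MeasurableEquiv.toLp 2 (Fin 2 → ℝ)).symm :=
  MeasurableEquiv.measurableEmbedding _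

lemma measurePreserving_ofLp :
    MeasurePreserving (MeasurableEquiv.toLp 2 (Fin 2 → ℝ)).symm volume volume :=
  EuclideanSpace.volume_preserving_symm_measurableEquiv_toLp _

/-- Every half-open unit cube is a fundamental domain. The right-hand side does not see `a`, so this
contains the translation invariance of integrals over a period. -/
lemma lintegral_halfBox {f : Plane → ENNReal} (hf : LatticePeriodic f) (a : Plane) :
    ∫⁻ x in halfBox a, f x = ∫⁻ t : UnitAddTorus (Fin 2), f (ofTorus t) := by
  rw [UnitAddTorus.lintegral_preimage _ (fun i => a i),
    ← measurePreserving_ofLp.setLIntegral_comp_preimage_emb measurableEmbedding_ofLp]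
  exact lintegral_congr fun x => (hf.apply_ofTorus x).symm

lemma integral_halfBox {E : Type*} [NormedAddCommGroup E] [NormedSpace ℝ E] {f : Plane → E}
    (hf : LatticePeriodic f) (a : Plane) :
    ∫ x in halfBox a, f x = ∫ t : UnitAddTorus (Fin 2), f (ofTorus t) := by
  rw [UnitAddTorus.integral_preimage _ (fun i => a i),
    ← measurePreserving_ofLp.setIntegral_preimage_emb measurableEmbedding_ofLp]
  exact integral_congr_ae (ae_of_all _ fun x => (hf.apply_ofTorus x).symm)

lemma cube_one_ae_eq_halfBox (a : Plane) : cube a 1 =ᵐ[volume] halfBox a := by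
  have h := Measure.univ_pi_Ioc_ae_eq_Icc (μ := fun _ : Fin 2 => (volume : Measure ℝ))
    (f := fun i => a i) (g := fun i => a i + 1)
  have h2 := measurePreserving_ofLp.quasiMeasurePreserving.preimage_ae_eq h
  have e1 : cube a 1 = (MeasurableEquiv.toLp 2 (Fin 2 → ℝ)).symm ⁻¹'
      (Icc (fun i => a i) (fun i => a i + 1)) := by
    ext x
    simp only [cube, mem_ofPred_eq, mem_preimage, mem_Icc, Pi.le_def]
    exact forall_and
  have e2 : halfBox a = (MeasurableEquiv.toLp 2 (Fin 2 → ℝ)).symm ⁻¹'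
      (univ.pi fun i => Ioc (a i) (a i + 1)) := by
    ext x
    simp [halfBox]
  rw [e1, e2]
  exact h2.symm

/-- The centre `(-1/2, -1/2)` of the fundamental domain's lower corner. -/
def corner : Plane := WithLp.toLp 2 (fun _ => -1 / 2)

lemma unitSquare_eq_cube : unitSquare = cube corner 1 := by
  ext x
  simp only [unitSquare, cube, corner, mem_ofPred_eq]
  norm_num

lemma torusMeasure_eq : torusMeasure = volume.restrict (halfBox corner) := by
  rw [torusMeasure, unitSquare_eq_cube]
  exact Measure.restrict_congr_set (cube_one_ae_eq_halfBox _)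

lemma setLIntegral_cube_one {f : Plane → ENNReal} (hf : LatticePeriodic f) (a : Plane) :
    ∫⁻ x in cube a 1, f x = ∫⁻ x, f x ∂torusMeasure := by
  rw [torusMeasure_eq, Measure.restrict_congr_set (cube_one_ae_eq_halfBox _),
    lintegral_halfBox hf, lintegral_halfBox hf]

lemma setIntegral_cube_one {E : Type*} [NormedAddCommGroup E] [NormedSpace ℝ E] {f : Plane → E}
    (hf : LatticePeriodic f) (a : Plane) :
    ∫ x in cube a 1, f x = ∫ x, f x ∂torusMeasure := by
  rw [torusMeasure_eq, Measure.restrict_congr_set (cube_one_ae_eq_halfBox _),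
    integral_halfBox hf, integral_halfBox hf]

lemma measurableSet_cube (a : Plane) (r : ℝ) : MeasurableSet (cube a r) := by
  have : cube a r = ⋂ i, (fun x : Plane => x i) ⁻¹' Icc (a i) (a i + r) := by
    ext x; simp [cube]
  rw [this]
  exact MeasurableSet.iInter fun i => (by fun_prop : Measurable fun x : Plane => x i)
    measurableSet_Icc

lemma isClosed_cube (a : Plane) (r : ℝ) : IsClosed (cube a r) := by
  have : cube a r = ⋂ i, (fun x : Plane => x i) ⁻¹' Icc (a i) (a i + r) := by
    ext x; simp [cube]
  rw [this]
  exact isClosed_iInter fun i => isClosed_Icc.preimage (by fun_prop)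

lemma volume_cube (a : Plane) {r : ℝ} : volume (cube a r) = ENNReal.ofReal r ^ 2 := by
  have h : cube a r = (MeasurableEquiv.toLp 2 (Fin 2 → ℝ)).symm ⁻¹'
      (Icc (fun i => a i) (fun i => a i + r)) := by
    ext x
    simp only [cube, mem_ofPred_eq, mem_preimage, mem_Icc, Pi.le_def]
    exact forall_and
  rw [h, measurePreserving_ofLp.measure_preimage measurableSet_Icc.nullMeasurableSet,
    Real.volume_Icc_pi]
  simp

instance : IsProbabilityMeasure torusMeasure := ⟨by
  rw [torusMeasure, Measure.restrict_apply_univ, unitSquare_eq_cube, volume_cube]; simp⟩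

lemma measurePreserving_toTorus : MeasurePreserving toTorus torusMeasure volume := by
  refine ⟨measurable_toTorus, ?_⟩
  ext s hs
  rw [Measure.map_apply measurable_toTorus hs, ← lintegral_indicator_one hs,
    ← lintegral_indicator_one (measurable_toTorus hs), torusMeasure_eq, lintegral_halfBox]
  · refine lintegral_congr fun t => ?_
    rw [show (toTorus ⁻¹' s).indicator (1 : Plane → ENNReal) (ofTorus t)
      = s.indicator 1 (toTorus (ofTorus t)) from rfl, toTorus_ofTorus]
  · intro n x
    show s.indicator (1 : UnitAddTorus (Fin 2) → ENNReal) (toTorus (x + latticeVec n)) = s.indicator 1 (toTorus x)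
    rw [toTorus_add_latticeVec]

lemma cube_shift_preimage (a y : Plane) (r : ℝ) :
    (fun x => x + y) ⁻¹' cube (a + y) r = cube a r := by
  ext x
  simp only [cube, mem_preimage, mem_ofPred_eq, PiLp.add_apply, mem_Icc]
  refine forall_congr' fun i => ?_
  constructor <;> rintro ⟨h1, h2⟩ <;> constructor <;> linarith

lemma integral_torus_add {E : Type*} [NormedAddCommGroup E] [NormedSpace ℝ E] {f : Plane → E}
    (hf : LatticePeriodic f) (y : Plane) :
    ∫ x, f (x + y) ∂torusMeasure = ∫ x, f x ∂torusMeasure := by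
  rw [← setIntegral_cube_one hf (corner + y), torusMeasure, unitSquare_eq_cube,
    ← (measurePreserving_add_right volume y).setIntegral_preimage_emb
      (measurableEmbedding_addRight y) f, cube_shift_preimage]

lemma measurePreserving_neg_torus :
    MeasurePreserving (fun x : Plane => -x) torusMeasure torusMeasure := by
  have h : unitSquare = (fun x : Plane => -x) ⁻¹' unitSquare := by
    ext x
    simp only [unitSquare, mem_preimage, mem_ofPred_eq, PiLp.neg_apply, mem_Icc]
    refine forall_congr' fun i => ?_
    constructor <;> rintro ⟨h1, h2⟩ <;> constructor <;> linarith
  have := (Measure.measurePreserving_neg (volume : Measure Plane)).restrict_preimage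
    (s := unitSquare) (by rw [unitSquare_eq_cube]; exact measurableSet_cube _ _)
  rwa [← h] at this

lemma integral_torus_sub_left {E : Type*} [NormedAddCommGroup E] [NormedSpace ℝ E]
    {f : Plane → E} (hf : LatticePeriodic f) (y : Plane) :
    ∫ x, f (y - x) ∂torusMeasure = ∫ x, f x ∂torusMeasure := by
  have h := measurePreserving_neg_torus.integral_comp
    (MeasurableEquiv.neg Plane).measurableEmbedding (fun x => f (x + y))
  simp only [neg_add_eq_sub] at h
  rw [h, integral_torus_add hf]

lemma ofTorus_toTorus {x : Plane} (hx : x ∈ halfBox corner) : ofTorus (toTorus x) = x := by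
  ext i
  have h := hx i
  simp only [corner] at h
  exact AddCircle.equivIoc_coe_of_mem (p := (1 : ℝ)) (a := -1 / 2) h

lemma measurable_ofTorus : Measurable ofTorus := by
  refine (MeasurableEquiv.toLp 2 (Fin 2 → ℝ)).measurable.comp (measurable_pi_lambda _ fun i => ?_)
  exact measurable_subtype_coe.comp
    ((AddCircle.measurableEquivIoc 1 (-1 / 2)).measurable.comp (measurable_pi_apply i))

lemma measurableSet_halfBox (a : Plane) : MeasurableSet (halfBox a) := by
  have : halfBox a = ⋂ i, (fun x : Plane => x i) ⁻¹' Ioc (a i) (a i + 1) := by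
    ext x; simp [halfBox]
  rw [this]
  exact MeasurableSet.iInter fun i => (by fun_prop : Measurable fun x : Plane => x i)
    measurableSet_Ioc

lemma measurePreserving_ofTorus : MeasurePreserving ofTorus volume torusMeasure := by
  refine ⟨measurable_ofTorus, ?_⟩
  ext s hs
  have hp : LatticePeriodic fun x => s.indicator (1 : Plane → ENNReal) (ofTorus (toTorus x)) :=
    fun n x => by simp only [toTorus_add_latticeVec]
  rw [Measure.map_apply measurable_ofTorus hs, ← lintegral_indicator_one hs,
    ← lintegral_indicator_one (measurable_ofTorus hs)]
  have h := lintegral_halfBox hp corner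
  simp only [toTorus_ofTorus] at h
  refine h.symm.trans ?_
  rw [torusMeasure_eq]
  exact setLIntegral_congr_fun (measurableSet_halfBox _) fun x hx => by
    simp only [ofTorus_toTorus hx]

lemma cube_one_mem_nhds (x : Plane) : cube (x + corner) 1 ∈ 𝓝 x := by
  have : (⋂ i, (fun y : Plane => y i) ⁻¹' Ioo ((x + corner) i) ((x + corner) i + 1)) ∈ 𝓝 x := by
    refine (isOpen_iInter_of_finite fun i => isOpen_Ioo.preimage (by fun_prop)).mem_nhds ?_
    refine mem_iInter.2 fun i => ?_
    simp only [corner, mem_preimage, PiLp.add_apply, mem_Ioo]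
    constructor <;> linarith
  refine Filter.mem_of_superset this fun y hy i => ?_
  exact Ioo_subset_Icc_self (mem_iInter.1 hy i)

/-- Nullity is a local property, and on each unit cube the projection preserves measure. This
carries almost-everywhere statements from one period to the whole plane. -/
lemma quasiMeasurePreserving_toTorus :
    Measure.QuasiMeasurePreserving toTorus (volume : Measure Plane) volume := by
  refine ⟨measurable_toTorus, Measure.AbsolutelyContinuous.mk fun s hs h0 => ?_⟩
  rw [Measure.map_apply measurable_toTorus hs]
  refine measure_null_of_locally_null _ fun x _ => ?_
  refine ⟨toTorus ⁻¹' s ∩ cube (x + corner) 1, inter_mem_nhdsWithin _ (cube_one_mem_nhds x), ?_⟩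
  · have hp : LatticePeriodic fun y => s.indicator (1 : UnitAddTorus (Fin 2) → ENNReal) (toTorus y) :=
      fun n y => by simp only [toTorus_add_latticeVec]
    have h := setLIntegral_cube_one hp (x + corner)
    rw [← Measure.restrict_apply (measurable_toTorus hs),
      ← lintegral_indicator_one (measurable_toTorus hs)]
    refine h.trans ?_
    rw [measurePreserving_toTorus.lintegral_comp (measurable_one.indicator hs),
      lintegral_indicator_one hs, h0]

lemma ae_volume_of_ae_torus {P : Plane → Prop} (hP : LatticePeriodic P)
    (h : ∀ᵐ x ∂torusMeasure, P x) : ∀ᵐ x, P x := by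
  have h1 := measurePreserving_ofTorus.quasiMeasurePreserving.ae h
  filter_upwards [quasiMeasurePreserving_toTorus.ae h1] with x hx
  rwa [hP.apply_ofTorus x] at hx

lemma ae_torus_of_ae_volume {P : Plane → Prop} (h : ∀ᵐ x, P x) : ∀ᵐ x ∂torusMeasure, P x :=
  ae_restrict_of_ae h

/-! ### Translates of periodic functions. -/

section Translation

variable {E : Type*} [NormedAddCommGroup E] {f : Plane → E}

lemma LatticePeriodic.aestronglyMeasurable (hf : LatticePeriodic f)
    (h : AEStronglyMeasurable f torusMeasure) : AEStronglyMeasurable f := by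
  have h1 := (h.comp_measurePreserving measurePreserving_ofTorus).comp_quasiMeasurePreserving
    quasiMeasurePreserving_toTorus
  exact h1.congr (ae_of_all _ fun x => hf.apply_ofTorus x)

lemma LatticePeriodic.eLpNorm_add (hf : LatticePeriodic f)
    (h : AEStronglyMeasurable f torusMeasure) (y : Plane) (p : ENNReal) :
    eLpNorm (fun x => f (x + y)) p torusMeasure = eLpNorm f p torusMeasure := by
  have h1 := h.comp_measurePreserving measurePreserving_ofTorus
  have e : (fun x => f (x + y)) = ((f ∘ ofTorus) ∘ (· + toTorus y)) ∘ toTorus := by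
    funext x
    have : toTorus x + toTorus y = toTorus (x + y) := by
      funext i; simp [toTorus]
    simp only [Function.comp_apply, this, hf.apply_ofTorus]
  have h2 := measurePreserving_add_right (volume : Measure (UnitAddTorus (Fin 2))) (toTorus y)
  rw [e, eLpNorm_comp_measurePreserving (h1.comp_measurePreserving h2) measurePreserving_toTorus,
    eLpNorm_comp_measurePreserving h1 h2, eLpNorm_comp_measurePreserving h measurePreserving_ofTorus]

lemma LatticePeriodic.memLp_add (hf : LatticePeriodic f) {p : ENNReal}
    (h : MemLp f p torusMeasure) (y : Plane) : MemLp (fun x => f (x + y)) p torusMeasure := by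
  refine ⟨?_, by rw [hf.eLpNorm_add h.1]; exact h.2⟩
  exact ((hf.aestronglyMeasurable h.1).comp_measurePreserving
    (measurePreserving_add_right volume y)).restrict

lemma LatticePeriodic.integrable_add (hf : LatticePeriodic f)
    (h : Integrable f torusMeasure) (y : Plane) :
    Integrable (fun x => f (x + y)) torusMeasure :=
  memLp_one_iff_integrable.1 (hf.memLp_add (memLp_one_iff_integrable.2 h) y)

lemma LatticePeriodic.integrable_sub_left (hf : LatticePeriodic f)
    (h : Integrable f torusMeasure) (y : Plane) :
    Integrable (fun x => f (y - x)) torusMeasure := by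
  have := measurePreserving_neg_torus.integrable_comp_of_integrable (hf.integrable_add h y)
  simpa [Function.comp_def, neg_add_eq_sub] using this

lemma LatticePeriodic.locallyIntegrable (hf : LatticePeriodic f)
    (h : Integrable f torusMeasure) : LocallyIntegrable f := by
  intro x
  refine ⟨cube (x + corner) 1, cube_one_mem_nhds x, (hf.aestronglyMeasurable h.1).restrict, ?_⟩
  · have := h.2
    rw [HasFiniteIntegral] at this ⊢
    rwa [setLIntegral_cube_one (hf.comp fun z => ‖z‖ₑ)]

end Translation

/-! ### Slicing along a coordinate axis and integrals of derivatives. -/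

/-- The `i`-th standard basis vector. -/
abbrev stdVec (i : Fin 2) : Plane := EuclideanSpace.single i 1

/-- The point of the plane with `k`-th coordinate `s` and other coordinate `t`. -/
def slicePoint (k : Fin 2) (p : ℝ × ℝ) : Plane := WithLp.toLp 2 (fun i => if i = k then p.1 else p.2)

lemma slicePoint_eq (k : Fin 2) (s t : ℝ) :
    slicePoint k (s, t) = slicePoint k (0, t) + s • stdVec k := by
  ext i
  by_cases h : i = k <;> simp [slicePoint, h]

lemma measurePreserving_slicePoint (k : Fin 2) :
    MeasurePreserving (slicePoint k) (volume : Measure (ℝ × ℝ)) volume := by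
  have h0 : MeasurePreserving (slicePoint 0) (volume : Measure (ℝ × ℝ)) volume := by
    have h := ((EuclideanSpace.volume_preserving_symm_measurableEquiv_toLp (Fin 2)).symm
      (MeasurableEquiv.toLp 2 (Fin 2 → ℝ)).symm).comp
      ((volume_preserving_finTwoArrow ℝ).symm (MeasurableEquiv.finTwoArrow))
    have e : slicePoint 0 = (MeasurableEquiv.toLp 2 (Fin 2 → ℝ)).symm.symm ∘
        (MeasurableEquiv.finTwoArrow (α := ℝ)).symm := by
      funext p
      ext i
      fin_cases i <;> rfl
    rw [e]
    exact h
  fin_cases k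
  · exact h0
  · have : slicePoint 1 = slicePoint 0 ∘ Prod.swap := by
      funext p
      ext i
      fin_cases i <;> simp [slicePoint]
    show MeasurePreserving (slicePoint 1) _ _
    rw [this]
    exact h0.comp Measure.measurePreserving_swap

lemma measurableEmbedding_slicePoint (k : Fin 2) : MeasurableEmbedding (slicePoint k) := by
  refine Continuous.measurableEmbedding ?_ ?_
  · refine (PiLp.continuous_toLp 2 _).comp (continuous_pi fun i => ?_)
    split_ifs <;> fun_prop
  · intro p q h
    have h1 := congrArg (fun x : Plane => x k) h
    have h2 := congrArg (fun x : Plane => x (k + 1)) h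
    have hk : k + 1 ≠ k := by fin_cases k <;> decide
    simp [slicePoint, hk] at h1 h2
    exact Prod.ext h1 h2

/-- The closed unit interval centred at the origin. -/
abbrev symInterval : Set ℝ := Icc (-1 / 2 : ℝ) (1 / 2)

lemma slicePoint_preimage (k : Fin 2) :
    slicePoint k ⁻¹' unitSquare = symInterval ×ˢ symInterval := by
  ext p
  simp only [unitSquare, slicePoint, mem_preimage, mem_ofPred_eq, mem_prod]
  constructor
  · intro h
    have hk : k + 1 ≠ k := by fin_cases k <;> decide
    exact ⟨by simpa using h k, by simpa [hk] using h (k + 1)⟩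
  · rintro ⟨h1, h2⟩ i
    split_ifs <;> assumption

lemma measurableSet_unitSquare : MeasurableSet unitSquare := by
  rw [unitSquare_eq_cube]; exact measurableSet_cube _ _

lemma measurePreserving_slicePoint_torus (k : Fin 2) :
    MeasurePreserving (slicePoint k)
      ((volume.restrict symInterval).prod (volume.restrict symInterval)) torusMeasure := by
  have := (measurePreserving_slicePoint k).restrict_preimage measurableSet_unitSquare
  rwa [slicePoint_preimage, Measure.volume_eq_prod, ← Measure.prod_restrict] at this

section Fubini

variable {E : Type*} [NormedAddCommGroup E] {F : Plane → E}

lemma ae_integrable_slice (hF : Integrable F torusMeasure) (k : Fin 2) :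
    ∀ᵐ t ∂volume.restrict symInterval,
      Integrable (fun s => F (slicePoint k (s, t))) (volume.restrict symInterval) := by
  have h := (measurePreserving_slicePoint_torus k).integrable_comp_of_integrable hF
  exact h.prod_left_ae

lemma integral_torus_slice [NormedSpace ℝ E] (hF : Integrable F torusMeasure) (k : Fin 2) :
    ∫ x, F x ∂torusMeasure =
      ∫ t in symInterval, ∫ s in symInterval, F (slicePoint k (s, t)) := by
  have h := (measurePreserving_slicePoint_torus k).integrable_comp_of_integrable hF
  rw [← (measurePreserving_slicePoint_torus k).integral_comp (measurableEmbedding_slicePoint k)]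
  exact integral_prod_symm _ h

end Fubini

/-- Almost every line parallel to an axis avoids all singularities at once; this is what lets point
singularities be ignored in integrations by parts. -/
lemma slicePoint_notMem_lattice (k : Fin 2) {t : ℝ} (ht : t ∉ range ((↑) : ℤ → ℝ)) (s : ℝ) :
    slicePoint k (s, t) ∉ lattice := by
  intro h
  have hk : k + 1 ≠ k := by fin_cases k <;> decide
  obtain ⟨n, hn⟩ := h (k + 1)
  exact ht ⟨n, by simpa [slicePoint, hk] using hn.symm⟩

lemma ae_notMem_range_intCast : ∀ᵐ t : ℝ, t ∉ range ((↑) : ℤ → ℝ) :=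
  (countable_range _).ae_notMem _

lemma ae_notMem_lattice : ∀ᵐ x : Plane, x ∉ lattice := by
  refine Set.Countable.ae_notMem ?_ volume
  refine (countable_range latticeVec).mono fun x hx => ?_
  choose n hn using hx
  exact ⟨n, by ext i; simp [hn]⟩

lemma hasDerivAt_line {E : Type*} [NormedAddCommGroup E] [NormedSpace ℝ E] {F : Plane → E}
    {x : Plane} (v : Plane) {s : ℝ} (h : DifferentiableAt ℝ F (x + s • v)) :
    HasDerivAt (fun s => F (x + s • v)) (fderiv ℝ F (x + s • v) v) s := by
  have h1 : HasDerivAt (fun s : ℝ => x + s • v) v s := by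
    simpa using ((hasDerivAt_id s).smul_const v).const_add x
  exact h.hasFDerivAt.comp_hasDerivAt s h1

lemma slicePoint_half (k : Fin 2) (t : ℝ) :
    slicePoint k (1 / 2, t) = slicePoint k (-1 / 2, t) + latticeVec (Pi.single k 1) := by
  ext i
  by_cases h : i = k
  · subst h; simp [slicePoint]; norm_num
  · simp [slicePoint, h]

/-- The integral over the torus of a partial derivative vanishes, even if the function is singular
on the lattice, as long as the partial derivative is integrable. -/
theorem integral_pderivE_eq_zero {E : Type*} [NormedAddCommGroup E] [NormedSpace ℝ E]
    [CompleteSpace E] {F : Plane → E} (k : Fin 2)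
    (hper : LatticePeriodic F) (hdiff : ∀ x ∉ lattice, DifferentiableAt ℝ F x)
    (hint : Integrable (fun x => fderiv ℝ F x (stdVec k)) torusMeasure) :
    ∫ x, fderiv ℝ F x (stdVec k) ∂torusMeasure = 0 := by
  rw [integral_torus_slice hint k]
  refine integral_eq_zero_of_ae ?_
  -- At non-integer height the function is differentiable along the entire line, so the fundamental
  -- theorem of calculus applies and periodicity cancels the end values.
  filter_upwards [ae_integrable_slice hint k, ae_restrict_of_ae ae_notMem_range_intCast]
    with t h1 h2
  have hd : ∀ s ∈ uIcc (-1 / 2 : ℝ) (1 / 2), HasDerivAt (fun s => F (slicePoint k (s, t)))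
      (fderiv ℝ F (slicePoint k (s, t)) (stdVec k)) s := by
    intro s _
    have := hasDerivAt_line (F := F) (x := slicePoint k (0, t)) (stdVec k) (s := s)
      (by rw [← slicePoint_eq]; exact hdiff _ (slicePoint_notMem_lattice k h2 s))
    simpa only [← slicePoint_eq] using this
  have h3 : IntervalIntegrable (fun s => fderiv ℝ F (slicePoint k (s, t)) (stdVec k)) volume
      (-1 / 2) (1 / 2) := by
    rw [intervalIntegrable_iff_integrableOn_Icc_of_le (by norm_num)]
    exact h1
  have h4 := intervalIntegral.integral_eq_sub_of_hasDerivAt hd h3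
  rw [slicePoint_half, hper, sub_self, intervalIntegral.integral_of_le (by norm_num),
    ← integral_Icc_eq_integral_Ioc] at h4
  exact h4

/-! ### Characters, Fourier coefficients and Parseval's identity. -/

/-- The character `x ↦ exp (2πi n·x)`. -/
def char (n : Fin 2 → ℤ) (x : Plane) : ℂ :=
  Complex.exp (2 * Real.pi * Complex.I * (n 0 * x 0 + n 1 * x 1))

lemma char_eq_mFourier (n : Fin 2 → ℤ) (x : Plane) :
    char n x = UnitAddTorus.mFourier n (toTorus x) := by
  simp only [UnitAddTorus.mFourier, ContinuousMap.coe_mk, Fin.prod_univ_two, toTorus,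
    fourier_coe_apply, char, ← Complex.exp_add]
  congr 1
  push_cast
  ring

lemma latticePeriodic_char (n : Fin 2 → ℤ) : LatticePeriodic (char n) := fun m x => by
  rw [char_eq_mFourier, char_eq_mFourier, toTorus_add_latticeVec]

lemma char_add (n : Fin 2 → ℤ) (x y : Plane) : char n (x + y) = char n x * char n y := by
  simp only [char, ← Complex.exp_add, PiLp.add_apply]
  congr 1
  push_cast
  ring

lemma char_neg (n : Fin 2 → ℤ) (x : Plane) : char (-n) x = (starRingEnd ℂ) (char n x) := by
  rw [char_eq_mFourier, char_eq_mFourier, UnitAddTorus.mFourier_neg]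

lemma char_neg_right (n : Fin 2 → ℤ) (x : Plane) : char n (-x) = char (-n) x := by
  simp only [char]
  congr 1
  simp

@[simp] lemma char_zero_left (x : Plane) : char 0 x = 1 := by simp [char]

@[simp] lemma char_zero_right (n : Fin 2 → ℤ) : char n 0 = 1 := by simp [char]

@[simp] lemma norm_char (n : Fin 2 → ℤ) (x : Plane) : ‖char n x‖ = 1 := by
  have : char n x = Complex.exp ((2 * Real.pi * (n 0 * x 0 + n 1 * x 1) : ℝ) * Complex.I) := by
    simp only [char]; congr 1; push_cast; ring
  rw [this, Complex.norm_exp_ofReal_mul_I]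

lemma contDiff_char (n : Fin 2 → ℤ) {m : WithTop ℕ∞} : ContDiff ℝ m (char n) := by
  unfold char
  have h : ∀ i : Fin 2, ContDiff ℝ m fun x : Plane => ((x i : ℝ) : ℂ) := fun i =>
    Complex.ofRealCLM.contDiff.comp (EuclideanSpace.proj i : Plane →L[ℝ] ℝ).contDiff
  exact (contDiff_const.mul ((contDiff_const.mul (h 0)).add (contDiff_const.mul (h 1)))).cexp

lemma continuous_char (n : Fin 2 → ℤ) : Continuous (char n) :=
  (contDiff_char n (m := 0)).continuous

lemma fderiv_char (n : Fin 2 → ℤ) (k : Fin 2) (x : Plane) :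
    fderiv ℝ (char n) x (stdVec k) = 2 * Real.pi * Complex.I * n k * char n x := by
  have h := hasDerivAt_line (F := char n) (x := x) (stdVec k) (s := 0)
    ((contDiff_char n (m := 1)).differentiable (by simp)).differentiableAt
  simp only [zero_smul, add_zero] at h
  refine h.unique ?_
  have e : (fun s : ℝ => char n (x + s • stdVec k)) =
      fun s : ℝ => char n x * Complex.exp (s * (2 * Real.pi * Complex.I * n k)) := by
    funext s
    rw [char_add]
    congr 1
    simp only [char]
    congr 1
    fin_cases k <;> simp <;> ring
  rw [e]
  have h2 : HasDerivAt (fun s : ℝ => ((s : ℂ) * (2 * Real.pi * Complex.I * n k)))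
      (2 * Real.pi * Complex.I * n k) 0 := by
    simpa using (HasDerivAt.ofReal_comp (hasDerivAt_id (0 : ℝ))).mul_const
      (2 * Real.pi * Complex.I * n k : ℂ)
  have h3 := (h2.cexp).const_mul (char n x)
  convert! h3 using 1
  simp; ring

/-- The linear gain in x costs one power of the frequency, which is exactly the decay of the Fourier
coefficients of ∇^⊥V. -/
lemma norm_char_sub_one_le (n : Fin 2 → ℤ) (x : Plane) :
    ‖char n x - 1‖ ≤ 2 * Real.pi * (|(n 0 : ℝ)| + |(n 1 : ℝ)|) * ‖x‖ := by
  have : char n x = Complex.exp (Complex.I * (2 * Real.pi * (n 0 * x 0 + n 1 * x 1) : ℝ)) := by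
    simp only [char]; congr 1; push_cast; ring
  rw [this]
  refine (Real.norm_exp_I_mul_ofReal_sub_one_le).trans ?_
  rw [Real.norm_eq_abs, abs_mul, abs_of_pos Real.two_pi_pos, mul_assoc (2 * Real.pi)]
  refine mul_le_mul_of_nonneg_left ?_ Real.two_pi_pos.le
  have h0 : |x 0| ≤ ‖x‖ := PiLp.norm_apply_le x 0
  have h1 : |x 1| ≤ ‖x‖ := PiLp.norm_apply_le x 1
  calc |(n 0 : ℝ) * x 0 + n 1 * x 1| ≤ |(n 0 : ℝ)| * |x 0| + |(n 1 : ℝ)| * |x 1| := by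
        rw [← abs_mul, ← abs_mul]; exact abs_add_le _ _
    _ ≤ |(n 0 : ℝ)| * ‖x‖ + |(n 1 : ℝ)| * ‖x‖ := by gcongr
    _ = _ := by ring

/-- The Fourier coefficients of a function on the torus. -/
def coef (f : Plane → ℝ) (n : Fin 2 → ℤ) : ℂ := ∫ x, char (-n) x * f x ∂torusMeasure

lemma integrable_char_mul {f : Plane → ℝ} (hf : Integrable f torusMeasure) (n : Fin 2 → ℤ) :
    Integrable (fun x => char n x * f x) torusMeasure := by
  refine hf.ofReal.bdd_mul (c := 1) (continuous_char n).aestronglyMeasurable ?_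
  exact ae_of_all _ fun x => by simp

lemma coef_neg (f : Plane → ℝ) (n : Fin 2 → ℤ) : coef f (-n) = (starRingEnd ℂ) (coef f n) := by
  rw [coef, coef, ← integral_conj]
  simp [char_neg]

lemma coef_sub {f g : Plane → ℝ} (hf : Integrable f torusMeasure) (hg : Integrable g torusMeasure)
    (n : Fin 2 → ℤ) : coef (fun x => f x - g x) n = coef f n - coef g n := by
  rw [coef, coef, coef, ← integral_sub (integrable_char_mul hf _) (integrable_char_mul hg _)]
  exact integral_congr_ae (ae_of_all _ fun x => by push_cast; ring)

lemma coef_add {f g : Plane → ℝ} (hf : Integrable f torusMeasure) (hg : Integrable g torusMeasure)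
    (n : Fin 2 → ℤ) : coef (fun x => f x + g x) n = coef f n + coef g n := by
  rw [coef, coef, coef, ← integral_add (integrable_char_mul hf _) (integrable_char_mul hg _)]
  exact integral_congr_ae (ae_of_all _ fun x => by push_cast; ring)

lemma coef_neg_fun (f : Plane → ℝ) (n : Fin 2 → ℤ) : coef (fun x => -f x) n = -coef f n := by
  rw [coef, coef, ← integral_neg]
  exact integral_congr_ae (ae_of_all _ fun x => by push_cast; ring)

/-- The function in `L²` of the torus induced by a square integrable function. -/
def torusLp {f : Plane → ℝ} (hf : MemLp f 2 torusMeasure) :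
    Lp ℂ 2 (volume : Measure (UnitAddTorus (Fin 2))) :=
  (hf.ofReal.comp_measurePreserving measurePreserving_ofTorus).toLp

lemma torusLp_ae {f : Plane → ℝ} (hf : MemLp f 2 torusMeasure) :
    torusLp hf =ᵐ[volume] fun t => ((f (ofTorus t) : ℝ) : ℂ) :=
  (hf.ofReal.comp_measurePreserving measurePreserving_ofTorus).coeFn_toLp

lemma integral_comp_ofTorus {E : Type*} [NormedAddCommGroup E] [NormedSpace ℝ E] {f : Plane → E}
    (hf : AEStronglyMeasurable f torusMeasure) :
    ∫ t, f (ofTorus t) = ∫ x, f x ∂torusMeasure := by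
  rw [← measurePreserving_ofTorus.map_eq,
    integral_map measurable_ofTorus.aemeasurable (by rwa [measurePreserving_ofTorus.map_eq])]

lemma mFourierCoeff_torusLp {f : Plane → ℝ} (hf : MemLp f 2 torusMeasure) (n : Fin 2 → ℤ) :
    UnitAddTorus.mFourierCoeff (torusLp hf) n = coef f n := by
  have h1 : AEStronglyMeasurable (fun x => char (-n) x * (f x : ℂ)) torusMeasure :=
    (continuous_char _).aestronglyMeasurable.mul hf.ofReal.1
  rw [coef, ← integral_comp_ofTorus h1, UnitAddTorus.mFourierCoeff]
  refine integral_congr_ae ((torusLp_ae hf).mono fun t ht => ?_)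
  simp only [ht, char_eq_mFourier, toTorus_ofTorus, smul_eq_mul]

/-- Parseval's identity. -/
theorem hasSum_coef_mul {f g : Plane → ℝ} (hf : MemLp f 2 torusMeasure)
    (hg : MemLp g 2 torusMeasure) :
    HasSum (fun n => (starRingEnd ℂ) (coef f n) * coef g n)
      ((∫ x, f x * g x ∂torusMeasure : ℝ) : ℂ) := by
  have h := UnitAddTorus.hasSum_prod_mFourierCoeff (torusLp hf) (torusLp hg)
  simp only [mFourierCoeff_torusLp] at h
  convert! h using 1
  rw [← integral_comp_ofTorus (f := fun x => f x * g x) (hf.1.mul hg.1), ← integral_complex_ofReal]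
  refine integral_congr_ae ?_
  filter_upwards [torusLp_ae hf, torusLp_ae hg] with t h1 h2
  simp [h1, h2]

theorem hasSum_sq_coef {f : Plane → ℝ} (hf : MemLp f 2 torusMeasure) :
    HasSum (fun n => ‖coef f n‖ ^ 2) (∫ x, f x ^ 2 ∂torusMeasure) := by
  have h := hasSum_coef_mul hf hf
  have e : (fun n => (starRingEnd ℂ) (coef f n) * coef f n) =
      fun n => ((‖coef f n‖ ^ 2 : ℝ) : ℂ) := by
    funext n
    rw [mul_comm, Complex.mul_conj, Complex.normSq_eq_norm_sq]
  rw [e, Complex.hasSum_ofReal] at h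
  simpa only [sq (f _)] using h

lemma ae_eq_of_coef_eq {f g : Plane → ℝ} (hf : MemLp f 2 torusMeasure)
    (hg : MemLp g 2 torusMeasure) (h : ∀ n, coef f n = coef g n) : f =ᵐ[torusMeasure] g := by
  have hs := hasSum_sq_coef (hf.sub hg)
  have hz : ∀ n, coef (f - g) n = 0 := fun n => by
    have := coef_sub (hf.integrable (by norm_num)) (hg.integrable (by norm_num)) n
    rw [h, sub_self] at this
    exact this
  simp only [hz, norm_zero, ne_eq, OfNat.ofNat_ne_zero, not_false_eq_true, zero_pow] at hs
  have h0 := hs.unique hasSum_zero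
  rw [integral_eq_zero_iff_of_nonneg (fun x => sq_nonneg _) (hf.sub hg).integrable_sq] at h0
  filter_upwards [h0] with x hx
  simpa [sub_eq_zero] using hx

/-- The Riesz–Fischer theorem for real functions on the torus. -/
theorem exists_coef_eq {c : (Fin 2 → ℤ) → ℂ} (hc : Summable fun n => ‖c n‖ ^ 2)
    (hsymm : ∀ n, c (-n) = (starRingEnd ℂ) (c n)) :
    ∃ g : Plane → ℝ, LatticePeriodic g ∧ MemLp g 2 torusMeasure ∧ ∀ n, coef g n = c n := by
  have hmem : Memℓp c 2 := by
    rw [memℓp_gen_iff (by norm_num)]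
    simpa using hc
  set G := (UnitAddTorus.mFourierBasis (d := Fin 2)).repr.symm ⟨c, hmem⟩ with hG
  have hcoef : ∀ n, UnitAddTorus.mFourierCoeff G n = c n := fun n => by
    rw [← UnitAddTorus.mFourierBasis_repr, hG, LinearIsometryEquiv.apply_symm_apply]
  have hGm := Lp.memLp G
  have h1 := hGm.comp_measurePreserving measurePreserving_toTorus
  refine ⟨fun x => (G (toTorus x)).re, fun n x => by simp only [toTorus_add_latticeVec], h1.re,
    fun n => ?_⟩
  have hint : ∀ m, ∫ x, char (-m) x * G (toTorus x) ∂torusMeasure = c m := fun m => by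
    have h2 : AEStronglyMeasurable (fun x => char (-m) x * G (toTorus x)) torusMeasure :=
      (continuous_char _).aestronglyMeasurable.mul h1.1
    rw [← integral_comp_ofTorus h2, ← hcoef m, UnitAddTorus.mFourierCoeff]
    simp only [toTorus_ofTorus, char_eq_mFourier, smul_eq_mul]
  have hGi : Integrable (fun x => G (toTorus x)) torusMeasure := h1.integrable (by norm_num)
  have hi : ∀ m, Integrable (fun x => char m x * G (toTorus x)) torusMeasure := fun m =>
    hGi.bdd_mul (c := 1) (continuous_char m).aestronglyMeasurable (ae_of_all _ fun x => by simp)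
  have hi2 : Integrable (fun x => (starRingEnd ℂ) (char n x * G (toTorus x))) torusMeasure :=
    (hi n).norm.mono' (Complex.continuous_conj.comp_aestronglyMeasurable (hi n).1)
      (ae_of_all _ fun x => by simp)
  -- Taking the real part averages c(n) with the conjugate of c(−n); the symmetry hypothesis makes
  -- the two equal.
  have e : ∀ x, char (-n) x * (((G (toTorus x)).re : ℝ) : ℂ) =
      (char (-n) x * G (toTorus x) + (starRingEnd ℂ) (char n x * G (toTorus x))) / 2 := fun x => by
    rw [Complex.re_eq_add_conj, map_mul, char_neg]; ring
  simp only [coef, e]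
  rw [integral_div, integral_add (hi _) hi2, hint, integral_conj]
  have h3 := hint (-n)
  rw [neg_neg] at h3
  rw [h3, hsymm, Complex.conj_conj]
  ring

/-! ### Convolution of integrable kernels with bounded periodic functions. -/

/-- Measurable periodic functions bounded by `M`. -/
structure IsBddPeriodic (f : Plane → ℝ) (M : ℝ) : Prop where
  periodic : LatticePeriodic f
  aesm : AEStronglyMeasurable f
  bound : ∀ x, |f x| ≤ M

namespace IsBddPeriodic

variable {f : Plane → ℝ} {M : ℝ}

lemma nonneg (hf : IsBddPeriodic f M) : 0 ≤ M := (abs_nonneg _).trans (hf.bound 0)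

lemma memLp (hf : IsBddPeriodic f M) (p : ENNReal) : MemLp f p torusMeasure :=
  MemLp.of_bound hf.aesm.restrict M (ae_of_all _ hf.bound)

lemma integrable (hf : IsBddPeriodic f M) : Integrable f torusMeasure :=
  (hf.memLp 1).integrable le_rfl

lemma locallyIntegrable (hf : IsBddPeriodic f M) : LocallyIntegrable f :=
  hf.periodic.locallyIntegrable hf.integrable

lemma integrable_mul (hf : IsBddPeriodic f M) {K : Plane → ℝ} (hK : Integrable K torusMeasure) :
    Integrable (fun y => K y * f y) torusMeasure :=
  hK.mul_bdd hf.aesm.restrict (ae_of_all _ hf.bound)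

lemma add_right (hf : IsBddPeriodic f M) (y : Plane) : IsBddPeriodic (fun x => f (x + y)) M :=
  ⟨hf.periodic.add_right y, hf.aesm.comp_measurePreserving (measurePreserving_add_right volume y),
    fun _ => hf.bound _⟩

lemma sub_left (hf : IsBddPeriodic f M) (y : Plane) : IsBddPeriodic (fun x => f (y - x)) M :=
  ⟨hf.periodic.sub_left y, hf.aesm.comp_measurePreserving (Measure.measurePreserving_sub_left volume y),
    fun _ => hf.bound _⟩

lemma sub (hf : IsBddPeriodic f M) {g : Plane → ℝ} {N : ℝ} (hg : IsBddPeriodic g N) :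
    IsBddPeriodic (fun x => f x - g x) (M + N) :=
  ⟨hf.periodic.comp₂ hg.periodic _, hf.aesm.sub hg.aesm, fun x =>
    (abs_sub _ _).trans (add_le_add (hf.bound x) (hg.bound x))⟩

lemma neg (hf : IsBddPeriodic f M) : IsBddPeriodic (fun x => -f x) M :=
  ⟨hf.periodic.comp _, hf.aesm.neg, fun x => by rw [abs_neg]; exact hf.bound x⟩

end IsBddPeriodic

lemma torusConv_eq {K f : Plane → ℝ} (hK : LatticePeriodic K) (hf : LatticePeriodic f)
    (x : Plane) : torusConv K f x = ∫ z, K z * f (x - z) ∂torusMeasure := by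
  have h := integral_torus_sub_left (f := fun y => K (x - y) * f y)
    ((hK.sub_left x).comp₂ hf _) x
  simp only [sub_sub_cancel] at h
  exact h.symm

lemma latticePeriodic_torusConv {K : Plane → ℝ} (hK : LatticePeriodic K) (f : Plane → ℝ) :
    LatticePeriodic (torusConv K f) := fun n x => by
  simp only [torusConv]
  congr 1
  funext y
  rw [add_sub_right_comm, hK]

lemma aestronglyMeasurable_sub_mul {K f : Plane → ℝ} (hK : AEStronglyMeasurable K)
    (hf : AEStronglyMeasurable f) :
    AEStronglyMeasurable (fun p : Plane × Plane => K (p.1 - p.2) * f p.2)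
      ((volume : Measure Plane).prod torusMeasure) := by
  have h1 : AEStronglyMeasurable (fun p : Plane × Plane => K (p.1 - p.2) * f p.2)
      ((volume : Measure Plane).prod volume) :=
    (hK.comp_quasiMeasurePreserving (quasiMeasurePreserving_sub volume volume)).mul hf.comp_snd
  refine h1.mono_ac ?_
  exact Measure.AbsolutelyContinuous.rfl.prod Measure.restrict_le_self.absolutelyContinuous

lemma abs_torusConv_le {K f : Plane → ℝ} {M : ℝ} (hKp : LatticePeriodic K)
    (hK : Integrable K torusMeasure) (hf : IsBddPeriodic f M) (x : Plane) :
    |torusConv K f x| ≤ (∫ z, |K z| ∂torusMeasure) * M := by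
  rw [torusConv_eq hKp hf.periodic, ← integral_mul_const]
  refine abs_integral_le_integral_abs.trans ?_
  refine integral_mono_of_nonneg (ae_of_all _ fun z => abs_nonneg _) (hK.abs.mul_const M)
    (ae_of_all _ fun z => ?_)
  simp only [abs_mul]
  exact mul_le_mul_of_nonneg_left (hf.bound _) (abs_nonneg _)

lemma isBddPeriodic_torusConv {K f : Plane → ℝ} {M : ℝ} (hKp : LatticePeriodic K)
    (hK : Integrable K torusMeasure) (hf : IsBddPeriodic f M) :
    IsBddPeriodic (torusConv K f) ((∫ z, |K z| ∂torusMeasure) * M) :=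
  ⟨latticePeriodic_torusConv hKp f,
    (aestronglyMeasurable_sub_mul (hKp.aestronglyMeasurable hK.1) hf.aesm).integral_prod_right',
    abs_torusConv_le hKp hK hf⟩

lemma integrable_sub_mul_torus {K f : Plane → ℝ} {M : ℝ} (hKp : LatticePeriodic K)
    (hK : Integrable K torusMeasure) (hf : IsBddPeriodic f M) :
    Integrable (fun p : Plane × Plane => K (p.1 - p.2) * f p.2)
      (torusMeasure.prod torusMeasure) := by
  have hm := (aestronglyMeasurable_sub_mul (hKp.aestronglyMeasurable hK.1) hf.aesm).mono_ac
    (show torusMeasure.prod torusMeasure ≪ volume.prod torusMeasure from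
      Measure.restrict_le_self.absolutelyContinuous.prod Measure.AbsolutelyContinuous.rfl)
  rw [integrable_prod_iff' hm]
  refine ⟨ae_of_all _ fun y => ?_, ?_⟩
  · have := (hKp.integrable_add hK (-y)).mul_const (f y)
    simpa only [← sub_eq_add_neg] using this
  · refine Integrable.of_bound (C := (∫ z, |K z| ∂torusMeasure) * M)
      hm.norm.prod_swap.integral_prod_right' (ae_of_all _ fun y => ?_)
    simp only [norm_mul, Real.norm_eq_abs]
    rw [integral_mul_const]
    have h := integral_torus_add (hKp.comp fun z => |z|) (-y)
    simp only [← sub_eq_add_neg] at h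
    rw [h, abs_mul, abs_abs, abs_of_nonneg (integral_nonneg fun z => abs_nonneg _)]
    exact mul_le_mul_of_nonneg_left (hf.bound _) (integral_nonneg fun z => abs_nonneg _)

/-- Fubini's theorem for a convolution tested against a bounded function. -/
lemma integral_torusConv_mul {E : Type*} [NormedAddCommGroup E] [NormedSpace ℝ E] [CompleteSpace E]
    {K f : Plane → ℝ} {φ : Plane → E} {M : ℝ}
    (hKp : LatticePeriodic K) (hK : Integrable K torusMeasure) (hf : IsBddPeriodic f M)
    (hφc : Continuous φ) {C : ℝ} (hφ : ∀ x, ‖φ x‖ ≤ C) :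
    ∫ x, torusConv K f x • φ x ∂torusMeasure =
      ∫ y, f y • ∫ x, K (x - y) • φ x ∂torusMeasure ∂torusMeasure := by
  have h0 := integrable_sub_mul_torus hKp hK hf
  have h1 : Integrable (fun p : Plane × Plane => (K (p.1 - p.2) * f p.2) • φ p.1)
      (torusMeasure.prod torusMeasure) := by
    refine (h0.norm.mul_const C).mono'
      (h0.1.smul (hφc.comp continuous_fst).aestronglyMeasurable) (ae_of_all _ fun p => ?_)
    rw [norm_smul]
    exact mul_le_mul_of_nonneg_left (hφ _) (norm_nonneg _)
  have h2 := integral_integral_swap (f := fun x y => (K (x - y) * f y) • φ x) h1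
  simp only [integral_smul_const] at h2
  refine h2.trans (integral_congr_ae (ae_of_all _ fun y => ?_))
  simp only [mul_comm _ (f y), mul_smul, integral_smul]

/-- The Fourier coefficients of a convolution. -/
lemma coef_torusConv {K f : Plane → ℝ} {M : ℝ} (hKp : LatticePeriodic K)
    (hK : Integrable K torusMeasure) (hf : IsBddPeriodic f M) (n : Fin 2 → ℤ) :
    coef (torusConv K f) n = coef K n * coef f n := by
  have h := integral_torusConv_mul hKp hK hf (continuous_char (-n)) (C := 1)
    (fun x => (norm_char _ _).le)
  have h1 : ∀ y, ∫ x, K (x - y) • char (-n) x ∂torusMeasure = char (-n) y * coef K n := fun y => by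
    have h2 := integral_torus_add (f := fun x => K (x - y) • char (-n) x)
      ((hKp.sub_right y).comp₂ (latticePeriodic_char _) (fun a b => a • b)) y
    rw [← h2, coef, ← integral_const_mul]
    refine integral_congr_ae (ae_of_all _ fun x => ?_)
    simp only [add_sub_cancel_right, char_add, Complex.real_smul]
    ring
  simp only [h1] at h
  calc coef (torusConv K f) n = ∫ x, torusConv K f x • char (-n) x ∂torusMeasure :=
        integral_congr_ae (ae_of_all _ fun x => by simp only [Complex.real_smul]; ring)
    _ = ∫ y, f y • (char (-n) y * coef K n) ∂torusMeasure := h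
    _ = _ := by
        rw [coef.eq_def f, ← integral_const_mul]
        exact integral_congr_ae (ae_of_all _ fun x => by simp only [Complex.real_smul]; ring)

/-- The Fourier coefficients of a translate. -/
lemma coef_add_right {f : Plane → ℝ} (hf : LatticePeriodic f) (z : Plane) (n : Fin 2 → ℤ) :
    coef (fun x => f (x + z)) n = char n z * coef f n := by
  have h := integral_torus_add (f := fun x => char (-n) (x - z) * f x)
    (((latticePeriodic_char (-n)).sub_right z).comp₂ hf fun a b => a * (b : ℂ)) z
  simp only [add_sub_cancel_right] at h
  rw [coef, h, coef, ← integral_const_mul]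
  refine integral_congr_ae (ae_of_all _ fun x => ?_)
  simp only [sub_eq_add_neg, char_add, char_neg_right, neg_neg]
  ring

/-- The Fourier coefficients of a partial derivative; singularities on the lattice are allowed as
long as the function and its derivative are integrable. -/
lemma coef_pderiv {F : Plane → ℝ} (k : Fin 2) (hper : LatticePeriodic F)
    (hdiff : ∀ x ∉ lattice, DifferentiableAt ℝ F x) (hF : Integrable F torusMeasure)
    (hF' : Integrable (pderiv k F) torusMeasure) (n : Fin 2 → ℤ) :
    coef (pderiv k F) n = 2 * Real.pi * Complex.I * n k * coef F n := by
  have hd : ∀ x ∉ lattice, HasFDerivAt (fun x => F x • char (-n) x)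
      (F x • fderiv ℝ (char (-n)) x + (fderiv ℝ F x).smulRight (char (-n) x)) x := fun x hx =>
    (hdiff x hx).hasFDerivAt.smul
      (((contDiff_char (-n) (m := 1)).differentiable (by simp)).differentiableAt.hasFDerivAt)
  have hae : (fun x => fderiv ℝ (fun x => F x • char (-n) x) x (stdVec k)) =ᵐ[torusMeasure]
      fun x => char (-n) x * (pderiv k F x : ℂ) +
        -(2 * Real.pi * Complex.I * n k) * (char (-n) x * F x) := by
    have : ∀ᵐ x ∂torusMeasure, x ∉ lattice := ae_torus_of_ae_volume ae_notMem_lattice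
    filter_upwards [this] with x hx
    rw [(hd x hx).fderiv]
    simp only [_root_.add_apply, _root_.smul_apply, fderiv_char,
      ContinuousLinearMap.smulRight_apply, Complex.real_smul, pderiv, Pi.neg_apply]
    push_cast
    ring
  have i1 := integrable_char_mul hF' (-n)
  have i2 := (integrable_char_mul hF (-n)).const_mul (-(2 * Real.pi * Complex.I * n k))
  have h := integral_pderivE_eq_zero (F := fun x => F x • char (-n) x) k
    (hper.comp₂ (latticePeriodic_char _) fun a b => a • b)
    (fun x hx => (hd x hx).differentiableAt) ((i1.add i2).congr hae.symm)
  rw [integral_congr_ae hae, integral_add i1 i2, integral_const_mul] at h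
  rw [coef, coef]
  linear_combination h

/-! ### The lattice and homogeneous singularities at its points. -/

lemma isClosed_lattice : IsClosed lattice := by
  have : lattice = ⋂ i, (fun x : Plane => x i) ⁻¹' range ((↑) : ℤ → ℝ) := by
    ext x
    simp only [lattice, mem_ofPred_eq, mem_iInter, mem_preimage, mem_range, eq_comm]
  rw [this]
  exact isClosed_iInter fun i => Int.isClosedEmbedding_coe_real.isClosed_range.preimage
    (by fun_prop)

lemma isOpen_compl_lattice : IsOpen latticeᶜ := isClosed_lattice.isOpen_compl

lemma zero_mem_lattice : (0 : Plane) ∈ lattice := fun i => ⟨0, by simp⟩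

lemma mem_lattice_iff {x : Plane} : x ∈ lattice ↔ ∃ n, x = latticeVec n := by
  constructor
  · intro h
    choose n hn using h
    exact ⟨n, by ext i; simp [hn]⟩
  · rintro ⟨n, rfl⟩ i
    exact ⟨n i, rfl⟩

lemma notMem_lattice_of_abs_lt {x : Plane} (hx : x ≠ 0) (h : ∀ i, |x i| < 1) : x ∉ lattice := by
  intro hl
  obtain ⟨n, rfl⟩ := mem_lattice_iff.1 hl
  apply hx
  ext i
  have h1 := h i
  have h2 : |n i| < 1 := by
    rw [latticeVec_apply, ← Int.cast_abs, ← Int.cast_one (R := ℝ), Int.cast_lt] at h1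
    exact h1
  simp [Int.abs_lt_one_iff.1 h2]

/-- The complement of the nonzero lattice points. -/
def puncturedPlane : Set Plane := latticeᶜ ∪ {0}

lemma mem_puncturedPlane_of_abs_lt {x : Plane} (h : ∀ i, |x i| < 1) : x ∈ puncturedPlane := by
  by_cases hx : x = 0
  · exact Or.inr hx
  · exact Or.inl (notMem_lattice_of_abs_lt hx h)

lemma isOpen_puncturedPlane : IsOpen puncturedPlane := by
  have : puncturedPlane = latticeᶜ ∪ Metric.ball 0 1 := by
    ext x
    constructor
    · rintro (h | h)
      · exact Or.inl h
      · rw [mem_singleton_iff.1 h]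
        exact Or.inr (Metric.mem_ball_self one_pos)
    · rintro (h | h)
      · exact Or.inl h
      · refine mem_puncturedPlane_of_abs_lt fun i => ?_
        exact (PiLp.norm_apply_le x i).trans_lt (by simpa using h)
  rw [this]
  exact isOpen_compl_lattice.union Metric.isOpen_ball

/-- The closed square of half side `3 / 4` centred at the origin. -/
def bigSquare : Set Plane := {x | ∀ i, |x i| ≤ 3 / 4}

/-- The half side 3/4 lies between 1/2 and 1: the square contains the fundamental domain with a
margin of 1/4, and its only lattice point is the origin. -/
lemma bigSquare_subset : bigSquare ⊆ puncturedPlane := fun _ hx =>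
  mem_puncturedPlane_of_abs_lt fun i => (hx i).trans_lt (by norm_num)

lemma norm_le_of_abs_le {x : Plane} {r : ℝ} (h : ∀ i, |x i| ≤ r) : ‖x‖ ≤ 2 * r := by
  have hr : 0 ≤ r := (abs_nonneg _).trans (h 0)
  rw [EuclideanSpace.norm_eq, Fin.sum_univ_two]
  refine Real.sqrt_le_iff.2 ⟨by positivity, ?_⟩
  have h0 := pow_le_pow_left₀ (abs_nonneg _) (h 0) 2
  have h1 := pow_le_pow_left₀ (abs_nonneg _) (h 1) 2
  simp only [Real.norm_eq_abs]
  nlinarith [sq_nonneg r]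

lemma isCompact_bigSquare : IsCompact bigSquare := by
  refine Metric.isCompact_of_isClosed_isBounded ?_ ?_
  · have : bigSquare = ⋂ i, (fun x : Plane => |x i|) ⁻¹' Iic (3 / 4) := by
      ext x; simp [bigSquare]
    rw [this]
    exact isClosed_iInter fun i => isClosed_Iic.preimage (by fun_prop)
  · exact (Metric.isBounded_closedBall (x := (0 : Plane)) (r := 2 * (3 / 4))).subset fun x hx => by
      simpa using norm_le_of_abs_le hx

lemma contDiffOn_pderiv {f : Plane → ℝ} {s : Set Plane} (hs : IsOpen s)
    (hf : ContDiffOn ℝ (⊤ : ℕ∞) f s) (i : Fin 2) : ContDiffOn ℝ (⊤ : ℕ∞) (pderiv i f) s :=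
  (hf.fderiv_of_isOpen hs (m := (⊤ : ℕ∞)) (by simp)).clm_apply contDiffOn_const

lemma _root_.ContDiffOn.differentiableAt_of_isOpen {f : Plane → ℝ} {s : Set Plane} (hs : IsOpen s)
    (hf : ContDiffOn ℝ (⊤ : ℕ∞) f s) {x : Plane} (hx : x ∈ s) : DifferentiableAt ℝ f x :=
  (hf.contDiffAt (hs.mem_nhds hx)).differentiableAt (by simp)

lemma latticePeriodic_pderiv {f : Plane → ℝ} (hf : LatticePeriodic f) (i : Fin 2) :
    LatticePeriodic (pderiv i f) := fun n x => by
  rw [pderiv, pderiv, ← fderiv_comp_add_right]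
  congr 2
  funext y
  exact hf n y

/-- Smooth functions on the punctured plane that are homogeneous of degree `-m`. -/
structure IsHomog (m : ℕ) (h : Plane → ℝ) : Prop where
  smooth : ContDiffOn ℝ (⊤ : ℕ∞) h {0}ᶜ
  smul : ∀ l : ℝ, 0 < l → ∀ x, x ≠ 0 → h (l • x) = (l⁻¹) ^ m * h x

/-- The additive constant `b` covers the logarithm, which is not homogeneous but gains log l under
dilation; its first derivatives are then homogeneous of degree −1. -/
lemma pderiv_smul {h : Plane → ℝ} (hs : ContDiffOn ℝ (⊤ : ℕ∞) h {0}ᶜ) {l a b : ℝ} (hl : 0 < l)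
    (hh : ∀ x, x ≠ 0 → h (l • x) = a * h x + b) {x : Plane} (hx : x ≠ 0) (i : Fin 2) :
    pderiv i h (l • x) = l⁻¹ * (a * pderiv i h x) := by
  have hlx : l • x ≠ 0 := smul_ne_zero hl.ne' hx
  have hd : HasFDerivAt h (fderiv ℝ h x) x :=
    (hs.differentiableAt_of_isOpen isOpen_compl_singleton hx).hasFDerivAt
  have hdl : HasFDerivAt h (fderiv ℝ h (l • x)) (l • x) :=
    (hs.differentiableAt_of_isOpen isOpen_compl_singleton hlx).hasFDerivAt
  have h1 : HasFDerivAt (fun y => h (l • y)) (l • fderiv ℝ h (l • x)) x := by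
    have := hdl.comp x ((hasFDerivAt_id x).const_smul l)
    convert! this using 1
    ext v; simp
  have h2 : HasFDerivAt (fun y => h (l • y)) (a • fderiv ℝ h x) x := by
    refine ((hd.const_mul a).add_const b).congr_of_eventuallyEq ?_
    filter_upwards [isOpen_compl_singleton.mem_nhds hx] with y hy using hh y hy
  have h3 := DFunLike.congr_fun (h1.unique h2) (stdVec i)
  simp only [_root_.smul_apply, smul_eq_mul] at h3
  simp only [pderiv]
  rw [← h3, inv_mul_cancel_left₀ hl.ne']

lemma IsHomog.pderiv {m : ℕ} {h : Plane → ℝ} (hh : IsHomog m h) (i : Fin 2) :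
    IsHomog (m + 1) (pderiv i h) where
  smooth := contDiffOn_pderiv isOpen_compl_singleton hh.smooth i
  smul l hl x hx := by
    rw [pderiv_smul hh.smooth hl (a := (l⁻¹) ^ m) (b := 0)
      (fun y hy => by rw [hh.smul l hl y hy, add_zero]) hx i]
    ring

lemma contDiffOn_log_norm : ContDiffOn ℝ (⊤ : ℕ∞) (fun x : Plane => Real.log ‖x‖) {0}ᶜ :=
  fun _ hx => (contDiffAt_id.norm ℝ hx).contDiffWithinAt.log (norm_ne_zero_iff.2 hx)

lemma isHomog_pderiv_log (i : Fin 2) : IsHomog 1 (pderiv i fun x : Plane => Real.log ‖x‖) where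
  smooth := contDiffOn_pderiv isOpen_compl_singleton contDiffOn_log_norm i
  smul l hl x hx := by
    rw [pderiv_smul contDiffOn_log_norm hl (a := 1) (b := Real.log l) _ hx i]
    · ring
    · intro y hy
      rw [norm_smul, Real.norm_of_nonneg hl.le,
        Real.log_mul hl.ne' (norm_ne_zero_iff.2 hy)]
      ring

lemma IsHomog.const_mul {m : ℕ} {h : Plane → ℝ} (hh : IsHomog m h) (c : ℝ) :
    IsHomog m (fun x => c * h x) where
  smooth := contDiffOn_const.mul hh.smooth
  smul l hl x hx := by rw [hh.smul l hl x hx]; ring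

/-- A continuous function is bounded on the unit circle, and homogeneity spreads the bound along
rays. -/
lemma IsHomog.exists_bound {m : ℕ} {h : Plane → ℝ} (hh : IsHomog m h) :
    ∃ C, 0 ≤ C ∧ ∀ x, x ≠ 0 → |h x| ≤ C * (‖x‖⁻¹) ^ m := by
  obtain ⟨C, hC⟩ := (isCompact_sphere (0 : Plane) 1).exists_bound_of_continuousOn
    (hh.smooth.continuousOn.mono fun x hx => by
      rintro rfl; simp at hx)
  refine ⟨max C 0, le_max_right _ _, fun x hx => ?_⟩
  have hn : 0 < ‖x‖ := norm_pos_iff.2 hx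
  have hu : ‖x‖⁻¹ • x ≠ 0 := smul_ne_zero (inv_ne_zero hn.ne') hx
  have h1 := hh.smul ‖x‖ hn _ hu
  rw [smul_inv_smul₀ hn.ne'] at h1
  rw [h1, abs_mul, abs_of_nonneg (by positivity), mul_comm]
  refine mul_le_mul_of_nonneg_right ((hC _ ?_).trans (le_max_left _ _)) (by positivity)
  simp [norm_smul, hn.ne']

/-- Periodic functions, smooth off the lattice, with a singularity of order `m` at the origin:
the sum of a smooth function and a function homogeneous of degree `-m`. -/
structure HasSing (m : ℕ) (f : Plane → ℝ) : Prop where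
  smooth : ContDiffOn ℝ (⊤ : ℕ∞) f latticeᶜ
  periodic : LatticePeriodic f
  decomp : ∃ f₀ h : Plane → ℝ, ContDiffOn ℝ (⊤ : ℕ∞) f₀ puncturedPlane ∧ IsHomog m h ∧
    ∀ x ∈ latticeᶜ, f x = f₀ x + h x

lemma ne_zero_of_notMem_lattice {x : Plane} (hx : x ∈ latticeᶜ) : x ≠ 0 := by
  rintro rfl; exact hx zero_mem_lattice

lemma pderiv_add_of_notMem_lattice {f f₀ h : Plane → ℝ}
    (h₀ : ContDiffOn ℝ (⊤ : ℕ∞) f₀ puncturedPlane) (hh : ContDiffOn ℝ (⊤ : ℕ∞) h {0}ᶜ)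
    (hf : ∀ x ∈ latticeᶜ, f x = f₀ x + h x) (i : Fin 2) :
    ∀ x ∈ latticeᶜ, pderiv i f x = pderiv i f₀ x + pderiv i h x := fun x hx => by
  have e : f =ᶠ[𝓝 x] f₀ + h := by
    filter_upwards [isOpen_compl_lattice.mem_nhds hx] with y hy using hf y hy
  rw [pderiv, e.fderiv_eq, fderiv_add
    (h₀.differentiableAt_of_isOpen isOpen_puncturedPlane (Or.inl hx))
    (hh.differentiableAt_of_isOpen isOpen_compl_singleton (ne_zero_of_notMem_lattice hx))]
  rfl

lemma HasSing.pderiv {m : ℕ} {f : Plane → ℝ} (hf : HasSing m f) (i : Fin 2) :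
    HasSing (m + 1) (pderiv i f) where
  smooth := contDiffOn_pderiv isOpen_compl_lattice hf.smooth i
  periodic := latticePeriodic_pderiv hf.periodic i
  decomp := by
    obtain ⟨f₀, h, h₀, hh, he⟩ := hf.decomp
    exact ⟨_, _, contDiffOn_pderiv isOpen_puncturedPlane h₀ i, hh.pderiv i,
      pderiv_add_of_notMem_lattice h₀ hh.smooth he i⟩

lemma HasSing.neg {m : ℕ} {f : Plane → ℝ} (hf : HasSing m f) : HasSing m (fun x => -f x) where
  smooth := hf.smooth.neg
  periodic := hf.periodic.comp _
  decomp := by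
    obtain ⟨f₀, h, h₀, hh, he⟩ := hf.decomp
    refine ⟨fun x => -f₀ x, fun x => -1 * h x, h₀.neg, hh.const_mul (-1), fun x hx => ?_⟩
    rw [he x hx]; ring

lemma HasSing.differentiableAt {m : ℕ} {f : Plane → ℝ} (hf : HasSing m f) :
    ∀ x ∉ lattice, DifferentiableAt ℝ f x := fun _ hx =>
  hf.smooth.differentiableAt_of_isOpen isOpen_compl_lattice hx

lemma HasSing.exists_bound {m : ℕ} {f : Plane → ℝ} (hf : HasSing m f) :
    ∃ C, 0 ≤ C ∧ ∀ x ∈ bigSquare, x ≠ 0 → |f x| ≤ C * (‖x‖⁻¹) ^ m := by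
  obtain ⟨f₀, h, h₀, hh, he⟩ := hf.decomp
  obtain ⟨C₀, hC₀⟩ := isCompact_bigSquare.exists_bound_of_continuousOn
    (h₀.continuousOn.mono bigSquare_subset)
  obtain ⟨C₁, hC₁, hb⟩ := hh.exists_bound
  refine ⟨max C₀ 0 * 2 ^ m + C₁, by positivity, fun x hx hx0 => ?_⟩
  have hl : x ∈ latticeᶜ := notMem_lattice_of_abs_lt hx0 fun i => (hx i).trans_lt (by norm_num)
  have hn : 0 < ‖x‖ := norm_pos_iff.2 hx0
  -- On the square ‖x‖ ≤ 3/2 < 2, so the bounded smooth part is absorbed into the singular bound.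
  have h2 : (1 : ℝ) ≤ 2 ^ m * (‖x‖⁻¹) ^ m := by
    rw [← mul_pow]
    refine one_le_pow₀ ?_
    rw [← div_eq_mul_inv, one_le_div hn]
    linarith [norm_le_of_abs_le hx]
  rw [he x hl, add_mul]
  refine (abs_add_le _ _).trans (add_le_add ?_ (hb x hx0))
  calc |f₀ x| ≤ max C₀ 0 := (hC₀ x hx).trans (le_max_left _ _)
    _ ≤ max C₀ 0 * (2 ^ m * (‖x‖⁻¹) ^ m) := le_mul_of_one_le_right (le_max_right _ _) h2
    _ = _ := by ring

lemma unitSquare_subset_bigSquare : unitSquare ⊆ bigSquare := fun x hx i => by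
  have := hx i
  rw [abs_le]
  constructor <;> linarith [this.1, this.2]

/-- In polar coordinates the Jacobian cancels the singularity. -/
lemma integrableOn_inv_norm_ball (R : ℝ) :
    IntegrableOn (fun x : Plane => ‖x‖⁻¹) (Metric.ball 0 R) := by
  rw [integrableOn_fun_norm_addHaar (E := Plane) volume (f := fun y => y⁻¹)]
  have : IntegrableOn (fun _ : ℝ => (1 : ℝ)) (Ioo 0 R) := by simp
  refine this.congr_fun (fun y hy => ?_) measurableSet_Ioo
  simp [hy.1.ne']

lemma integrable_inv_norm_torus : Integrable (fun x : Plane => ‖x‖⁻¹) torusMeasure := by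
  refine (integrableOn_inv_norm_ball 2).mono_set fun x hx => ?_
  have := norm_le_of_abs_le (unitSquare_subset_bigSquare hx)
  simp only [Metric.mem_ball, dist_zero_right]
  linarith

lemma ae_torus_mem_unitSquare : ∀ᵐ x ∂torusMeasure, x ∈ unitSquare :=
  ae_restrict_mem measurableSet_unitSquare

lemma aestronglyMeasurable_of_contDiffOn {f : Plane → ℝ}
    (hf : ContDiffOn ℝ (⊤ : ℕ∞) f latticeᶜ) : AEStronglyMeasurable f := by
  have h := hf.continuousOn.aestronglyMeasurable (μ := volume) isOpen_compl_lattice.measurableSet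
  rwa [Measure.restrict_eq_self_of_ae_mem (s := latticeᶜ) ae_notMem_lattice] at h

lemma integrable_of_le_inv_norm {f : Plane → ℝ} (hf : AEStronglyMeasurable f) {C : ℝ}
    (h : ∀ x ∈ unitSquare, x ≠ 0 → |f x| ≤ C * ‖x‖⁻¹) : Integrable f torusMeasure := by
  refine (integrable_inv_norm_torus.const_mul C).mono' hf.restrict ?_
  filter_upwards [ae_torus_mem_unitSquare, ae_torus_of_ae_volume ae_notMem_lattice] with x h1 h2
  exact h x h1 (ne_zero_of_notMem_lattice h2)

lemma HasSing.aesm {m : ℕ} {f : Plane → ℝ} (hf : HasSing m f) : AEStronglyMeasurable f :=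
  aestronglyMeasurable_of_contDiffOn hf.smooth

/-- Order 1 is integrable in dimension two. Second derivatives of the potential have order 2, for
which this bound is not available; they enter only through truncation or against a factor vanishing
at the origin. -/
lemma HasSing.integrable {f : Plane → ℝ} (hf : HasSing 1 f) : Integrable f torusMeasure := by
  obtain ⟨C, -, hC⟩ := hf.exists_bound
  exact integrable_of_le_inv_norm hf.aesm fun x hx hx0 => by
    simpa using hC x (unitSquare_subset_bigSquare hx) hx0

/-! ### Logarithmic kernels. -/

/-- Periodic functions, smooth off the lattice, with the logarithmic singularity of the
two-dimensional Coulomb potential. -/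
structure IsLogKernel (V : Plane → ℝ) : Prop where
  smooth : ContDiffOn ℝ (⊤ : ℕ∞) V latticeᶜ
  periodic : LatticePeriodic V
  decomp : ∃ V₀ : Plane → ℝ, ContDiffOn ℝ (⊤ : ℕ∞) V₀ puncturedPlane ∧
    ∀ x ∈ latticeᶜ, V x = V₀ x + -(1 / (2 * Real.pi)) * Real.log ‖x‖

lemma IsCoulombPotential.isLogKernel {V : Plane → ℝ} (hV : IsCoulombPotential V) :
    IsLogKernel V :=
  ⟨hV.smooth, hV.periodic, hV.log_singularity⟩

namespace IsLogKernel

variable {V : Plane → ℝ}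

lemma aesm (hV : IsLogKernel V) : AEStronglyMeasurable V :=
  aestronglyMeasurable_of_contDiffOn hV.smooth

lemma differentiableAt (hV : IsLogKernel V) : ∀ x ∉ lattice, DifferentiableAt ℝ V x := fun _ hx =>
  hV.smooth.differentiableAt_of_isOpen isOpen_compl_lattice hx

lemma hasSing_pderiv (hV : IsLogKernel V) (i : Fin 2) : HasSing 1 (pderiv i V) where
  smooth := contDiffOn_pderiv isOpen_compl_lattice hV.smooth i
  periodic := latticePeriodic_pderiv hV.periodic i
  decomp := by
    obtain ⟨V₀, h₀, he⟩ := hV.decomp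
    refine ⟨_, _, contDiffOn_pderiv isOpen_puncturedPlane h₀ i,
      (isHomog_pderiv_log i).const_mul (-(1 / (2 * Real.pi))), ?_⟩
    intro x hx
    rw [pderiv_add_of_notMem_lattice h₀ (contDiffOn_const.mul contDiffOn_log_norm) he i x hx]
    congr 1
    rw [pderiv, fderiv_const_mul (contDiffOn_log_norm.differentiableAt_of_isOpen
      isOpen_compl_singleton (ne_zero_of_notMem_lattice hx))]
    rfl

lemma hasSing_perpGrad (hV : IsLogKernel V) (j : Fin 2) : HasSing 1 (perpGrad V j) := by
  fin_cases j
  · exact (hV.hasSing_pderiv 1).neg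
  · exact hV.hasSing_pderiv 0

lemma integrable (hV : IsLogKernel V) : Integrable V torusMeasure := by
  obtain ⟨V₀, h₀, he⟩ := hV.decomp
  obtain ⟨C₀, hC₀⟩ := isCompact_bigSquare.exists_bound_of_continuousOn
    (h₀.continuousOn.mono bigSquare_subset)
  set c : ℝ := 1 / (2 * Real.pi) with hc
  have hc0 : 0 ≤ c := by positivity
  refine integrable_of_le_inv_norm (C := max C₀ 0 * 2 + c * 5) hV.aesm fun x hx hx0 => ?_
  have hx' := unitSquare_subset_bigSquare hx
  have hl : x ∈ latticeᶜ := notMem_lattice_of_abs_lt hx0 fun i => (hx' i).trans_lt (by norm_num)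
  have hn : 0 < ‖x‖ := norm_pos_iff.2 hx0
  have hn2 : ‖x‖ ≤ 2 := by linarith [norm_le_of_abs_le hx']
  have h2 : (1 : ℝ) ≤ 2 * ‖x‖⁻¹ := by
    rw [← div_eq_mul_inv, one_le_div hn]; exact hn2
  -- Both signs come from log s ≤ s − 1, applied to ‖x‖ ≤ 2 and to its inverse; the constant 5 is
  -- generous.
  have h3 : |Real.log ‖x‖| ≤ 5 * ‖x‖⁻¹ := by
    rw [abs_le]
    have e1 := Real.log_le_sub_one_of_pos hn
    have e2 := Real.log_le_sub_one_of_pos (inv_pos.2 hn)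
    rw [Real.log_inv] at e2
    constructor <;> nlinarith
  rw [he x hl, add_mul]
  refine (abs_add_le _ _).trans (add_le_add ?_ ?_)
  · calc |V₀ x| ≤ max C₀ 0 := (hC₀ x hx').trans (le_max_left _ _)
      _ ≤ max C₀ 0 * (2 * ‖x‖⁻¹) := le_mul_of_one_le_right (le_max_right _ _) h2
      _ = _ := by ring
  · rw [abs_mul, abs_neg, abs_of_nonneg hc0, mul_assoc]
    exact mul_le_mul_of_nonneg_left h3 hc0

end IsLogKernel

/-! ### Continuity and differentiability of convolutions. -/

/-- The convolution of an integrable and a bounded function is continuous. -/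
theorem continuous_torusConv {K f : Plane → ℝ} {M : ℝ} (hKp : LatticePeriodic K)
    (hK : Integrable K torusMeasure) (hf : IsBddPeriodic f M) : Continuous (torusConv K f) := by
  set K' : Plane → ℝ := unitSquare.indicator K with hK'
  have hi : Integrable K' := (integrable_indicator_iff measurableSet_unitSquare).2 hK
  have hM := hf.nonneg
  have hconv : ∀ x, torusConv K f x = ∫ z, K' z * f (x - z) := fun x => by
    rw [torusConv_eq hKp hf.periodic, torusMeasure, ← integral_indicator measurableSet_unitSquare]
    refine integral_congr_ae (ae_of_all _ fun z => ?_)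
    by_cases hz : z ∈ unitSquare <;> simp [hK', hz]
  have hfi : ∀ {g : Plane → ℝ} (_ : Integrable g) (x : Plane),
      Integrable fun z => g z * f (x - z) := fun hg x =>
    hg.mul_bdd (hf.sub_left x).aesm (ae_of_all _ (hf.sub_left x).bound)
  -- The kernel is approximated in L¹ by continuous functions of compact support. As f is bounded,
  -- the convolutions are then uniformly close; M + 1 avoids a division by zero.
  refine continuous_of_uniform_approx_of_continuous fun u hu => ?_
  obtain ⟨ε, hε, hu⟩ := Metric.mem_uniformity_dist.1 hu
  obtain ⟨g, hgs, hgi, hgc, hg⟩ := hi.exists_hasCompactSupport_integral_sub_le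
    (ε := ε / (2 * (M + 1))) (by positivity)
  refine ⟨g ⋆[ContinuousLinearMap.mul ℝ ℝ, volume] f,
    hgs.continuous_convolution_left _ hgc hf.locallyIntegrable, fun x => hu ?_⟩
  rw [hconv, convolution_def, Real.dist_eq]
  simp only [ContinuousLinearMap.mul_apply']
  rw [← integral_sub (hfi hi x) (hfi hg x)]
  calc |∫ z, (K' z * f (x - z) - g z * f (x - z))|
      ≤ ∫ z, |K' z * f (x - z) - g z * f (x - z)| := abs_integral_le_integral_abs
    _ ≤ ∫ z, |K' z - g z| * M := by
        refine integral_mono_of_nonneg (ae_of_all _ fun z => abs_nonneg _)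
          ((hi.sub hg).abs.mul_const M) (ae_of_all _ fun z => ?_)
        simp only [← sub_mul, abs_mul]
        exact mul_le_mul_of_nonneg_left (hf.bound _) (abs_nonneg _)
    _ = (∫ z, |K' z - g z|) * M := integral_mul_const _ _
    _ ≤ ε / (2 * (M + 1)) * M := mul_le_mul_of_nonneg_right hgi hM
    _ < ε := by
        rw [div_mul_eq_mul_div, div_lt_iff₀ (by positivity)]
        nlinarith

lemma measurable_pderiv (i : Fin 2) (f : Plane → ℝ) : Measurable (pderiv i f) :=
  measurable_fderiv_apply_const ℝ f _

lemma add_smul_stdVec_notMem_lattice {x : Plane} {k : Fin 2}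
    (hx : x (k + 1) ∉ range ((↑) : ℤ → ℝ)) (s : ℝ) : x + s • stdVec k ∉ lattice := by
  intro h
  have hk : k + 1 ≠ k := by fin_cases k <;> decide
  obtain ⟨n, hn⟩ := h (k + 1)
  exact hx ⟨n, by simpa [hk] using hn.symm⟩

lemma ae_coord_sub_notMem (x : Plane) (i : Fin 2) :
    ∀ᵐ y : Plane, (x - y) i ∉ range ((↑) : ℤ → ℝ) := by
  have h0 : ∀ᵐ y : Plane, y i ∉ range ((↑) : ℤ → ℝ) := by
    have h1 := (Measure.quasiMeasurePreserving_eval (μ := fun _ : Fin 2 => (volume : Measure ℝ))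
      i).ae ae_notMem_range_intCast
    exact measurePreserving_ofLp.quasiMeasurePreserving.ae h1
  exact (Measure.measurePreserving_sub_left volume x).quasiMeasurePreserving.ae h0

/-- Integration by parts on the torus, with singularities on the lattice in the first factor. -/
lemma integral_mul_pderiv {F G : Plane → ℝ} (k : Fin 2) (hF : LatticePeriodic F)
    (hG : LatticePeriodic G) (hdF : ∀ x ∉ lattice, DifferentiableAt ℝ F x)
    (hdG : Differentiable ℝ G) (i1 : Integrable (fun x => F x * pderiv k G x) torusMeasure)
    (i2 : Integrable (fun x => pderiv k F x * G x) torusMeasure) :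
    ∫ x, F x * pderiv k G x ∂torusMeasure = -∫ x, pderiv k F x * G x ∂torusMeasure := by
  have hd : ∀ x ∉ lattice, HasFDerivAt (fun x => F x * G x)
      (F x • fderiv ℝ G x + G x • fderiv ℝ F x) x := fun x hx =>
    (hdF x hx).hasFDerivAt.mul (hdG x).hasFDerivAt
  have hae : (fun x => fderiv ℝ (fun x => F x * G x) x (stdVec k)) =ᵐ[torusMeasure]
      fun x => F x * pderiv k G x + pderiv k F x * G x := by
    filter_upwards [ae_torus_of_ae_volume ae_notMem_lattice] with x hx
    rw [(hd x hx).fderiv]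
    simp only [_root_.add_apply, _root_.smul_apply, smul_eq_mul, pderiv]
    ring
  have h := integral_pderivE_eq_zero k (hF.comp₂ hG fun a b => a * b)
    (fun x hx => (hd x hx).differentiableAt) ((i1.add i2).congr hae.symm)
  rw [integral_congr_ae hae, integral_add i1 i2] at h
  linarith

section Gradient

variable {V f : Plane → ℝ} {M : ℝ}

/-- The fundamental theorem of calculus is applied to V on the segment through x − y, which lies on
a line off the lattice for almost every y, and Fubini's theorem then exchanges the integrals. This
avoids differentiating the singular kernel under the integral. -/
lemma torusConv_add_sub (hV : IsLogKernel V) (hf : IsBddPeriodic f M) (k : Fin 2) (x : Plane)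
    (t : ℝ) : torusConv V f (x + t • stdVec k) - torusConv V f x =
      ∫ s in (0 : ℝ)..t, torusConv (pderiv k V) f (x + s • stdVec k) := by
  have hS := hV.hasSing_pderiv k
  have hint : Integrable (fun p : ℝ × Plane => pderiv k V (x + p.1 • stdVec k - p.2) * f p.2)
      ((volume.restrict (uIoc 0 t)).prod torusMeasure) := by
    have hm : AEStronglyMeasurable
        (fun p : ℝ × Plane => pderiv k V (x + p.1 • stdVec k - p.2) * f p.2)
        ((volume.restrict (uIoc 0 t)).prod torusMeasure) :=
      (((measurable_pderiv k V).comp (by fun_prop)).aestronglyMeasurable).mul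
        hf.aesm.restrict.comp_snd
    rw [integrable_prod_iff hm]
    have hb : ∀ s : ℝ, ∫ y, ‖pderiv k V (x + s • stdVec k - y) * f y‖ ∂torusMeasure ≤
        (∫ z, |pderiv k V z| ∂torusMeasure) * M := fun s => by
      rw [← integral_torus_sub_left (hS.periodic.comp fun z => |z|) (x + s • stdVec k),
        ← integral_mul_const]
      refine integral_mono_of_nonneg (ae_of_all _ fun z => norm_nonneg _)
        ((hS.periodic.integrable_sub_left hS.integrable _).abs.mul_const M)
        (ae_of_all _ fun z => ?_)
      simp only [norm_mul, Real.norm_eq_abs]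
      exact mul_le_mul_of_nonneg_left (hf.bound _) (abs_nonneg _)
    refine ⟨ae_of_all _ fun s => hf.integrable_mul
      (K := fun y => pderiv k V (x + s • stdVec k - y))
      (hS.periodic.integrable_sub_left hS.integrable _), ?_⟩
    have hm2 : AEStronglyMeasurable
        (fun s : ℝ => ∫ y, ‖pderiv k V (x + s • stdVec k - y) * f y‖ ∂torusMeasure)
        (volume.restrict (uIoc 0 t)) := hm.norm.integral_prod_right'
    have : IsFiniteMeasure ((volume : Measure ℝ).restrict (uIoc 0 t)) :=
      ⟨by rw [Measure.restrict_apply_univ, uIoc]; exact measure_Ioc_lt_top⟩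
    refine Integrable.of_bound hm2 ((∫ z, |pderiv k V z| ∂torusMeasure) * M)
      (ae_of_all _ fun s => ?_)
    rw [Real.norm_of_nonneg (integral_nonneg fun _ => norm_nonneg _)]
    exact hb s
  have hline : ∀ᵐ y ∂torusMeasure,
      ∫ s in (0 : ℝ)..t, pderiv k V (x + s • stdVec k - y) =
        V (x + t • stdVec k - y) - V (x - y) := by
    filter_upwards [ae_torus_of_ae_volume (ae_coord_sub_notMem x (k + 1))] with y hy
    have e : ∀ s : ℝ, x + s • stdVec k - y = x - y + s • stdVec k := fun s => by abel
    simp only [e]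
    have hn := add_smul_stdVec_notMem_lattice hy
    have hc : Continuous fun s : ℝ => pderiv k V (x - y + s • stdVec k) :=
      hS.smooth.continuousOn.comp_continuous (by fun_prop) hn
    have h := intervalIntegral.integral_eq_sub_of_hasDerivAt
      (fun s _ => hasDerivAt_line (F := V) (x := x - y) (stdVec k) (s := s)
        (hV.differentiableAt _ (hn s))) (hc.intervalIntegrable 0 t)
    rw [zero_smul, add_zero] at h
    exact h
  have hsw : ∫ s in (0 : ℝ)..t, torusConv (pderiv k V) f (x + s • stdVec k) =
      ∫ y, (∫ s in (0 : ℝ)..t, pderiv k V (x + s • stdVec k - y)) * f y ∂torusMeasure := by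
    simp only [torusConv]
    simp only [← intervalIntegral.integral_mul_const]
    exact intervalIntegral_integral_swap hint
  rw [hsw, torusConv, torusConv, ← integral_sub
    (hf.integrable_mul (K := fun y => V (x + t • stdVec k - y))
      (hV.periodic.integrable_sub_left hV.integrable _))
    (hf.integrable_mul (K := fun y => V (x - y))
      (hV.periodic.integrable_sub_left hV.integrable _))]
  refine integral_congr_ae (hline.mono fun y hy => ?_)
  simp only [hy, sub_mul]

lemma hasDerivAt_torusConv_line (hV : IsLogKernel V) (hf : IsBddPeriodic f M) (k : Fin 2)
    (x : Plane) (t : ℝ) : HasDerivAt (fun s : ℝ => torusConv V f (x + s • stdVec k))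
      (torusConv (pderiv k V) f (x + t • stdVec k)) t := by
  have hS := hV.hasSing_pderiv k
  have hc : Continuous fun s : ℝ => torusConv (pderiv k V) f (x + s • stdVec k) :=
    (continuous_torusConv hS.periodic hS.integrable hf).comp (by fun_prop)
  have h := (hc.integral_hasStrictDerivAt 0 t).hasDerivAt.const_add (torusConv V f x)
  refine h.congr_of_eventuallyEq (Eventually.of_forall fun s => ?_)
  simp only [← torusConv_add_sub hV hf k x s]
  ring

/-- The convolution of a logarithmic kernel with a bounded function is continuously
differentiable. -/
theorem hasFDerivAt_torusConv (hV : IsLogKernel V) (hf : IsBddPeriodic f M) (x : Plane) :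
    HasFDerivAt (torusConv V f)
      (torusConv (pderiv 0 V) f x • (EuclideanSpace.proj 0 : Plane →L[ℝ] ℝ) +
        torusConv (pderiv 1 V) f x • (EuclideanSpace.proj 1 : Plane →L[ℝ] ℝ)) x := by
  have hG : ∀ k, Continuous (torusConv (pderiv k V) f) := fun k =>
    continuous_torusConv (hV.hasSing_pderiv k).periodic (hV.hasSing_pderiv k).integrable hf
  set P : ℝ → ℝ → Plane := fun a b => a • stdVec 0 + b • stdVec 1 with hP
  have hPc : Continuous fun v : ℝ × ℝ => P v.1 v.2 := by fun_prop
  have hxP : ∀ y : Plane, P (y 0) (y 1) = y := fun y => by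
    ext i; fin_cases i <;> simp [hP]
  -- Continuous partial derivatives imply differentiability; the criterion is stated on a product,
  -- so the plane is first written as ℝ × ℝ.
  have h := hasStrictFDerivAt_uncurry_coprod (𝕜 := ℝ) (u := (x 0, x 1))
    (f := fun a b => torusConv V f (P a b))
    (f₁ := fun a b => ContinuousLinearMap.toSpanSingleton ℝ (torusConv (pderiv 0 V) f (P a b)))
    (f₂ := fun a b => ContinuousLinearMap.toSpanSingleton ℝ (torusConv (pderiv 1 V) f (P a b)))
    (Eventually.of_forall fun v => by
      have := hasDerivAt_torusConv_line hV hf 0 (v.2 • stdVec 1) v.1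
      simp only [add_comm (v.2 • stdVec 1)] at this
      exact this.hasFDerivAt)
    (Eventually.of_forall fun v =>
      (hasDerivAt_torusConv_line hV hf 1 (v.1 • stdVec 0) v.2).hasFDerivAt)
    (((ContinuousLinearMap.toSpanSingletonCLE (𝕜 := ℝ) (E := ℝ)).continuous.comp
      ((hG 0).comp hPc)).continuousAt)
    (((ContinuousLinearMap.toSpanSingletonCLE (𝕜 := ℝ) (E := ℝ)).continuous.comp
      ((hG 1).comp hPc)).continuousAt)
  have hpr : HasFDerivAt (fun y : Plane => (y 0, y 1))
      ((EuclideanSpace.proj 0 : Plane →L[ℝ] ℝ).prod (EuclideanSpace.proj 1 : Plane →L[ℝ] ℝ)) x :=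
    ((EuclideanSpace.proj 0 : Plane →L[ℝ] ℝ).prod
      (EuclideanSpace.proj 1 : Plane →L[ℝ] ℝ)).hasFDerivAt
  have h2 := h.hasFDerivAt.comp x hpr
  convert! h2 using 1
  · funext y
    exact (congrArg (torusConv V f) (hxP y)).symm
  · ext v
    simp [Function.HasUncurry.uncurry, hxP]
    ring

lemma contDiff_torusConv (hV : IsLogKernel V) (hf : IsBddPeriodic f M) :
    ContDiff ℝ 1 (torusConv V f) := by
  have hG : ∀ k, Continuous (torusConv (pderiv k V) f) := fun k =>
    continuous_torusConv (hV.hasSing_pderiv k).periodic (hV.hasSing_pderiv k).integrable hf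
  rw [contDiff_one_iff_hasFDerivAt]
  exact ⟨_, ((hG 0).smul continuous_const).add ((hG 1).smul continuous_const),
    hasFDerivAt_torusConv hV hf⟩

end Gradient

/-! ### The theta function of the square lattice. -/

/-- The nome of the square torus. -/
def nome : ℝ := Real.exp (-(2 * Real.pi))

lemma nome_pos : 0 < nome := Real.exp_pos _

lemma nome_lt_one : nome < 1 := Real.exp_lt_one_iff.2 (by linarith [Real.pi_pos])

/-- The infinite product `∏ (1 - q ^ n * w)` with `q` the nome. -/
def qProd (w : ℂ) : ℂ := ∏' n : ℕ, (1 + -((nome : ℂ) ^ n * w))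

lemma summable_qProd (w : ℂ) : Summable fun n : ℕ => ‖-((nome : ℂ) ^ n * w)‖ := by
  simp only [norm_neg, norm_mul, norm_pow, Complex.norm_real, Real.norm_of_nonneg nome_pos.le]
  exact (summable_geometric_of_lt_one nome_pos.le nome_lt_one).mul_right _

/-- Splitting off the factor n = 0 shifts the rest. Both the quasi-periodicity of `theta` and the
extraction of its zero at the origin rest on this. -/
lemma qProd_eq (w : ℂ) : qProd w = (1 - w) * qProd (nome * w) := by
  have e : ∀ n : ℕ, (1 + -((nome : ℂ) ^ n * (nome * w))) = 1 + -((nome : ℂ) ^ (n + 1) * w) :=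
    fun n => by ring
  have hm : Multipliable fun n : ℕ => 1 + -((nome : ℂ) ^ (n + 1) * w) := by
    simp only [← e]
    exact multipliable_one_add_of_summable (summable_qProd _)
  rw [qProd, tprod_eq_zero_mul' (f := fun n : ℕ => 1 + -((nome : ℂ) ^ n * w)) hm, qProd]
  simp only [e, pow_zero, one_mul, sub_eq_add_neg]

lemma qProd_ne_zero {w : ℂ} (h : ∀ n : ℕ, (nome : ℂ) ^ n * w ≠ 1) : qProd w ≠ 0 := by
  refine tprod_one_add_ne_zero_of_summable (fun n h0 => h n ?_) (summable_qProd w)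
  linear_combination -h0

lemma differentiable_qProd : Differentiable ℂ qProd := by
  have hp : HasProdLocallyUniformlyOn (fun (n : ℕ) (w : ℂ) => 1 + -((nome : ℂ) ^ n * w)) qProd
      univ := by
    refine hasProdLocallyUniformlyOn_of_forall_compact isOpen_univ fun K _ hK => ?_
    obtain ⟨R, hR⟩ := hK.isBounded.exists_norm_le
    refine ((summable_geometric_of_lt_one nome_pos.le nome_lt_one).mul_right
      R).hasProdUniformlyOn_nat_one_add hK (.of_forall fun n w hw => ?_) fun _ => by fun_prop
    simp only [norm_neg, norm_mul, norm_pow, Complex.norm_real, Real.norm_of_nonneg nome_pos.le]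
    exact mul_le_mul_of_nonneg_left (hR w hw) (by have := nome_pos; positivity)
  have := hp.differentiableOn (.of_forall fun s => by
    simpa [Finset.prod_fn] using DifferentiableOn.finsetProd (fun _ _ => by fun_prop)) isOpen_univ
  exact differentiableOn_univ.1 this

/-- The function `z ↦ exp (2πiz)`. -/
def expC (z : ℂ) : ℂ := Complex.exp (2 * Real.pi * Complex.I * z)

lemma differentiable_expC : Differentiable ℂ expC := by unfold expC; fun_prop

lemma expC_add (z w : ℂ) : expC (z + w) = expC z * expC w := by
  rw [expC, expC, expC, ← Complex.exp_add]; ring_nf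

lemma expC_one : expC 1 = 1 := by simp [expC, Complex.exp_two_pi_mul_I]

lemma expC_I : expC Complex.I = nome := by
  rw [expC, nome, Complex.ofReal_exp]
  congr 1
  push_cast
  linear_combination (2 * Real.pi : ℂ) * Complex.I_mul_I

lemma expC_neg (z : ℂ) : expC (-z) * expC z = 1 := by
  rw [← expC_add, neg_add_cancel]; simp [expC]

lemma expC_neg_add_I (z : ℂ) : nome * expC (-(z + Complex.I)) = expC (-z) := by
  have h : expC (-z) = expC (-(z + Complex.I)) * expC Complex.I := by
    rw [← expC_add]; congr 1; ring
  rw [h, expC_I]; ring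

lemma nome_pow (n : ℕ) : (nome : ℂ) ^ n = expC (n * Complex.I) := by
  rw [nome, ← Complex.ofReal_pow, ← Real.exp_nat_mul, expC, Complex.ofReal_exp]
  congr 1
  push_cast
  linear_combination (-2 * Real.pi * n : ℂ) * Complex.I_mul_I

lemma expC_eq_one_iff {z : ℂ} : expC z = 1 ↔ ∃ n : ℤ, z = n := by
  rw [expC, Complex.exp_eq_one_iff]
  refine exists_congr fun n => ?_
  rw [mul_comm]
  exact mul_left_inj' Complex.two_pi_I_ne_zero

/-- A theta function, by its product expansion, vanishing exactly on the lattice. -/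
def theta (z : ℂ) : ℂ := qProd (expC z) * qProd (nome * expC (-z))

lemma differentiable_theta : Differentiable ℂ theta := by
  have h1 := differentiable_qProd.comp differentiable_expC
  have h2 := differentiable_qProd.comp
    ((differentiable_expC.comp differentiable_neg).const_mul (nome : ℂ))
  exact h1.mul h2

lemma theta_add_one (z : ℂ) : theta (z + 1) = theta z := by
  have h : expC (-(z + 1)) = expC (-z) := by
    have : expC (-z) = expC (-(z + 1)) * expC 1 := by rw [← expC_add]; congr 1; ring
    rw [this, expC_one, mul_one]
  rw [theta, theta, expC_add, expC_one, mul_one, h]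

/-- The shift multiplies the variable of one product by the nome and undoes such a factor in the
other, so one factor is lost and one gained. The multiplier has modulus exp(2πy), which the
quadratic term of the potential compensates. -/
lemma theta_add_I (z : ℂ) : theta (z + Complex.I) = -expC (-z) * theta z := by
  rw [theta, theta, expC_neg_add_I, expC_add, expC_I, mul_comm (expC z) (nome : ℂ),
    qProd_eq (expC z), qProd_eq (expC (-z))]
  linear_combination (-qProd (nome * expC z) * qProd (nome * expC (-z))) * expC_neg z

/-- The identification of the plane with `ℂ`. -/
def toC : Plane →L[ℝ] ℂ :=
  (EuclideanSpace.proj 0 : Plane →L[ℝ] ℝ).smulRight (1 : ℂ) +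
    (EuclideanSpace.proj 1 : Plane →L[ℝ] ℝ).smulRight Complex.I

lemma toC_apply (x : Plane) : toC x = x 0 + x 1 * Complex.I := by
  simp [toC]

lemma norm_toC (x : Plane) : ‖toC x‖ = ‖x‖ := by
  rw [toC_apply, Complex.norm_add_mul_I, EuclideanSpace.norm_eq, Fin.sum_univ_two]
  simp

lemma mem_lattice_of_toC {x : Plane} {m n : ℤ} (h : toC x = m + n * Complex.I) : x ∈ lattice := by
  rw [toC_apply] at h
  have h0 := congrArg Complex.re h
  have h1 := congrArg Complex.im h
  simp at h0 h1
  intro i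
  fin_cases i
  · exact ⟨m, h0⟩
  · exact ⟨n, h1⟩

/-- A convergent product vanishes only if one of its factors does, and since the nome is `expC
Complex.I` each factor vanishes only at points of one row of the lattice. -/
lemma theta_ne_zero {x : Plane} (hx : x ∉ lattice) : theta (toC x) ≠ 0 := by
  refine mul_ne_zero (qProd_ne_zero fun n h => hx ?_) (qProd_ne_zero fun n h => hx ?_)
  · rw [nome_pow, ← expC_add, expC_eq_one_iff] at h
    obtain ⟨m, hm⟩ := h
    exact mem_lattice_of_toC (m := m) (n := -n) (by push_cast; linear_combination hm)
  · rw [← mul_assoc, ← pow_succ, nome_pow, ← expC_add, expC_eq_one_iff] at h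
    obtain ⟨m, hm⟩ := h
    exact mem_lattice_of_toC (m := -m) (n := n + 1) (by
      push_cast at hm ⊢; linear_combination -hm)

/-- The quotient of the theta function by the identity. -/
def thetaQuot (z : ℂ) : ℂ :=
  dslope (fun z => 1 - expC z) 0 z * qProd (nome * expC z) * qProd (nome * expC (-z))

lemma differentiable_thetaQuot : Differentiable ℂ thetaQuot := by
  have h0 : Differentiable ℂ (dslope (fun z => 1 - expC z) 0) := by
    rw [← differentiableOn_univ, Complex.differentiableOn_dslope univ_mem]
    exact ((differentiable_const _).sub differentiable_expC).differentiableOn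
  have h1 := differentiable_qProd.comp (differentiable_expC.const_mul (nome : ℂ))
  have h2 := differentiable_qProd.comp
    ((differentiable_expC.comp differentiable_neg).const_mul (nome : ℂ))
  exact (h0.mul h1).mul h2

lemma theta_eq (z : ℂ) : theta z = z * thetaQuot z := by
  have h := sub_smul_dslope (fun z => 1 - expC z) 0 z
  simp only [sub_zero, smul_eq_mul] at h
  have h0 : expC 0 = 1 := by simp [expC]
  rw [theta, thetaQuot, qProd_eq (expC z), ← mul_assoc, ← mul_assoc, h, h0]
  ring

/-- At the origin the first factor is the derivative −2πi of 1 − `expC`, so the zero of `theta` is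
simple and the logarithm of the modulus of the quotient is smooth across it. -/
lemma thetaQuot_ne_zero {x : Plane} (hx : x ∈ puncturedPlane) : thetaQuot (toC x) ≠ 0 := by
  rcases hx with hx | hx
  · have h := theta_ne_zero hx
    rw [theta_eq] at h
    exact right_ne_zero_of_mul h
  · rw [mem_singleton_iff.1 hx, map_zero, thetaQuot, dslope_same, neg_zero]
    have h0 : expC 0 = 1 := by simp [expC]
    have h1 : qProd (nome * expC 0) ≠ 0 := by
      refine qProd_ne_zero fun n h => ?_
      rw [h0, mul_one, ← pow_succ, ← Complex.ofReal_pow] at h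
      have h2 : nome ^ (n + 1) = 1 := by exact_mod_cast h
      exact (pow_lt_one₀ nome_pos.le nome_lt_one (by simp)).ne h2
    have h2 : deriv (fun z => 1 - expC z) 0 = -(2 * Real.pi * Complex.I) := by
      have : HasDerivAt (fun z : ℂ => 2 * Real.pi * Complex.I * z) (2 * Real.pi * Complex.I) 0 := by
        simpa using (hasDerivAt_id (0 : ℂ)).const_mul (2 * Real.pi * Complex.I)
      have h3 := (this.cexp.const_sub 1).deriv
      simpa [expC] using h3
    rw [h2]
    exact mul_ne_zero (mul_ne_zero (neg_ne_zero.2 Complex.two_pi_I_ne_zero) h1) h1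

lemma contDiffAt_log_norm_comp {f : ℂ → ℂ} (hf : Differentiable ℂ f) {x : Plane}
    (hx : f (toC x) ≠ 0) : ContDiffAt ℝ (⊤ : ℕ∞) (fun y => Real.log ‖f (toC y)‖) x := by
  have h1 : ContDiff ℝ (⊤ : ℕ∞) fun y => f (toC y) :=
    ((hf.contDiff (n := (⊤ : ℕ∞))).restrict_scalars ℝ).comp toC.contDiff
  exact (h1.contDiffAt.norm ℝ hx).log (norm_ne_zero_iff.2 hx)

/-! ### The theta potential is periodic with Laplacian 1 off the lattice. -/

/-- The Coulomb potential of the square torus, in terms of the theta function. -/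
def thetaPotential (x : Plane) : ℝ :=
  -- The value 0 on the lattice makes periodicity hold at every point: the quadratic term alone is
  -- not periodic there.
  latticeᶜ.indicator (fun x => -(1 / (2 * Real.pi)) * Real.log ‖theta (toC x)‖ +
    (x 1 ^ 2 / 2 - x 1 / 2)) x

lemma thetaPotential_of_notMem {x : Plane} (hx : x ∈ latticeᶜ) :
    thetaPotential x = -(1 / (2 * Real.pi)) * Real.log ‖theta (toC x)‖ +
      (x 1 ^ 2 / 2 - x 1 / 2) := indicator_of_mem hx _

lemma add_mem_compl_lattice {v x : Plane} (hv : v ∈ lattice) (hx : x ∈ latticeᶜ) :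
    x + v ∈ latticeᶜ := by
  intro h
  refine hx fun i => ?_
  obtain ⟨m, hm⟩ := h i
  obtain ⟨n, hn⟩ := hv i
  exact ⟨m - n, by push_cast; rw [← hm, ← hn]; simp⟩

lemma thetaPotential_add_of_lattice {v : Plane} (hv : v ∈ lattice)
    (h : ∀ x ∈ latticeᶜ, thetaPotential (x + v) = thetaPotential x) (x : Plane) :
    thetaPotential (x + v) = thetaPotential x := by
  by_cases hx : x ∈ latticeᶜ
  · exact h x hx
  · have h2 : x + v ∉ latticeᶜ := fun h2 => hx (by
      have := add_mem_compl_lattice (v := -v) (fun i => by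
        obtain ⟨n, hn⟩ := hv i
        exact ⟨-n, by simp [hn]⟩) h2
      simpa using this)
    rw [thetaPotential, thetaPotential, indicator_of_notMem hx, indicator_of_notMem h2]

lemma stdVec_mem_lattice (i : Fin 2) : stdVec i ∈ lattice := fun j => by
  by_cases h : j = i
  · exact ⟨1, by simp [h]⟩
  · exact ⟨0, by simp [h]⟩

lemma thetaPotential_add_stdVec (i : Fin 2) (x : Plane) :
    thetaPotential (x + stdVec i) = thetaPotential x := by
  refine thetaPotential_add_of_lattice (stdVec_mem_lattice i) (fun x hx => ?_) x
  rw [thetaPotential_of_notMem hx,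
    thetaPotential_of_notMem (add_mem_compl_lattice (stdVec_mem_lattice i) hx)]
  fin_cases i
  · have : toC (x + stdVec 0) = toC x + 1 := by rw [map_add, toC_apply (stdVec 0)]; simp
    simp only [Fin.zero_eta, this, theta_add_one]
    simp
  · have h1 : toC (x + stdVec 1) = toC x + Complex.I := by
      rw [map_add, toC_apply (stdVec 1)]; simp
    have h2 : ‖-expC (-toC x)‖ = Real.exp (2 * Real.pi * x 1) := by
      rw [norm_neg, expC, Complex.norm_exp, toC_apply]
      simp
    simp only [Fin.mk_one, h1, theta_add_I, norm_mul, h2]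
    -- The multiplier contributes −(1/2π)·2πy = −y, and y²/2 − y/2 increases by exactly y when y is
    -- replaced by y + 1.
    rw [Real.log_mul (Real.exp_ne_zero _) (norm_ne_zero_iff.2 (theta_ne_zero hx)), Real.log_exp]
    simp only [PiLp.add_apply, PiLp.single_apply]
    have := Real.pi_ne_zero
    field_simp
    simp
    ring

lemma latticePeriodic_thetaPotential : LatticePeriodic thetaPotential := by
  have h : ∀ (i : Fin 2) (m : ℤ) (x : Plane),
      thetaPotential (x + (m : ℝ) • stdVec i) = thetaPotential x := by
    intro i m
    induction m using Int.induction_on with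
    | zero => simp
    | succ k ih =>
      intro x
      rw [show x + (((k : ℤ) + 1 : ℤ) : ℝ) • stdVec i = x + ((k : ℤ) : ℝ) • stdVec i + stdVec i by
        push_cast; module, thetaPotential_add_stdVec, ih]
    | pred k ih =>
      intro x
      rw [← ih x, ← thetaPotential_add_stdVec i]
      congr 1
      push_cast
      module
  intro n x
  have e : latticeVec n = (n 0 : ℝ) • stdVec 0 + (n 1 : ℝ) • stdVec 1 := by
    ext i; fin_cases i <;> simp
  rw [e, ← add_assoc, h, h]

lemma isLogKernel_thetaPotential : IsLogKernel thetaPotential where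
  smooth := by
    intro x hx
    refine ContDiffWithinAt.congr (f := fun x => -(1 / (2 * Real.pi)) *
      Real.log ‖theta (toC x)‖ + (x 1 ^ 2 / 2 - x 1 / 2)) ?_
      (fun y hy => thetaPotential_of_notMem hy) (thetaPotential_of_notMem hx)
    have h := contDiffAt_log_norm_comp differentiable_theta (theta_ne_zero hx)
    exact ((contDiffAt_const.mul h).add (by fun_prop)).contDiffWithinAt
  periodic := latticePeriodic_thetaPotential
  decomp := by
    refine ⟨fun x => -(1 / (2 * Real.pi)) * Real.log ‖thetaQuot (toC x)‖ +
      (x 1 ^ 2 / 2 - x 1 / 2), fun x hx => ?_, fun x hx => ?_⟩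
    · have h := contDiffAt_log_norm_comp differentiable_thetaQuot (thetaQuot_ne_zero hx)
      exact ((contDiffAt_const.mul h).add (by fun_prop)).contDiffWithinAt
    · rw [thetaPotential_of_notMem hx, theta_eq, norm_mul, norm_toC, Real.log_mul
        (norm_ne_zero_iff.2 (ne_zero_of_notMem_lattice hx))
        (norm_ne_zero_iff.2 (thetaQuot_ne_zero (Or.inl hx)))]
      ring

lemma pderiv_comp_toC {g : ℂ → ℝ} {x : Plane} (hg : DifferentiableAt ℝ g (toC x)) (i : Fin 2) :
    pderiv i (fun y => g (toC y)) x = fderiv ℝ g (toC x) (toC (stdVec i)) := by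
  have h := hg.hasFDerivAt.comp x toC.hasFDerivAt
  rw [pderiv, show (fun y => g (toC y)) = g ∘ toC from rfl, h.fderiv]
  rfl

lemma pderiv_congr {f g : Plane → ℝ} {x : Plane} (h : f =ᶠ[𝓝 x] g) (i : Fin 2) :
    pderiv i f x = pderiv i g x := by
  rw [pderiv, pderiv, h.fderiv_eq]

lemma pderiv_pderiv_comp_toC {g : ℂ → ℝ} {x : Plane} (hg : ContDiffAt ℝ 2 g (toC x)) (i : Fin 2) :
    pderiv i (pderiv i fun y => g (toC y)) x =
      iteratedFDeriv ℝ 2 g (toC x) ![toC (stdVec i), toC (stdVec i)] := by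
  have h1 : ∀ᶠ z in 𝓝 (toC x), DifferentiableAt ℝ g z :=
    (hg.eventually (by simp)).mono fun z hz => hz.differentiableAt (by simp)
  have h2 : pderiv i (fun y => g (toC y)) =ᶠ[𝓝 x]
      fun y => (fun z => fderiv ℝ g z (toC (stdVec i))) (toC y) :=
    (toC.continuous.continuousAt.eventually h1).mono fun y hy => pderiv_comp_toC hy i
  have h3 : DifferentiableAt ℝ (fderiv ℝ g) (toC x) :=
    (hg.fderiv_right (m := 1) (by norm_num)).differentiableAt (by simp)
  rw [pderiv_congr h2, pderiv_comp_toC (h3.clm_apply (differentiableAt_const _)),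
    iteratedFDeriv_two_apply, fderiv_clm_apply h3 (differentiableAt_const _)]
  simp

lemma pderiv_add {f g : Plane → ℝ} {x : Plane} (hf : DifferentiableAt ℝ f x)
    (hg : DifferentiableAt ℝ g x) (i : Fin 2) :
    pderiv i (fun y => f y + g y) x = pderiv i f x + pderiv i g x := by
  rw [pderiv, show (fun y => f y + g y) = f + g from rfl, fderiv_add hf hg]
  rfl

lemma pderiv_const_mul {f : Plane → ℝ} {x : Plane} (hf : DifferentiableAt ℝ f x) (c : ℝ)
    (i : Fin 2) : pderiv i (fun y => c * f y) x = c * pderiv i f x := by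
  rw [pderiv, fderiv_const_mul hf]
  rfl

/-- The logarithm of the modulus of a nonvanishing holomorphic function is harmonic. -/
lemma laplacian_log_norm_theta {x : Plane} (hx : x ∈ latticeᶜ) :
    ∑ i, pderiv i (pderiv i fun y => Real.log ‖theta (toC y)‖) x = 0 := by
  have h := (differentiable_theta.analyticAt (toC x)).harmonicAt_log_norm (theta_ne_zero hx)
  have h2 := h.2.self_of_nhds
  rw [InnerProductSpace.laplacian_eq_iteratedFDeriv_complexPlane] at h2
  have e0 : toC (stdVec 0) = 1 := by rw [toC_apply]; simp
  have e1 : toC (stdVec 1) = Complex.I := by rw [toC_apply]; simp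
  rw [Fin.sum_univ_two, pderiv_pderiv_comp_toC h.1, pderiv_pderiv_comp_toC h.1, e0, e1]
  exact h2

lemma pderiv_quadratic (i : Fin 2) :
    (pderiv i fun y : Plane => y 1 ^ 2 / 2 - y 1 / 2) =
      fun y => (y 1 - 1 / 2) * (if i = 1 then 1 else 0) := by
  funext x
  have h1 : HasFDerivAt (fun y : Plane => y 1) (EuclideanSpace.proj 1 : Plane →L[ℝ] ℝ) x :=
    (EuclideanSpace.proj 1 : Plane →L[ℝ] ℝ).hasFDerivAt
  have h2 := ((h1.pow 2).mul_const (1 / 2)).sub (h1.mul_const (1 / 2))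
  have e : (fun y : Plane => y 1 ^ 2 / 2 - y 1 / 2) =
      (fun y : Plane => y 1 ^ 2 * (1 / 2)) - fun y => y 1 * (1 / 2) := by
    funext y; simp; ring
  rw [pderiv, e, h2.fderiv]
  fin_cases i <;> simp

lemma pderiv_pderiv_quadratic (i : Fin 2) (x : Plane) :
    pderiv i (pderiv i fun y : Plane => y 1 ^ 2 / 2 - y 1 / 2) x = if i = 1 then 1 else 0 := by
  rw [pderiv_quadratic]
  have h1 : HasFDerivAt (fun y : Plane => y 1) (EuclideanSpace.proj 1 : Plane →L[ℝ] ℝ) x :=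
    (EuclideanSpace.proj 1 : Plane →L[ℝ] ℝ).hasFDerivAt
  have h2 := ((h1.sub_const (1 / 2)).mul_const (if i = 1 then (1 : ℝ) else 0))
  rw [pderiv, h2.fderiv]
  fin_cases i <;> simp

/-- The Laplacian of the potential is `1` off the lattice. -/
lemma laplacian_thetaPotential {x : Plane} (hx : x ∈ latticeᶜ) :
    ∑ i, pderiv i (pderiv i thetaPotential) x = 1 := by
  set L : Plane → ℝ := fun y => Real.log ‖theta (toC y)‖ with hL
  set Q : Plane → ℝ := fun y => y 1 ^ 2 / 2 - y 1 / 2 with hQ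
  have hLs : ContDiffOn ℝ (⊤ : ℕ∞) L latticeᶜ := fun y hy =>
    (contDiffAt_log_norm_comp differentiable_theta (theta_ne_zero hy)).contDiffWithinAt
  have hQs : ContDiff ℝ (⊤ : ℕ∞) Q := by fun_prop
  have hQ' : ∀ i, Differentiable ℝ (pderiv i Q) := fun i y =>
    (contDiffOn_pderiv isOpen_univ hQs.contDiffOn i).differentiableAt_of_isOpen isOpen_univ
      (mem_univ y)
  have h1 : ∀ i, ∀ y ∈ latticeᶜ, pderiv i thetaPotential y =
      -(1 / (2 * Real.pi)) * pderiv i L y + pderiv i Q y := fun i y hy => by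
    have e : thetaPotential =ᶠ[𝓝 y] fun y => -(1 / (2 * Real.pi)) * L y + Q y := by
      filter_upwards [isOpen_compl_lattice.mem_nhds hy] with z hz using thetaPotential_of_notMem hz
    have hLd := hLs.differentiableAt_of_isOpen isOpen_compl_lattice hy
    rw [pderiv_congr e, pderiv_add (hLd.const_mul _) (hQs.differentiable (by simp) y),
      pderiv_const_mul hLd]
  have h2 : ∀ i, pderiv i (pderiv i thetaPotential) x =
      -(1 / (2 * Real.pi)) * pderiv i (pderiv i L) x + pderiv i (pderiv i Q) x := fun i => by
    have e : pderiv i thetaPotential =ᶠ[𝓝 x]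
        fun y => -(1 / (2 * Real.pi)) * pderiv i L y + pderiv i Q y := by
      filter_upwards [isOpen_compl_lattice.mem_nhds hx] with z hz using h1 i z hz
    have hLd := (contDiffOn_pderiv isOpen_compl_lattice hLs i).differentiableAt_of_isOpen
      isOpen_compl_lattice hx
    rw [pderiv_congr e, pderiv_add (hLd.const_mul _) (hQ' i x), pderiv_const_mul hLd]
  simp only [h2, Finset.sum_add_distrib, ← Finset.mul_sum]
  rw [laplacian_log_norm_theta hx, hQ]
  simp [pderiv_pderiv_quadratic]

/-! ### Test functions and Poisson's equation. -/

namespace IsTest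

variable {φ : Plane → ℝ}

lemma differentiable (hφ : IsTest φ) : Differentiable ℝ φ := hφ.smooth.differentiable (by simp)

lemma partialDeriv (hφ : IsTest φ) (i : Fin 2) : IsTest (pderiv i φ) where
  smooth := contDiffOn_univ.1 (contDiffOn_pderiv isOpen_univ hφ.smooth.contDiffOn i)
  periodic := latticePeriodic_pderiv hφ.periodic i

lemma exists_bound (hφ : IsTest φ) : ∃ C, ∀ x, |φ x| ≤ C := by
  obtain ⟨C, hC⟩ := isCompact_bigSquare.exists_bound_of_continuousOn
    hφ.smooth.continuous.continuousOn
  refine ⟨C, fun x => ?_⟩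
  rw [← (IsPeriodic.latticePeriodic hφ.periodic).apply_ofTorus x]
  refine hC _ fun i => ?_
  have h : ((AddCircle.equivIoc 1 (-1 / 2) (toTorus x i)).1 : ℝ) ∈ Ioc (-1 / 2 : ℝ) (-1 / 2 + 1) :=
    (AddCircle.equivIoc 1 (-1 / 2) (toTorus x i)).2
  show |((AddCircle.equivIoc 1 (-1 / 2) (toTorus x i)).1 : ℝ)| ≤ 3 / 4
  rw [abs_le]
  constructor <;> linarith [h.1, h.2]

lemma isBddPeriodic (hφ : IsTest φ) : ∃ C, IsBddPeriodic φ C := by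
  obtain ⟨C, hC⟩ := hφ.exists_bound
  exact ⟨C, hφ.periodic, hφ.smooth.continuous.aestronglyMeasurable, hC⟩

lemma add_right (hφ : IsTest φ) (y : Plane) : IsTest (fun x => φ (x + y)) where
  smooth := hφ.smooth.comp (contDiff_id.add contDiff_const)
  periodic := LatticePeriodic.add_right hφ.periodic y

lemma laplacian_eq (hφ : IsTest φ) (x : Plane) :
    Laplacian.laplacian φ x = ∑ i, pderiv i (pderiv i φ) x := by
  rw [InnerProductSpace.laplacian_eq_iteratedFDeriv_orthonormalBasis φ
    (EuclideanSpace.basisFun (Fin 2) ℝ)]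
  refine Finset.sum_congr rfl fun i _ => ?_
  have h3 : DifferentiableAt ℝ (fderiv ℝ φ) x :=
    (hφ.smooth.fderiv_right (m := (⊤ : ℕ∞)) (by simp)).differentiable (by simp) x
  rw [iteratedFDeriv_two_apply, pderiv,
    show pderiv i φ = fun y => fderiv ℝ φ y (stdVec i) from rfl,
    fderiv_clm_apply h3 (differentiableAt_const _)]
  simp

end IsTest

lemma pderiv_comp_add_right (f : Plane → ℝ) (y x : Plane) (i : Fin 2) :
    pderiv i (fun x => f (x + y)) x = pderiv i f (x + y) := by
  rw [pderiv, pderiv, fderiv_comp_add_right]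

lemma norm_fderiv_le_abs_pderiv (f : Plane → ℝ) (z : Plane) :
    ‖fderiv ℝ f z‖ ≤ |pderiv 0 f z| + |pderiv 1 f z| := by
  refine ContinuousLinearMap.opNorm_le_bound _ (by positivity) fun v => ?_
  have hv : v = v 0 • stdVec 0 + v 1 • stdVec 1 := by
    ext i; fin_cases i <;> simp
  have e : fderiv ℝ f z v = v 0 * pderiv 0 f z + v 1 * pderiv 1 f z := by
    conv_lhs => rw [hv, map_add, map_smul, map_smul]
    rfl
  rw [e]
  calc |v 0 * pderiv 0 f z + v 1 * pderiv 1 f z|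
      ≤ |v 0| * |pderiv 0 f z| + |v 1| * |pderiv 1 f z| := by
        rw [← abs_mul, ← abs_mul]; exact abs_add_le _ _
    _ ≤ ‖v‖ * |pderiv 0 f z| + ‖v‖ * |pderiv 1 f z| := by
        gcongr
        · exact PiLp.norm_apply_le v 0
        · exact PiLp.norm_apply_le v 1
    _ = _ := by ring

lemma IsTest.exists_lipschitz {φ : Plane → ℝ} (hφ : IsTest φ) :
    ∃ C, 0 ≤ C ∧ ∀ x y, |φ x - φ y| ≤ C * ‖x - y‖ := by
  obtain ⟨C0, h0⟩ := (hφ.partialDeriv 0).exists_bound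
  obtain ⟨C1, h1⟩ := (hφ.partialDeriv 1).exists_bound
  have hC0 : 0 ≤ C0 := (abs_nonneg _).trans (h0 0)
  have hC1 : 0 ≤ C1 := (abs_nonneg _).trans (h1 0)
  refine ⟨C0 + C1, by positivity, fun x y => ?_⟩
  have hb : ∀ z, ‖fderiv ℝ φ z‖ ≤ C0 + C1 := fun z =>
    (norm_fderiv_le_abs_pderiv φ z).trans (add_le_add (h0 z) (h1 z))
  exact convex_univ.norm_image_sub_le_of_norm_fderiv_le (fun z _ => hφ.differentiable z)
    (fun z _ => hb z) (mem_univ y) (mem_univ x)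

/-- Integration by parts for a logarithmic kernel. -/
lemma IsLogKernel.integral_mul_pderiv {V φ : Plane → ℝ} (hV : IsLogKernel V) (hφ : IsTest φ)
    (i : Fin 2) : ∫ x, V x * pderiv i φ x ∂torusMeasure = -∫ x, pderiv i V x * φ x ∂torusMeasure := by
  obtain ⟨C, hC⟩ := hφ.isBddPeriodic
  obtain ⟨C', hC'⟩ := (hφ.partialDeriv i).isBddPeriodic
  exact TorusEuler.integral_mul_pderiv i hV.periodic hφ.periodic hV.differentiableAt
    hφ.differentiable (hC'.integrable_mul hV.integrable)
    (hC.integrable_mul (hV.hasSing_pderiv i).integrable)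

/-- This is −ΔV = δ₀ − 1. The first integration by parts moves one derivative onto V. Before the
second, φ is replaced by φ − φ(0), which has the same derivatives and is O(|x|); against second
derivatives of order |x|⁻² it is integrable, so no boundary term appears. Off the lattice ΔV = 1,
and what remains is ∫(φ − φ(0)). -/
lemma integral_thetaPotential_mul_laplacian {φ : Plane → ℝ} (hφ : IsTest φ) :
    ∫ x, thetaPotential x * Laplacian.laplacian φ x ∂torusMeasure =
      (∫ x, φ x ∂torusMeasure) - φ 0 := by
  have hV := isLogKernel_thetaPotential
  have hψ : IsTest fun x => φ x - φ 0 :=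
    ⟨hφ.smooth.sub contDiff_const, LatticePeriodic.comp hφ.periodic fun y => y - φ 0⟩
  have hψd : ∀ i, pderiv i (fun x => φ x - φ 0) = pderiv i φ := fun i => by
    funext x; rw [pderiv, pderiv, fderiv_sub_const]
  obtain ⟨C, hC0, hC⟩ := hφ.exists_lipschitz
  obtain ⟨B, hB⟩ := hφ.isBddPeriodic
  have hint : ∀ i, Integrable (fun x => pderiv i (pderiv i thetaPotential) x * (φ x - φ 0))
      torusMeasure := fun i => by
    have hS := (hV.hasSing_pderiv i).pderiv i
    obtain ⟨D, hD0, hD⟩ := hS.exists_bound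
    refine integrable_of_le_inv_norm (C := D * C)
      (hS.aesm.mul hψ.smooth.continuous.aestronglyMeasurable) fun x hx hx0 => ?_
    have h1 := hD x (unitSquare_subset_bigSquare hx) hx0
    have h2 := hC x 0
    rw [sub_zero] at h2
    have hn : 0 < ‖x‖ := norm_pos_iff.2 hx0
    rw [abs_mul]
    calc |pderiv i (pderiv i thetaPotential) x| * |φ x - φ 0|
        ≤ (D * (‖x‖⁻¹) ^ 2) * (C * ‖x‖) := by gcongr
      _ = D * C * ‖x‖⁻¹ := by field_simp
  have h1 : ∀ i, ∫ x, thetaPotential x * pderiv i (pderiv i φ) x ∂torusMeasure =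
      ∫ x, pderiv i (pderiv i thetaPotential) x * (φ x - φ 0) ∂torusMeasure := fun i => by
    obtain ⟨C', hC'⟩ := (hφ.partialDeriv i).isBddPeriodic
    have h2 := TorusEuler.integral_mul_pderiv i (hV.hasSing_pderiv i).periodic hψ.periodic.latticePeriodic
      (hV.hasSing_pderiv i).differentiableAt hψ.differentiable
      (by rw [hψd]; exact hC'.integrable_mul (hV.hasSing_pderiv i).integrable) (hint i)
    rw [hV.integral_mul_pderiv (hφ.partialDeriv i) i, ← hψd i, h2, neg_neg]
  have hLi : ∀ i ∈ Finset.univ,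
      Integrable (fun x => thetaPotential x * pderiv i (pderiv i φ) x) torusMeasure := fun i _ => by
    obtain ⟨C', hC'⟩ := ((hφ.partialDeriv i).partialDeriv i).isBddPeriodic
    exact hC'.integrable_mul hV.integrable
  simp only [hφ.laplacian_eq, Finset.mul_sum]
  rw [integral_finsetSum _ hLi]
  simp only [h1]
  rw [← integral_finsetSum _ fun i _ => hint i]
  have hae : (fun x => ∑ i, pderiv i (pderiv i thetaPotential) x * (φ x - φ 0)) =ᵐ[torusMeasure]
      fun x => φ x - φ 0 := by
    filter_upwards [ae_torus_of_ae_volume ae_notMem_lattice] with x hx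
    rw [← Finset.sum_mul, laplacian_thetaPotential hx, one_mul]
  rw [integral_congr_ae hae, integral_sub hB.integrable (integrable_const _)]
  simp

/-- An essentially bounded function agrees almost everywhere with a bounded one. -/
lemma MemLinf.exists_isBddPeriodic {f : Plane → ℝ} (hf : MemLinf f) :
    ∃ g, IsBddPeriodic g (linfNorm f).toReal ∧ g =ᵐ[torusMeasure] f := by
  set M := (linfNorm f).toReal with hM
  have hM0 : 0 ≤ M := ENNReal.toReal_nonneg
  have hp : LatticePeriodic f := hf.periodic
  refine ⟨fun x => max (-M) (min (f x) M), ⟨hp.comp fun y => max (-M) (min y M), ?_, fun x => ?_⟩, ?_⟩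
  · have h := hp.aestronglyMeasurable hf.memLp.1
    exact aestronglyMeasurable_const.sup (h.inf aestronglyMeasurable_const)
  · rw [abs_le]
    exact ⟨le_max_left _ _, max_le (by linarith) (min_le_right _ _)⟩
  · have h : ∀ᵐ x ∂torusMeasure, ‖f x‖ₑ ≤ linfNorm f := by
      have := ae_le_eLpNormEssSup (f := f) (μ := torusMeasure)
      rwa [← eLpNorm_exponent_top] at this
    filter_upwards [h] with x hx
    have h1 : |f x| ≤ M := by
      have := ENNReal.toReal_mono hf.memLp.2.ne hx
      rwa [toReal_enorm] at this
    rw [abs_le] at h1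
    rw [min_eq_left h1.2, max_eq_right h1.1]

lemma torusConv_congr_ae {K f g : Plane → ℝ} (h : f =ᵐ[torusMeasure] g) :
    torusConv K f = torusConv K g := by
  funext x
  exact integral_congr_ae (h.mono fun y hy => by simp only [hy])

/-- Coulomb potentials on the torus exist. -/
theorem isCoulombPotential_thetaPotential : IsCoulombPotential thetaPotential where
  smooth := isLogKernel_thetaPotential.smooth
  periodic := latticePeriodic_thetaPotential
  log_singularity := isLogKernel_thetaPotential.decomp
  poisson := by
    intro ϱ hϱ h0
    have hV := isLogKernel_thetaPotential
    obtain ⟨f, hf, hfe⟩ := hϱ.exists_isBddPeriodic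
    rw [← torusConv_congr_ae hfe]
    rw [← integral_congr_ae hfe] at h0
    refine ⟨contDiff_torusConv hV hf, latticePeriodic_torusConv hV.periodic f, ?_, ?_⟩
    · have h := integral_torusConv_mul (φ := fun _ => (1 : ℝ)) hV.periodic hV.integrable hf
        continuous_const (C := 1) (by simp)
      simp only [smul_eq_mul, mul_one] at h
      rw [h]
      have h1 : ∀ y, ∫ x, thetaPotential (x - y) ∂torusMeasure =
          ∫ x, thetaPotential x ∂torusMeasure := fun y => by
        simpa only [sub_eq_add_neg] using integral_torus_add hV.periodic (-y)
      simp only [h1]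
      rw [integral_mul_const, h0, zero_mul]
    · intro φ hφ
      have hL : Laplacian.laplacian φ = fun x => ∑ i, pderiv i (pderiv i φ) x :=
        funext hφ.laplacian_eq
      have hLt : IsTest (Laplacian.laplacian φ) := by
        rw [hL]
        simp only [Fin.sum_univ_two]
        exact ⟨((hφ.partialDeriv 0).partialDeriv 0).smooth.add ((hφ.partialDeriv 1).partialDeriv 1).smooth,
          LatticePeriodic.comp₂ ((hφ.partialDeriv 0).partialDeriv 0).periodic
            ((hφ.partialDeriv 1).partialDeriv 1).periodic fun a b => a + b⟩
      obtain ⟨C, hC⟩ := hLt.exists_bound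
      obtain ⟨B, hB⟩ := hφ.isBddPeriodic
      have h := integral_torusConv_mul hV.periodic hV.integrable hf hLt.smooth.continuous hC
      simp only [smul_eq_mul] at h
      -- Translation by y brings the singularity to the origin. Integrated against a density of mean
      -- zero, the constant ∫φ disappears.
      have h1 : ∀ y, ∫ x, thetaPotential (x - y) * Laplacian.laplacian φ x ∂torusMeasure =
          (∫ x, φ x ∂torusMeasure) - φ y := fun y => by
        have h2 := integral_torus_add (f := fun x => thetaPotential (x - y) *
          Laplacian.laplacian φ x) ((hV.periodic.sub_right y).comp₂ hLt.periodic _) y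
        have h3 := integral_thetaPotential_mul_laplacian (hφ.add_right y)
        rw [integral_torus_add (IsPeriodic.latticePeriodic hφ.periodic), zero_add] at h3
        rw [← h2, ← h3]
        refine integral_congr_ae (ae_of_all _ fun x => ?_)
        simp only [add_sub_cancel_right]
        rw [hφ.laplacian_eq, (hφ.add_right y).laplacian_eq]
        congr 2
        funext i
        rw [show pderiv i (fun x => φ (x + y)) = fun x => pderiv i φ (x + y) from
          funext fun x => pderiv_comp_add_right φ y x i, pderiv_comp_add_right]
      simp only [h1] at h
      have e : ∀ y, f y * ((∫ x, φ x ∂torusMeasure) - φ y) =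
          f y * (∫ x, φ x ∂torusMeasure) - f y * φ y := fun y => by ring
      rw [h]
      simp only [e]
      rw [integral_sub (hf.integrable.mul_const _) (hB.integrable_mul hf.integrable),
        integral_mul_const, h0, zero_mul, zero_sub, neg_neg]
      exact integral_congr_ae (hfe.mono fun x hx => by simp only [hx])

/-! ### Fourier coefficients of a Coulomb potential and bounds in L². -/

lemma coef_re {f : Plane → ℝ} (hf : Integrable f torusMeasure) (n : Fin 2 → ℤ) :
    (coef f n).re = ∫ x, f x * (char (-n) x).re ∂torusMeasure := by
  have h := integral_re (𝕜 := ℂ) (integrable_char_mul hf (-n))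
  simp only [RCLike.re_to_complex] at h
  rw [coef, ← h]
  refine integral_congr_ae (ae_of_all _ fun x => ?_)
  simp [mul_comm]

lemma coef_im {f : Plane → ℝ} (hf : Integrable f torusMeasure) (n : Fin 2 → ℤ) :
    (coef f n).im = ∫ x, f x * (char (-n) x).im ∂torusMeasure := by
  have h := integral_im (𝕜 := ℂ) (integrable_char_mul hf (-n))
  simp only [RCLike.im_to_complex] at h
  rw [coef, ← h]
  refine integral_congr_ae (ae_of_all _ fun x => ?_)
  simp [mul_comm]

lemma isTest_char_re (n : Fin 2 → ℤ) : IsTest fun x => (char n x).re where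
  smooth := Complex.reCLM.contDiff.comp (contDiff_char n)
  periodic := (latticePeriodic_char n).comp Complex.re

lemma isTest_char_im (n : Fin 2 → ℤ) : IsTest fun x => (char n x).im where
  smooth := Complex.imCLM.contDiff.comp (contDiff_char n)
  periodic := (latticePeriodic_char n).comp Complex.im

lemma hasFDerivAt_char (n : Fin 2 → ℤ) (x : Plane) :
    HasFDerivAt (char n) (fderiv ℝ (char n) x) x :=
  ((contDiff_char n (m := 1)).differentiable (by simp)).differentiableAt.hasFDerivAt

lemma pderiv_char_re (n : Fin 2 → ℤ) (i : Fin 2) :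
    (pderiv i fun x => (char n x).re) = fun x => -(2 * Real.pi * n i) * (char n x).im := by
  funext x
  have h := Complex.reCLM.hasFDerivAt.comp x (hasFDerivAt_char n x)
  rw [pderiv, show (fun x => (char n x).re) = Complex.reCLM ∘ char n from rfl, h.fderiv]
  simp [fderiv_char]

lemma pderiv_char_im (n : Fin 2 → ℤ) (i : Fin 2) :
    (pderiv i fun x => (char n x).im) = fun x => (2 * Real.pi * n i) * (char n x).re := by
  funext x
  have h := Complex.imCLM.hasFDerivAt.comp x (hasFDerivAt_char n x)
  rw [pderiv, show (fun x => (char n x).im) = Complex.imCLM ∘ char n from rfl, h.fderiv]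
  simp [fderiv_char]

/-- The squared Euclidean length of an integer vector. -/
def sqLen (n : Fin 2 → ℤ) : ℝ := (n 0 : ℝ) ^ 2 + (n 1 : ℝ) ^ 2

lemma sqLen_pos {n : Fin 2 → ℤ} (hn : n ≠ 0) : 0 < sqLen n := by
  have h : n 0 ≠ 0 ∨ n 1 ≠ 0 := by
    by_contra! h
    exact hn (funext fun i => by fin_cases i; exacts [h.1, h.2])
  rcases h with h | h
  · have : (n 0 : ℝ) ≠ 0 := by exact_mod_cast h
    unfold sqLen; positivity
  · have : (n 1 : ℝ) ≠ 0 := by exact_mod_cast h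
    unfold sqLen; positivity

lemma laplacian_char_re (n : Fin 2 → ℤ) (x : Plane) :
    Laplacian.laplacian (fun x => (char n x).re) x =
      -(4 * Real.pi ^ 2 * sqLen n) * (char n x).re := by
  rw [(isTest_char_re n).laplacian_eq, Fin.sum_univ_two]
  simp only [pderiv_char_re, pderiv_const_mul (isTest_char_im n).differentiable.differentiableAt,
    pderiv_char_im, sqLen]
  ring

lemma laplacian_char_im (n : Fin 2 → ℤ) (x : Plane) :
    Laplacian.laplacian (fun x => (char n x).im) x =
      -(4 * Real.pi ^ 2 * sqLen n) * (char n x).im := by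
  rw [(isTest_char_im n).laplacian_eq, Fin.sum_univ_two]
  simp only [pderiv_char_im, pderiv_const_mul (isTest_char_re n).differentiable.differentiableAt,
    pderiv_char_re, sqLen]
  ring

lemma integral_char {n : Fin 2 → ℤ} (hn : n ≠ 0) : ∫ x, char n x ∂torusMeasure = 0 := by
  have hi : Integrable (char n) torusMeasure :=
    Integrable.of_bound (continuous_char n).aestronglyMeasurable 1 (ae_of_all _ fun x => by simp)
  have h : ∀ k, (n k : ℂ) * ∫ x, char n x ∂torusMeasure = 0 := fun k => by
    have h1 := integral_pderivE_eq_zero (F := char n) k (latticePeriodic_char n)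
      (fun x _ => (hasFDerivAt_char n x).differentiableAt)
      (by simp only [fderiv_char]; exact hi.const_mul _)
    simp only [fderiv_char] at h1
    rw [integral_const_mul, mul_assoc] at h1
    exact (mul_eq_zero.1 h1).resolve_left Complex.two_pi_I_ne_zero
  by_contra h0
  refine hn (funext fun k => ?_)
  have := (mul_eq_zero.1 (h k)).resolve_right h0
  exact_mod_cast this

lemma coef_char_re {n : Fin 2 → ℤ} (hn : n ≠ 0) : coef (fun x => (char n x).re) n = 1 / 2 := by
  have hi : ∀ m, Integrable (char m) torusMeasure := fun m =>
    Integrable.of_bound (continuous_char m).aestronglyMeasurable 1 (ae_of_all _ fun x => by simp)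
  have e : ∀ x, char (-n) x * ((char n x).re : ℂ) = (1 + char (-n - n) x) / 2 := fun x => by
    have h1 : char (-n) x * char n x = 1 := by
      rw [char_neg, mul_comm, Complex.mul_conj, Complex.normSq_eq_norm_sq, norm_char]; simp
    have h2 : char (-n - n) x = char (-n) x * char (-n) x := by
      simp only [char, ← Complex.exp_add]
      congr 1
      simp only [Pi.sub_apply, Pi.neg_apply]
      push_cast
      ring
    rw [Complex.re_eq_add_conj, ← char_neg, h2]
    linear_combination (1 / 2) * h1
  have h0 : -n - n ≠ 0 := fun h => hn (funext fun k => by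
    have := congrFun h k
    simp only [Pi.sub_apply, Pi.neg_apply, Pi.zero_apply] at this ⊢
    omega)
  simp only [coef, e]
  rw [integral_div, integral_add (integrable_const _) (hi _), integral_char h0]
  simp

lemma memLinf_of_isTest {φ : Plane → ℝ} (hφ : IsTest φ) : MemLinf φ := by
  obtain ⟨C, hC⟩ := hφ.isBddPeriodic
  exact ⟨hφ.periodic, hC.memLp _⟩

/-- The Fourier coefficients of a Coulomb potential. -/
theorem IsCoulombPotential.coef_eq {V : Plane → ℝ} (hV : IsCoulombPotential V) {n : Fin 2 → ℤ}
    (hn : n ≠ 0) : coef V n = 1 / (4 * Real.pi ^ 2 * sqLen n : ℝ) := by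
  have hL := hV.isLogKernel
  -- The density is a real trigonometric polynomial of mean zero with n-th coefficient 1/2.
  -- Poisson's equation tested on the real and imaginary parts of the character of −n then isolates
  -- the n-th coefficient of V.
  set ϱ : Plane → ℝ := fun x => (char n x).re with hϱ
  have ht : IsTest ϱ := isTest_char_re n
  obtain ⟨C, hC⟩ := ht.isBddPeriodic
  have h0 : ∫ x, ϱ x ∂torusMeasure = 0 := by
    have h := coef_re (f := fun _ => (1 : ℝ)) (integrable_const _) (-n)
    have h1 : coef (fun _ => (1 : ℝ)) (-n) = 0 := by
      simp [coef, integral_char hn]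
    rw [h1, neg_neg] at h
    simpa using h.symm
  have hp := (hV.poisson ϱ (memLinf_of_isTest ht) h0).2.2.2
  have hΦ := isBddPeriodic_torusConv hL.periodic hL.integrable hC
  have hre := hp _ (isTest_char_re (-n))
  have him := hp _ (isTest_char_im (-n))
  have hs : sqLen (-n) = sqLen n := by simp [sqLen]
  simp only [laplacian_char_re, laplacian_char_im, hs, mul_left_comm _ (-(4 * Real.pi ^ 2 * sqLen n)),
    integral_const_mul] at hre him
  rw [← coef_re hΦ.integrable, ← coef_re hC.integrable] at hre
  rw [← coef_im hΦ.integrable, ← coef_im hC.integrable] at him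
  have h1 : (4 * Real.pi ^ 2 * sqLen n : ℝ) * coef (torusConv V ϱ) n = coef ϱ n := by
    apply Complex.ext
    · rw [Complex.re_ofReal_mul]; linarith
    · rw [Complex.im_ofReal_mul]; linarith
  rw [coef_torusConv hL.periodic hL.integrable hC, coef_char_re hn] at h1
  have h2 : ((4 * Real.pi ^ 2 * sqLen n : ℝ) : ℂ) ≠ 0 := by
    have := sqLen_pos hn
    have := Real.pi_pos
    rw [Complex.ofReal_ne_zero]
    positivity
  rw [eq_div_iff h2]
  linear_combination 2 * h1

/-- The components of the rotation of an integer vector. -/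
def perpVec (n : Fin 2 → ℤ) (j : Fin 2) : ℤ := (![-n 1, n 0] : Fin 2 → ℤ) j

lemma coef_perpGrad {V : Plane → ℝ} (hV : IsLogKernel V) (j : Fin 2) (n : Fin 2 → ℤ) :
    coef (perpGrad V j) n = 2 * Real.pi * Complex.I * perpVec n j * coef V n := by
  have h := fun k => coef_pderiv k hV.periodic hV.differentiableAt hV.integrable
    (hV.hasSing_pderiv k).integrable n
  fin_cases j
  · have e : perpGrad V 0 = fun x => -pderiv 1 V x := rfl
    simp only [Fin.zero_eta, e, coef_neg_fun, h, perpVec, Matrix.cons_val_zero]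
    push_cast
    ring
  · have e : perpGrad V 1 = pderiv 0 V := rfl
    simp only [Fin.mk_one, e, h, perpVec, Matrix.cons_val_one, Matrix.cons_val_zero]

lemma norm_coef_perpGrad {V : Plane → ℝ} (hV : IsCoulombPotential V) (j : Fin 2) {n : Fin 2 → ℤ}
    (hn : n ≠ 0) : ‖coef (perpGrad V j) n‖ = |(perpVec n j : ℝ)| / (2 * Real.pi * sqLen n) := by
  have h0 := sqLen_pos hn
  have hpi := Real.pi_pos
  have hD : 0 ≤ 4 * Real.pi ^ 2 * sqLen n := by positivity
  rw [coef_perpGrad hV.isLogKernel, hV.coef_eq hn, norm_mul, norm_div, Complex.norm_real,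
    Real.norm_of_nonneg hD]
  simp only [norm_mul, Complex.norm_I, Complex.norm_real, Complex.norm_intCast,
    Complex.norm_two, norm_one, Real.norm_of_nonneg hpi.le]
  field_simp
  ring

lemma abs_perpVec_mul_le (n : Fin 2 → ℤ) (j k : Fin 2) :
    |(perpVec n j : ℝ)| * |(n k : ℝ)| ≤ sqLen n := by
  have h : ∀ a b : ℝ, |a| * |b| ≤ a ^ 2 + b ^ 2 := fun a b => by
    nlinarith [sq_nonneg (|a| - |b|), sq_abs a, sq_abs b, abs_nonneg a, abs_nonneg b]
  have h' : ∀ a b : ℝ, |a| * |a| ≤ a ^ 2 + b ^ 2 := fun a b => by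
    rw [abs_mul_abs_self]; nlinarith [sq_nonneg b]
  unfold sqLen
  fin_cases j <;> fin_cases k <;> simp [perpVec]
  · rw [mul_comm]; exact h _ _
  · nlinarith [sq_nonneg (n 0 : ℝ)]
  · nlinarith [sq_nonneg (n 1 : ℝ)]
  · exact h _ _

/-- The Fourier multiplier of `∂_k ∇^⊥_j V ⋆` is bounded by `1`. -/
lemma norm_multiplier_le {V : Plane → ℝ} (hV : IsCoulombPotential V) (j k : Fin 2)
    (n : Fin 2 → ℤ) : ‖2 * Real.pi * Complex.I * n k * coef (perpGrad V j) n‖ ≤ 1 := by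
  by_cases hn : n = 0
  · subst hn; simp
  have h0 := sqLen_pos hn
  have hpi := Real.pi_pos
  have h := abs_perpVec_mul_le n j k
  simp only [norm_mul, norm_coef_perpGrad hV j hn, Complex.norm_I, Complex.norm_real,
    Complex.norm_intCast, Complex.norm_two, Real.norm_of_nonneg hpi.le]
  rw [mul_one, mul_div_assoc', div_le_one (by positivity)]
  calc 2 * Real.pi * |(n k : ℝ)| * |(perpVec n j : ℝ)|
      = 2 * Real.pi * (|(perpVec n j : ℝ)| * |(n k : ℝ)|) := by ring
    _ ≤ 2 * Real.pi * sqLen n := by gcongr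

/-- The frequency lost in the increment of the character cancels against the decay |n|⁻¹ of the
coefficient, uniformly in n; the 2 counts the two coordinates of n. Through Parseval this is a
Lipschitz bound in L² for the velocity. -/
lemma norm_char_sub_one_mul_le {V : Plane → ℝ} (hV : IsCoulombPotential V) (j : Fin 2)
    (n : Fin 2 → ℤ) (z : Plane) :
    ‖(char n z - 1) * coef (perpGrad V j) n‖ ≤ 2 * ‖z‖ := by
  by_cases hn : n = 0
  · subst hn; simp
  have h0 := sqLen_pos hn
  have hpi := Real.pi_pos
  have e0 := abs_perpVec_mul_le n j 0
  have e1 := abs_perpVec_mul_le n j 1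
  rw [norm_mul, norm_coef_perpGrad hV j hn, mul_div_assoc', div_le_iff₀ (by positivity)]
  calc ‖char n z - 1‖ * |(perpVec n j : ℝ)|
      ≤ 2 * Real.pi * (|(n 0 : ℝ)| + |(n 1 : ℝ)|) * ‖z‖ * |(perpVec n j : ℝ)| := by
        gcongr; exact norm_char_sub_one_le n z
    _ = 2 * Real.pi * ‖z‖ * (|(perpVec n j : ℝ)| * |(n 0 : ℝ)| +
          |(perpVec n j : ℝ)| * |(n 1 : ℝ)|) := by ring
    _ ≤ 2 * Real.pi * ‖z‖ * (sqLen n + sqLen n) := by gcongr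
    _ = 2 * ‖z‖ * (2 * Real.pi * sqLen n) := by ring

/-- Comparison of `L²` norms through Fourier coefficients. -/
lemma integral_sq_le_of_coef_le {f g : Plane → ℝ} (hf : MemLp f 2 torusMeasure)
    (hg : MemLp g 2 torusMeasure) {C : ℝ} (h : ∀ n, ‖coef g n‖ ≤ C * ‖coef f n‖) :
    ∫ x, g x ^ 2 ∂torusMeasure ≤ C ^ 2 * ∫ x, f x ^ 2 ∂torusMeasure := by
  refine hasSum_le (fun n => ?_) (hasSum_sq_coef hg) ((hasSum_sq_coef hf).mul_left (C ^ 2))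
  rw [← mul_pow]
  exact pow_le_pow_left₀ (norm_nonneg _) (h n) 2

/-- `L²` bound for the differences of the convolution with `∇^⊥ V`. -/
theorem integral_sq_torusConv_sub_le {V f : Plane → ℝ} {M : ℝ} (hV : IsCoulombPotential V)
    (hf : IsBddPeriodic f M) (j : Fin 2) (z : Plane) :
    ∫ x, (torusConv (perpGrad V j) f (x + z) - torusConv (perpGrad V j) f x) ^ 2 ∂torusMeasure ≤
      (2 * ‖z‖) ^ 2 * ∫ x, f x ^ 2 ∂torusMeasure := by
  have hS := hV.isLogKernel.hasSing_perpGrad j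
  have hh := isBddPeriodic_torusConv hS.periodic hS.integrable hf
  refine integral_sq_le_of_coef_le (hf.memLp 2) (((hh.add_right z).sub hh).memLp 2) fun n => ?_
  rw [coef_sub (hh.add_right z).integrable hh.integrable, coef_add_right hh.periodic,
    coef_torusConv hS.periodic hS.integrable hf, ← sub_one_mul, ← mul_assoc, norm_mul]
  exact mul_le_mul_of_nonneg_right (norm_char_sub_one_mul_le hV j n z) (norm_nonneg _)

/-- Translations are continuous in `L²`. -/
theorem tendsto_integral_sq_sub {f : Plane → ℝ} {M : ℝ} (hf : IsBddPeriodic f M) :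
    Tendsto (fun z => ∫ x, (f (x + z) - f x) ^ 2 ∂torusMeasure) (𝓝 0) (𝓝 0) := by
  have h : ∀ z, ∫ x, (f (x + z) - f x) ^ 2 ∂torusMeasure =
      ∑' n, ‖(char n z - 1) * coef f n‖ ^ 2 := fun z => by
    rw [← (hasSum_sq_coef (((hf.add_right z).sub hf).memLp 2)).tsum_eq]
    refine tsum_congr fun n => ?_
    rw [coef_sub (hf.add_right z).integrable hf.integrable, coef_add_right hf.periodic, sub_one_mul]
  simp only [h]
  have h0 : (0 : ℝ) = ∑' n : Fin 2 → ℤ, (0 : ℝ) := by simp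
  rw [h0]
  refine tendsto_tsum_of_dominated_convergence (bound := fun n => 4 * ‖coef f n‖ ^ 2)
    ((hasSum_sq_coef (hf.memLp 2)).summable.mul_left 4) (fun n => ?_)
    (Eventually.of_forall fun z n => ?_)
  · have hc : Continuous fun z => ‖(char n z - 1) * coef f n‖ ^ 2 :=
      (((continuous_char n).sub continuous_const).mul continuous_const).norm.pow 2
    have := hc.tendsto 0
    simpa using this
  · rw [Real.norm_of_nonneg (by positivity), norm_mul, mul_pow]
    have : ‖char n z - 1‖ ≤ 2 := by
      refine (norm_sub_le _ _).trans ?_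
      rw [norm_char, norm_one]; norm_num
    gcongr
    calc ‖char n z - 1‖ ^ 2 ≤ 2 ^ 2 := by gcongr
      _ = 4 := by norm_num

/-- A weak derivative of `∇^⊥_j V ⋆ f` in direction `k` exists in `L²`. -/
theorem exists_weakDeriv {V f : Plane → ℝ} {M : ℝ} (hV : IsCoulombPotential V)
    (hf : IsBddPeriodic f M) (k j : Fin 2) :
    ∃ g : Plane → ℝ, MemLp g 2 torusMeasure ∧ IsCZ V k j f g ∧
      (∀ n, coef g n = 2 * Real.pi * Complex.I * n k * coef (perpGrad V j) n * coef f n) ∧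
      ∫ x, g x ^ 2 ∂torusMeasure ≤ ∫ x, f x ^ 2 ∂torusMeasure := by
  have hS := hV.isLogKernel.hasSing_perpGrad j
  have hh := isBddPeriodic_torusConv hS.periodic hS.integrable hf
  set c : (Fin 2 → ℤ) → ℂ := fun n =>
    2 * Real.pi * Complex.I * n k * coef (perpGrad V j) n * coef f n with hc
  have hle : ∀ n, ‖c n‖ ≤ 1 * ‖coef f n‖ := fun n => by
    rw [hc]
    simp only []
    rw [norm_mul]
    exact mul_le_mul_of_nonneg_right (norm_multiplier_le hV j k n) (norm_nonneg _)
  -- The derivative is defined by its Fourier series; conjugate symmetry of the coefficients makes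
  -- it real.
  obtain ⟨g, hgp, hg2, hgc⟩ := exists_coef_eq (c := c)
    (((hasSum_sq_coef (hf.memLp 2)).summable).of_nonneg_of_le (fun n => sq_nonneg _)
      fun n => pow_le_pow_left₀ (norm_nonneg _) (by simpa using hle n) 2)
    (fun n => by
      simp only [hc, map_mul, coef_neg, Complex.conj_I, Complex.conj_ofReal, Pi.neg_apply,
        map_ofNat, map_intCast]
      push_cast
      ring)
  refine ⟨g, hg2, ⟨hh.periodic, hgp, hh.locallyIntegrable,
    hgp.locallyIntegrable (hg2.integrable (by norm_num)), fun φ hφ => ?_⟩, hgc, ?_⟩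
  · obtain ⟨C, hC⟩ := hφ.isBddPeriodic
    obtain ⟨C', hC'⟩ := (hφ.partialDeriv k).isBddPeriodic
    have h1 := hasSum_coef_mul (hh.memLp 2) (hC'.memLp 2)
    have h2 := (hasSum_coef_mul hg2 (hC.memLp 2)).neg
    -- Parseval turns integration by parts into a termwise identity: conjugation changes the sign of
    -- the factor 2πi n_k.
    have e : ∀ n, (starRingEnd ℂ) (coef (torusConv (perpGrad V j) f) n) * coef (pderiv k φ) n =
        -((starRingEnd ℂ) (coef g n) * coef φ n) := fun n => by
      rw [hgc, coef_torusConv hS.periodic hS.integrable hf,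
        coef_pderiv k hφ.periodic (fun x _ => hφ.differentiable x) hC.integrable hC'.integrable]
      simp only [hc, map_mul, Complex.conj_I, Complex.conj_ofReal, map_ofNat, map_intCast]
      ring
    simp only [e] at h1
    have := h1.unique h2
    exact_mod_cast this
  · have := integral_sq_le_of_coef_le (hf.memLp 2) hg2 (C := 1) fun n => by rw [hgc]; exact hle n
    simpa using this

/-! ### Distance on the torus and periodisation of test functions. -/

lemma norm_coe_le_abs (t : ℝ) : ‖(t : UnitAddCircle)‖ ≤ |t| := by
  rw [UnitAddCircle.norm_eq]
  simpa using round_le t 0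

/-- The torus carries the supremum norm of the coordinate distances to ℤ, so its balls are cubes,
whereas the plane is Euclidean. -/
lemma norm_toTorus_le (x : Plane) : ‖toTorus x‖ ≤ ‖x‖ := by
  rw [pi_norm_le_iff_of_nonneg (norm_nonneg _)]
  exact fun i => (norm_coe_le_abs _).trans (PiLp.norm_apply_le x i)

lemma norm_coe_eq_abs {t : ℝ} (h : |t| ≤ 1 / 2) : ‖(t : UnitAddCircle)‖ = |t| := by
  exact (AddCircle.norm_coe_eq_abs_iff (1 : ℝ) one_ne_zero).2 (by simpa using h)

lemma toTorus_sub (x y : Plane) : toTorus (x - y) = toTorus x - toTorus y := by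
  funext i; simp [toTorus]

lemma toTorus_add (x y : Plane) : toTorus (x + y) = toTorus x + toTorus y := by
  funext i; simp [toTorus]

lemma continuous_toTorus : Continuous toTorus :=
  continuous_pi fun i => (AddCircle.continuous_mk' 1).comp (by fun_prop)

/-- The function `ψ` summed over integer translates, when supported near the origin. -/
def periodize (ψ : Plane → ℝ) (x : Plane) : ℝ :=
  ψ (WithLp.toLp 2 fun i => x i - round (x i))

lemma latticePeriodic_periodize (ψ : Plane → ℝ) : LatticePeriodic (periodize ψ) := fun n x => by
  simp only [periodize]
  congr 2
  funext i
  simp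

/-- Rounding selects the nearest lattice translate and is discontinuous only at half-integers, where
ψ already vanishes because its support stays within 1/4 of the centre. Tests on the plane with small
support thus become tests on the torus. -/
lemma exists_periodization {ψ : Plane → ℝ} (hψ : ContDiff ℝ (⊤ : ℕ∞) ψ) {a : Plane}
    (hs : ∀ x, (∃ i, 1 / 4 < |x i - a i|) → ψ x = 0) :
    ∃ φ, IsTest φ ∧ ∀ x ∈ cube (a + corner) 1, φ =ᶠ[𝓝 x] ψ := by
  set ψ₀ : Plane → ℝ := fun y => ψ (y + a) with hψ₀
  have hs₀ : ∀ x, (∃ i, 1 / 4 < |x i|) → ψ₀ x = 0 := fun x ⟨i, hi⟩ => hs _ ⟨i, by simpa using hi⟩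
  have hψ₀s : ContDiff ℝ (⊤ : ℕ∞) ψ₀ := hψ.comp (contDiff_id.add contDiff_const)
  have hfar : ∀ x, (∃ i, 1 / 4 < ‖((x i : ℝ) : UnitAddCircle)‖) → periodize ψ₀ =ᶠ[𝓝 x] 0 := by
    rintro x ⟨i, hi⟩
    have hc : Continuous fun y : Plane => ‖((y i : ℝ) : UnitAddCircle)‖ :=
      ((AddCircle.continuous_mk' 1).comp (by fun_prop : Continuous fun y : Plane => y i)).norm
    filter_upwards [(isOpen_lt continuous_const hc).mem_nhds hi] with y hy
    refine hs₀ _ ⟨i, ?_⟩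
    simp only [UnitAddCircle.norm_eq] at hy
    exact hy
  have hnear : ∀ (n : Fin 2 → ℤ) (x : Plane), (∀ i, |x i - n i| < 1 / 2) →
      periodize ψ₀ =ᶠ[𝓝 x] fun y => ψ₀ (y - latticeVec n) := by
    intro n x hx
    have ho : IsOpen {y : Plane | ∀ i, |y i - n i| < 1 / 2} := by
      simp only [ofPred_forall]
      exact isOpen_iInter_of_finite fun i => isOpen_lt (by fun_prop) continuous_const
    filter_upwards [ho.mem_nhds hx] with y hy
    simp only [periodize]
    congr 1
    ext i
    have : round (y i) = n i := by
      have h1 := abs_lt.1 (hy i)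
      rw [round_eq, Int.floor_eq_iff]
      constructor <;> linarith
    simp [this]
  refine ⟨fun x => periodize ψ₀ (x - a), ⟨?_, (latticePeriodic_periodize ψ₀).sub_right a⟩, ?_⟩
  · have h : ContDiff ℝ (⊤ : ℕ∞) (periodize ψ₀) := by
      rw [contDiff_iff_contDiffAt]
      intro x
      -- Either some coordinate is far from ℤ and the function vanishes nearby, or all are within
      -- 1/4 of ℤ and the rounding is locally constant.
      by_cases hx : ∃ i, 1 / 4 < ‖((x i : ℝ) : UnitAddCircle)‖
      · exact contDiffAt_const.congr_of_eventuallyEq (hfar x hx)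
      · push Not at hx
        refine ContDiffAt.congr_of_eventuallyEq ?_ (hnear (fun i => round (x i)) x fun i => ?_)
        · exact (hψ₀s.comp (contDiff_id.sub contDiff_const)).contDiffAt
        · have := hx i
          rw [UnitAddCircle.norm_eq] at this
          linarith
    exact h.comp (contDiff_id.sub contDiff_const)
  · intro x hx
    have hx' : ∀ i, |x i - a i| ≤ 1 / 2 := fun i => by
      have := hx i
      simp only [corner, PiLp.add_apply, mem_Icc] at this
      rw [abs_le]
      constructor <;> linarith [this.1, this.2]
    have hcont : Tendsto (fun y : Plane => y - a) (𝓝 x) (𝓝 (x - a)) :=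
      (continuous_id.sub continuous_const).tendsto x
    by_cases h : ∃ i, 1 / 4 < |x i - a i|
    · have h2 : ∃ i, 1 / 4 < ‖(((x - a) i : ℝ) : UnitAddCircle)‖ := by
        obtain ⟨i, hi⟩ := h
        exact ⟨i, by rw [PiLp.sub_apply, norm_coe_eq_abs (hx' i)]; exact hi⟩
      have ho : IsOpen {y : Plane | ∃ i, 1 / 4 < |y i - a i|} := by
        simp only [ofPred_exists]
        exact isOpen_iUnion fun i => isOpen_lt continuous_const (by fun_prop)
      filter_upwards [hcont.eventually (hfar _ h2), ho.mem_nhds h] with y hy1 hy2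
      rw [hy1, hs y hy2]; rfl
    · push Not at h
      have h2 : ∀ i, |(x - a) i - (0 : Fin 2 → ℤ) i| < 1 / 2 := fun i => by
        have := h i
        simp only [PiLp.sub_apply, Pi.zero_apply, Int.cast_zero, sub_zero]
        linarith
      filter_upwards [hcont.eventually (hnear 0 _ h2)] with y hy
      rw [hy]
      have : latticeVec 0 = 0 := by ext i; simp
      simp [hψ₀, this]

/-- Unfolding of integrals over the torus against a function supported in a small cube. -/
lemma integral_torus_eq_integral {F φ ψ : Plane → ℝ} {a : Plane} (hF : LatticePeriodic F)
    (hφ : LatticePeriodic φ) (hs : ∀ x, (∃ i, 1 / 4 < |x i - a i|) → ψ x = 0)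
    (h : ∀ x ∈ cube (a + corner) 1, φ x = ψ x) :
    ∫ x, F x * φ x ∂torusMeasure = ∫ x, F x * ψ x := by
  rw [← setIntegral_cube_one (hF.comp₂ hφ fun s t => s * t) (a + corner),
    ← setIntegral_eq_integral_of_forall_compl_eq_zero (s := cube (a + corner) 1)
      (f := fun x => F x * ψ x)]
  · exact setIntegral_congr_fun (measurableSet_cube _ _) fun x hx => by simp only [h x hx]
  · intro x hx
    rw [hs x, mul_zero]
    by_contra! hc
    refine hx fun i => ?_
    have := abs_le.1 (hc i)
    simp only [corner, PiLp.add_apply, mem_Icc]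
    constructor <;> linarith [this.1, this.2]

/-! ### Kernel differences, truncation and the near–far splitting. -/

/-- The difference of a singular kernel at nearby points. -/
lemma HasSing.exists_sub_bound {m : ℕ} {K : Plane → ℝ} (hK : HasSing m K) :
    ∃ C, 0 ≤ C ∧ ∀ z ∈ unitSquare, z ≠ 0 → ∀ v : Plane, ‖v‖ ≤ ‖z‖ / 2 → ‖v‖ ≤ 1 / 4 →
      |K (z + v) - K z| ≤ C * ‖v‖ * (‖z‖⁻¹) ^ (m + 1) := by
  obtain ⟨C0, h0, hC0⟩ := (hK.pderiv 0).exists_bound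
  obtain ⟨C1, h1, hC1⟩ := (hK.pderiv 1).exists_bound
  refine ⟨(C0 + C1) * 2 ^ (m + 1), by positivity, fun z hz hz0 v hv hv' => ?_⟩
  have hn : 0 < ‖z‖ := norm_pos_iff.2 hz0
  -- The ball stays in the square by the margin 1/4 and away from the origin by ‖v‖ ≤ ‖z‖/2, so the
  -- mean value inequality applies on it with a derivative of order m + 1.
  have hball : ∀ w ∈ Metric.closedBall z ‖v‖, w ∈ bigSquare ∧ ‖z‖ / 2 ≤ ‖w‖ := fun w hw => by
    have hw' : ‖w - z‖ ≤ ‖v‖ := by simpa [dist_eq_norm] using hw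
    refine ⟨fun i => ?_, ?_⟩
    · have h2 := (PiLp.norm_apply_le (w - z) i).trans hw'
      have h3 := hz i
      rw [PiLp.sub_apply, Real.norm_eq_abs, abs_le] at h2
      rw [abs_le]
      constructor <;> linarith [h3.1, h3.2, h2.1, h2.2]
    · have := norm_sub_norm_le z w
      rw [norm_sub_rev] at this
      linarith
  have hw0 : ∀ w ∈ Metric.closedBall z ‖v‖, w ≠ 0 := fun w hw => by
    rw [← norm_pos_iff]; linarith [(hball w hw).2]
  have key := (convex_closedBall z ‖v‖).norm_image_sub_le_of_norm_fderiv_le (𝕜 := ℝ) (f := K)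
    (C := (C0 + C1) * (2 * ‖z‖⁻¹) ^ (m + 1)) (x := z) (y := z + v)
    (fun w hw => hK.differentiableAt w <| notMem_lattice_of_abs_lt (hw0 w hw) fun i =>
      ((hball w hw).1 i).trans_lt (by norm_num))
    (fun w hw => by
      have hinv : ‖w‖⁻¹ ≤ 2 * ‖z‖⁻¹ := by
        rw [show 2 * ‖z‖⁻¹ = (‖z‖ / 2)⁻¹ by field_simp]
        exact inv_anti₀ (by positivity) (hball w hw).2
      calc ‖fderiv ℝ K w‖ ≤ |TorusEuler.pderiv 0 K w| + |TorusEuler.pderiv 1 K w| :=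
            norm_fderiv_le_abs_pderiv K w
        _ ≤ C0 * (‖w‖⁻¹) ^ (m + 1) + C1 * (‖w‖⁻¹) ^ (m + 1) :=
            add_le_add (hC0 w (hball w hw).1 (hw0 w hw)) (hC1 w (hball w hw).1 (hw0 w hw))
        _ = (C0 + C1) * (‖w‖⁻¹) ^ (m + 1) := by ring
        _ ≤ _ := by gcongr)
    (by simp) (by simp [dist_eq_norm])
  rw [add_sub_cancel_left, Real.norm_eq_abs, mul_pow] at key
  linarith

/-- A kernel cut off near the lattice. -/
def truncKernel (K : Plane → ℝ) (r : ℝ) (x : Plane) : ℝ := if r ≤ ‖toTorus x‖ then K x else 0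

lemma truncKernel_of_le {K : Plane → ℝ} {r : ℝ} {x : Plane} (h : r ≤ ‖toTorus x‖) :
    truncKernel K r x = K x := if_pos h

lemma latticePeriodic_norm_toTorus : LatticePeriodic fun x => ‖toTorus x‖ := fun n x => by
  have := toTorus_add_latticeVec n x
  simp only [this]

lemma HasSing.isBddPeriodic_truncKernel {m : ℕ} {K : Plane → ℝ} (hK : HasSing m K) {r : ℝ}
    (hr : 0 < r) : ∃ C, IsBddPeriodic (truncKernel K r) C := by
  obtain ⟨C, hC0, hC⟩ := hK.exists_bound
  have hp : LatticePeriodic (truncKernel K r) :=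
    latticePeriodic_norm_toTorus.comp₂ hK.periodic fun (s t : ℝ) => if r ≤ s then t else 0
  refine ⟨C * (r⁻¹) ^ m, hp, ?_, fun x => ?_⟩
  · have : truncKernel K r = {x | r ≤ ‖toTorus x‖}.indicator K := by
      funext x; by_cases h : r ≤ ‖toTorus x‖ <;> simp [truncKernel, h]
    rw [this]
    exact hK.aesm.indicator (isClosed_le continuous_const continuous_toTorus.norm).measurableSet
  · rw [← hp.apply_ofTorus x]
    set y := ofTorus (toTorus x) with hy
    by_cases h : r ≤ ‖toTorus y‖
    · rw [truncKernel_of_le h]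
      have hyn : r ≤ ‖y‖ := h.trans (norm_toTorus_le y)
      have hys : y ∈ bigSquare := fun i => by
        have h : ((AddCircle.equivIoc 1 (-1 / 2) (toTorus x i)).1 : ℝ) ∈
            Ioc (-1 / 2 : ℝ) (-1 / 2 + 1) := (AddCircle.equivIoc 1 (-1 / 2) (toTorus x i)).2
        show |((AddCircle.equivIoc 1 (-1 / 2) (toTorus x i)).1 : ℝ)| ≤ 3 / 4
        rw [abs_le]
        constructor <;> linarith [h.1, h.2]
      have hy0 : y ≠ 0 := norm_pos_iff.1 (hr.trans_le hyn)
      refine (hC y hys hy0).trans ?_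
      gcongr
    · rw [truncKernel, if_neg h, abs_zero]; positivity

/-- The part of `f` on the points of the torus at distance less than `s` from `a`. -/
def nearPart (f : Plane → ℝ) (a : Plane) (s : ℝ) (x : Plane) : ℝ :=
  if ‖toTorus (x - a)‖ < s then f x else 0

/-- The part of `f` on the points of the torus at distance at least `s` from `a`. -/
def farPart (f : Plane → ℝ) (a : Plane) (s : ℝ) (x : Plane) : ℝ :=
  if ‖toTorus (x - a)‖ < s then 0 else f x

lemma nearPart_add_farPart (f : Plane → ℝ) (a : Plane) (s : ℝ) (x : Plane) :
    nearPart f a s x + farPart f a s x = f x := by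
  unfold nearPart farPart; split_ifs <;> simp

lemma measurableSet_near (a : Plane) (s : ℝ) : MeasurableSet {x : Plane | ‖toTorus (x - a)‖ < s} :=
  (isOpen_lt (continuous_toTorus.comp (continuous_id.sub continuous_const)).norm
    continuous_const).measurableSet

lemma IsBddPeriodic.nearPart {f : Plane → ℝ} {M : ℝ} (hf : IsBddPeriodic f M) (a : Plane) (s : ℝ) :
    IsBddPeriodic (nearPart f a s) M where
  periodic := (latticePeriodic_norm_toTorus.sub_right a).comp₂ hf.periodic
    fun (u v : ℝ) => if u < s then v else 0
  aesm := by
    have : TorusEuler.nearPart f a s = {x | ‖toTorus (x - a)‖ < s}.indicator f := by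
      funext x; by_cases h : ‖toTorus (x - a)‖ < s <;> simp [TorusEuler.nearPart, h]
    rw [this]
    exact hf.aesm.indicator (measurableSet_near a s)
  bound x := by
    unfold TorusEuler.nearPart
    split_ifs
    · exact hf.bound x
    · simpa using hf.nonneg

lemma IsBddPeriodic.farPart {f : Plane → ℝ} {M : ℝ} (hf : IsBddPeriodic f M) (a : Plane) (s : ℝ) :
    IsBddPeriodic (farPart f a s) M where
  periodic := (latticePeriodic_norm_toTorus.sub_right a).comp₂ hf.periodic
    fun (u v : ℝ) => if u < s then 0 else v
  aesm := by
    have : TorusEuler.farPart f a s = {x | ‖toTorus (x - a)‖ < s}ᶜ.indicator f := by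
      funext x; by_cases h : ‖toTorus (x - a)‖ < s <;> simp [TorusEuler.farPart, h]
    rw [this]
    exact hf.aesm.indicator (measurableSet_near a s).compl
  bound x := by
    unfold TorusEuler.farPart
    split_ifs
    · simpa using hf.nonneg
    · exact hf.bound x

lemma cube_subset_cube {a b : Plane} {r s : ℝ} (h : ∀ i, b i ≤ a i) (h' : ∀ i, a i + r ≤ b i + s) :
    cube a r ⊆ cube b s := fun x hx i => by
  have := hx i
  exact ⟨(h i).trans this.1, this.2.trans (h' i)⟩

lemma measureReal_cube (a : Plane) {r : ℝ} (hr : 0 ≤ r) : volume.real (cube a r) = r ^ 2 := by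
  rw [measureReal_def, volume_cube, ENNReal.toReal_pow, ENNReal.toReal_ofReal hr]

/-- In the period cell centred at a, the points at torus distance less than s lie in a cube of side
2s. -/
lemma integral_sq_nearPart_le {f : Plane → ℝ} {M : ℝ} (hf : IsBddPeriodic f M) (a : Plane) {s : ℝ}
    (hs : 0 ≤ s) : ∫ x, nearPart f a s x ^ 2 ∂torusMeasure ≤ M ^ 2 * (2 * s) ^ 2 := by
  have hM := hf.nonneg
  set b : Plane := a - WithLp.toLp 2 (fun _ => s) with hb
  rw [← setIntegral_cube_one ((hf.nearPart a s).periodic.comp fun y => y ^ 2) (a + corner)]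
  have hi : Integrable ((cube b (2 * s)).indicator fun _ => M ^ 2) :=
    (integrable_indicator_iff (measurableSet_cube _ _)).2
      (integrableOn_const (by rw [volume_cube]; exact ENNReal.pow_ne_top ENNReal.ofReal_ne_top))
  calc ∫ x in cube (a + corner) 1, nearPart f a s x ^ 2
      ≤ ∫ x in cube (a + corner) 1, (cube b (2 * s)).indicator (fun _ => M ^ 2) x := by
        refine integral_mono_of_nonneg (ae_of_all _ fun x => sq_nonneg _) hi.integrableOn ?_
        filter_upwards [ae_restrict_mem (measurableSet_cube _ _)] with x hx
        by_cases h : ‖toTorus (x - a)‖ < s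
        · have hxb : x ∈ cube b (2 * s) := fun i => by
            have h1 := hx i
            simp only [corner, PiLp.add_apply, mem_Icc] at h1
            have h2 : |(x - a) i| ≤ 1 / 2 := by
              rw [PiLp.sub_apply, abs_le]; constructor <;> linarith [h1.1, h1.2]
            have h3 := (norm_le_pi_norm (toTorus (x - a)) i).trans_lt h
            have h4 : ‖toTorus (x - a) i‖ = |(x - a) i| := norm_coe_eq_abs h2
            rw [h4, PiLp.sub_apply, abs_lt] at h3
            simp only [hb, PiLp.sub_apply, mem_Icc]
            constructor <;> linarith [h3.1, h3.2]
          rw [indicator_of_mem hxb, nearPart, if_pos h, ← sq_abs]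
          exact pow_le_pow_left₀ (abs_nonneg _) (hf.bound x) 2
        · rw [nearPart, if_neg h]
          simp only [ne_eq, OfNat.ofNat_ne_zero, not_false_eq_true, zero_pow]
          exact indicator_nonneg (fun _ _ => sq_nonneg M) x
    _ ≤ ∫ x, (cube b (2 * s)).indicator (fun _ => M ^ 2) x :=
        setIntegral_le_integral hi (ae_of_all _ fun x => indicator_nonneg (fun _ _ => sq_nonneg M) x)
    _ = M ^ 2 * (2 * s) ^ 2 := by
        rw [integral_indicator (measurableSet_cube _ _), setIntegral_const,
          measureReal_cube _ (by positivity), smul_eq_mul, mul_comm]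

/-- The Cauchy–Schwarz inequality against a constant. -/
lemma sq_integral_abs_le {α : Type*} [MeasurableSpace α] {μ : Measure α} [IsFiniteMeasure μ]
    {g : α → ℝ} (hg : MemLp g 2 μ) : (∫ x, |g x| ∂μ) ^ 2 ≤ μ.real univ * ∫ x, g x ^ 2 ∂μ := by
  have i1 : Integrable (fun x => |g x|) μ := (hg.integrable (by norm_num)).abs
  have i2 : Integrable (fun x => g x ^ 2) μ := hg.integrable_sq
  set I := ∫ x, |g x| ∂μ
  set J := ∫ x, g x ^ 2 ∂μ
  set v := μ.real univ
  have hv : 0 ≤ v := measureReal_nonneg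
  have key : ∀ c : ℝ, 0 ≤ J - 2 * c * I + c ^ 2 * v := fun c => by
    have h : ∫ x, (|g x| - c) ^ 2 ∂μ = J - 2 * c * I + c ^ 2 * v := by
      have e : ∀ x, (|g x| - c) ^ 2 = g x ^ 2 - 2 * c * |g x| + c ^ 2 := fun x => by
        rw [sub_sq, sq_abs]; ring
      simp only [e]
      have i3 : Integrable (fun x => 2 * c * |g x|) μ := i1.const_mul _
      have i4 : Integrable (fun x => g x ^ 2 - 2 * c * |g x|) μ := i2.sub i3
      rw [integral_add i4 (integrable_const _), integral_sub i2 i3, integral_const_mul,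
        integral_const, smul_eq_mul]
      ring
    rw [← h]
    exact integral_nonneg fun x => sq_nonneg _
  have hd := discrim_le_zero (a := v) (b := -(2 * I)) (c := J) fun c => by
    have := key c; nlinarith
  rw [discrim] at hd
  nlinarith

lemma integrable_tail {r : ℝ} (hr : 0 < r) :
    Integrable (fun z : Plane => (1 + ‖r⁻¹ • z‖) ^ (-(3 : ℝ))) := by
  have h : Integrable fun z : Plane => (1 + ‖z‖) ^ (-(3 : ℝ)) :=
    integrable_one_add_norm (by simp; norm_num)
  exact (integrable_comp_smul_iff volume (fun z : Plane => (1 + ‖z‖) ^ (-(3 : ℝ)))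
    (inv_ne_zero hr.ne')).2 h

lemma integral_tail {r : ℝ} (hr : 0 < r) :
    ∫ z : Plane, (1 + ‖r⁻¹ • z‖) ^ (-(3 : ℝ)) = r ^ 2 * ∫ z : Plane, (1 + ‖z‖) ^ (-(3 : ℝ)) := by
  rw [Measure.integral_comp_inv_smul volume (fun z : Plane => (1 + ‖z‖) ^ (-(3 : ℝ))) r]
  simp [abs_of_pos hr]

/-- Follows from r + ‖z‖ ≤ 2‖z‖. It replaces the cubic tail by a majorant integrable on the whole
plane, whose integral scales like r². -/
lemma inv_norm_cube_le {r : ℝ} (hr : 0 < r) {z : Plane} (hz : r ≤ ‖z‖) :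
    (‖z‖⁻¹) ^ 3 ≤ 8 * (r⁻¹) ^ 3 * (1 + ‖r⁻¹ • z‖) ^ (-(3 : ℝ)) := by
  have hn : 0 < ‖z‖ := hr.trans_le hz
  have e : (1 + ‖r⁻¹ • z‖) ^ (-(3 : ℝ)) = ((1 + ‖z‖ / r)⁻¹) ^ 3 := by
    rw [Real.rpow_neg (by positivity), norm_smul, norm_inv, Real.norm_of_nonneg hr.le,
      inv_pow, ← Real.rpow_natCast, div_eq_inv_mul]
    norm_num
  rw [e, show 8 * (r⁻¹) ^ 3 * ((1 + ‖z‖ / r)⁻¹) ^ 3 = (2 * r⁻¹ * (1 + ‖z‖ / r)⁻¹) ^ 3 by ring]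
  refine pow_le_pow_left₀ (by positivity) ?_ 3
  rw [show 2 * r⁻¹ * (1 + ‖z‖ / r)⁻¹ = 2 / (r + ‖z‖) by field_simp, inv_eq_one_div,
    div_le_div_iff₀ hn (by positivity)]
  linarith

lemma norm_sub_le_of_mem_cube {a x : Plane} {r : ℝ} (hx : x ∈ cube a r) : ‖x - a‖ ≤ 2 * r :=
  norm_le_of_abs_le fun i => by
    have := hx i
    rw [PiLp.sub_apply, abs_le]
    constructor <;> linarith [this.1, this.2]

/-- The far part of the singular integral has bounded oscillation on a cube. -/
theorem HasSing.exists_oscillation_bound {K : Plane → ℝ} (hK : HasSing 2 K) :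
    ∃ C, 0 ≤ C ∧ ∀ (f : Plane → ℝ) (M : ℝ), IsBddPeriodic f M → ∀ (a : Plane) (r : ℝ), 0 < r →
      r ≤ 1 / 16 → ∀ x ∈ cube a r,
      |torusConv (truncKernel K r) (farPart f a (4 * r)) x -
        torusConv (truncKernel K r) (farPart f a (4 * r)) a| ≤ C * M := by
  obtain ⟨C, hC0, hC⟩ := hK.exists_sub_bound
  set J := ∫ z : Plane, (1 + ‖z‖) ^ (-(3 : ℝ)) with hJ
  have hJ0 : 0 ≤ J := integral_nonneg fun z => by positivity
  refine ⟨C * 16 * J, by positivity, fun f M hf a r hr hr' x hx => ?_⟩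
  have hM := hf.nonneg
  obtain ⟨B, hB⟩ := hK.isBddPeriodic_truncKernel hr
  have hff := hf.farPart a (4 * r)
  set v := x - a with hv
  have hvn : ‖v‖ ≤ 2 * r := norm_sub_le_of_mem_cube hx
  have hconv : ∀ y, torusConv (truncKernel K r) (farPart f a (4 * r)) (a + y) =
      ∫ z, truncKernel K r (z + y) * farPart f a (4 * r) (a - z) ∂torusMeasure := fun y => by
    have h := integral_torus_sub_left
      (f := fun w => truncKernel K r (a + y - w) * farPart f a (4 * r) w)
      ((hB.periodic.sub_left (a + y)).comp₂ hff.periodic fun s t => s * t) a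
    rw [torusConv, ← h]
    refine integral_congr_ae (ae_of_all _ fun z => ?_)
    simp only []
    rw [show a + y - (a - z) = z + y by abel]
  have hi : ∀ y, Integrable (fun z => truncKernel K r (z + y) * farPart f a (4 * r) (a - z))
      torusMeasure := fun y =>
    (hff.sub_left a).integrable_mul (hB.add_right y).integrable
  have e1 := hconv v
  have e2 := hconv 0
  rw [hv, add_sub_cancel] at e1
  rw [add_zero] at e2
  rw [e1, e2, ← integral_sub (hi _) (hi _), ← hv]
  have hpt : ∀ᵐ z ∂torusMeasure,
      |truncKernel K r (z + v) * farPart f a (4 * r) (a - z) -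
        truncKernel K r (z + 0) * farPart f a (4 * r) (a - z)| ≤
      C * (2 * r) * M * (8 * (r⁻¹) ^ 3) * (1 + ‖r⁻¹ • z‖) ^ (-(3 : ℝ)) := by
    filter_upwards [ae_torus_mem_unitSquare] with z hz
    rw [← sub_mul, abs_mul, add_zero]
    by_cases h : ‖toTorus z‖ < 4 * r
    · have : farPart f a (4 * r) (a - z) = 0 := by
        refine if_pos ?_
        rwa [sub_sub_cancel_left, ← zero_sub z, toTorus_sub, ← norm_neg, neg_sub,
          show toTorus 0 = 0 from by funext i; simp [toTorus], sub_zero]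
      rw [this, abs_zero, mul_zero]
      positivity
    · push Not at h
      have hzn : 4 * r ≤ ‖z‖ := h.trans (norm_toTorus_le z)
      have hz0 : z ≠ 0 := norm_pos_iff.1 (by linarith)
      -- A displacement of at most 2r from distance 4r leaves distance 2r, so both arguments avoid
      -- the truncation.
      have h1 : r ≤ ‖toTorus (z + v)‖ := by
        rw [toTorus_add]
        have h2 := norm_sub_le_norm_add (toTorus z) (toTorus v)
        have h3 := (norm_toTorus_le v).trans hvn
        linarith
      rw [truncKernel_of_le h1, truncKernel_of_le (by linarith)]
      -- The splitting radius 4r gives ‖v‖ ≤ 2r ≤ ‖z‖/2, and r ≤ 1/16 gives ‖v‖ ≤ 1/8.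
      have h4 := hC z hz hz0 v (by linarith) (by linarith)
      have h5 := inv_norm_cube_le hr (z := z) (by linarith)
      calc |K (z + v) - K z| * |farPart f a (4 * r) (a - z)|
          ≤ (C * ‖v‖ * (‖z‖⁻¹) ^ 3) * M := by
            gcongr
            exact hff.bound _
        _ ≤ (C * (2 * r) * (8 * (r⁻¹) ^ 3 * (1 + ‖r⁻¹ • z‖) ^ (-(3 : ℝ)))) * M := by gcongr
        _ = _ := by ring
  have hti : Integrable (fun z : Plane => C * (2 * r) * M * (8 * (r⁻¹) ^ 3) *
      (1 + ‖r⁻¹ • z‖) ^ (-(3 : ℝ))) := (integrable_tail hr).const_mul _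
  calc |∫ z, (truncKernel K r (z + v) * farPart f a (4 * r) (a - z) -
        truncKernel K r (z + 0) * farPart f a (4 * r) (a - z)) ∂torusMeasure|
      ≤ ∫ z, |truncKernel K r (z + v) * farPart f a (4 * r) (a - z) -
        truncKernel K r (z + 0) * farPart f a (4 * r) (a - z)| ∂torusMeasure :=
        abs_integral_le_integral_abs
    _ ≤ ∫ z, C * (2 * r) * M * (8 * (r⁻¹) ^ 3) * (1 + ‖r⁻¹ • z‖) ^ (-(3 : ℝ)) ∂torusMeasure :=
        integral_mono_of_nonneg (ae_of_all _ fun _ => abs_nonneg _) hti.restrict hpt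
    _ ≤ ∫ z, C * (2 * r) * M * (8 * (r⁻¹) ^ 3) * (1 + ‖r⁻¹ • z‖) ^ (-(3 : ℝ)) :=
        setIntegral_le_integral hti (ae_of_all _ fun z => by
          simp only [Pi.zero_apply]; positivity)
    _ = C * 16 * J * M := by
        -- The powers of r cancel: r from the displacement, r⁻³ from the majorant, r² from its
        -- integral.
        rw [integral_const_mul, integral_tail hr, ← hJ]
        field_simp
        ring

/-! ### The derivative of the far part near the cube. -/

/-- Away from its singularity the kernel may be differentiated under the convolution. -/
lemma integral_torusConv_farPart {P f φ : Plane → ℝ} {M : ℝ} (hP : HasSing 1 P)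
    (hf : IsBddPeriodic f M) (k : Fin 2) {a : Plane} {r : ℝ} (hr : 0 < r) (hφ : IsTest φ)
    (hs : ∀ x, φ x ≠ 0 → ‖toTorus (x - a)‖ < 2 * r) :
    ∫ x, torusConv P (farPart f a (4 * r)) x * pderiv k φ x ∂torusMeasure =
      -∫ x, torusConv (truncKernel (pderiv k P) r) (farPart f a (4 * r)) x * φ x ∂torusMeasure := by
  have hff := hf.farPart a (4 * r)
  obtain ⟨B, hB⟩ := (hP.pderiv k).isBddPeriodic_truncKernel hr
  obtain ⟨C, hC⟩ := hφ.isBddPeriodic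
  obtain ⟨C', hC'⟩ := (hφ.partialDeriv k).isBddPeriodic
  have h1 := integral_torusConv_mul hP.periodic hP.integrable hff
    (hφ.partialDeriv k).smooth.continuous hC'.bound
  have h2 := integral_torusConv_mul hB.periodic hB.integrable hff hφ.smooth.continuous hC.bound
  simp only [smul_eq_mul] at h1 h2
  rw [h1, h2, ← integral_neg]
  refine integral_congr_ae (ae_of_all _ fun y => ?_)
  simp only []
  by_cases hy : farPart f a (4 * r) y = 0
  · rw [hy]; simp
  have hyn : 4 * r ≤ ‖toTorus (y - a)‖ := by
    by_contra! h
    exact hy (if_pos h)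
  rw [← mul_neg]
  congr 1
  have s1 := integral_torus_add (f := fun x => P (x - y) * pderiv k φ x)
    ((hP.periodic.sub_right y).comp₂ hC'.periodic fun s t => s * t) y
  have s2 := integral_torus_add (f := fun x => truncKernel (pderiv k P) r (x - y) * φ x)
    ((hB.periodic.sub_right y).comp₂ hC.periodic fun s t => s * t) y
  rw [← s1, ← s2]
  simp only [add_sub_cancel_right]
  -- The support of φ is within 2r of a and y is at least 4r away, so the kernel is evaluated at
  -- distance more than 2r from the lattice, where truncation changes nothing.
  have e : (fun x => truncKernel (pderiv k P) r x * φ (x + y)) =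
      fun x => pderiv k P x * φ (x + y) := by
    funext x
    by_cases hx : φ (x + y) = 0
    · rw [hx, mul_zero, mul_zero]
    · rw [truncKernel_of_le]
      have h3 := hs _ hx
      have h4 : toTorus x = toTorus (x + y - a) - toTorus (y - a) := by
        rw [← toTorus_sub]; congr 1; abel
      have h5 := norm_sub_norm_le (toTorus (y - a)) (toTorus (x + y - a))
      rw [h4, norm_sub_rev]
      linarith
  have hφy := hφ.add_right y
  have hd : pderiv k (fun x => φ (x + y)) = fun x => pderiv k φ (x + y) :=
    funext fun x => pderiv_comp_add_right φ y x k
  have i2 : Integrable (fun x => pderiv k P x * φ (x + y)) torusMeasure := by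
    rw [← e]; exact (hC.add_right y).integrable_mul hB.integrable
  have h6 := integral_mul_pderiv k hP.periodic hφy.periodic.latticePeriodic hP.differentiableAt hφy.differentiable
    (by rw [hd]; exact (hC'.add_right y).integrable_mul hP.integrable) i2
  rw [hd] at h6
  rw [h6]
  congr 2
  exact e.symm

lemma exists_add_latticeVec_mem_cube (a x : Plane) :
    ∃ n, x + latticeVec n ∈ cube (a + corner) 1 := by
  refine ⟨fun i => -round (x i - a i), fun i => ?_⟩
  have := abs_le.1 (abs_sub_round (x i - a i))
  simp only [corner, PiLp.add_apply, latticeVec_apply, mem_Icc]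
  push_cast
  constructor <;> linarith [this.1, this.2]

lemma IsWeakDeriv.integrable_torus {k : Fin 2} {h g : Plane → ℝ} (hg : IsWeakDeriv k h g) :
    Integrable g torusMeasure :=
  (hg.integrable_right.integrableOn_isCompact isCompact_bigSquare).mono_set
    unitSquare_subset_bigSquare

/-- Away from the support of `f` the weak derivative is given by the kernel. -/
lemma ae_eq_torusConv_farPart {P f g : Plane → ℝ} {M : ℝ} (hP : HasSing 1 P)
    (hf : IsBddPeriodic f M) (k : Fin 2) {a : Plane} {r : ℝ} (hr : 0 < r) (hr' : r ≤ 1 / 16)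
    (hg : IsWeakDeriv k (torusConv P (farPart f a (4 * r))) g) :
    ∀ᵐ x : Plane, (∀ i, |x i - a i| < 2 * r) →
      g x = torusConv (truncKernel (pderiv k P) r) (farPart f a (4 * r)) x := by
  have hff := hf.farPart a (4 * r)
  obtain ⟨B, hB⟩ := (hP.pderiv k).isBddPeriodic_truncKernel hr
  have hG := isBddPeriodic_torusConv hB.periodic hB.integrable hff
  have hgp : LatticePeriodic g := hg.periodic_right
  have ho : IsOpen {x : Plane | ∀ i, |x i - a i| < 2 * r} := by
    simp only [ofPred_forall]
    exact isOpen_iInter_of_finite fun i => isOpen_lt (by fun_prop) continuous_const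
  have hloc : LocallyIntegrable fun x =>
      g x - torusConv (truncKernel (pderiv k P) r) (farPart f a (4 * r)) x :=
    hg.integrable_right.sub hG.locallyIntegrable
  -- By the fundamental lemma of the calculus of variations, tests supported in this open cube are
  -- enough; since 2r ≤ 1/8 they can be periodised.
  have key := ho.ae_eq_zero_of_integral_contDiff_smul_eq_zero (μ := volume)
    (hloc.locallyIntegrableOn _) fun ψ hψ hψc hψs => ?_
  · filter_upwards [key] with x hx h
    exact sub_eq_zero.1 (hx h)
  have hs : ∀ x, (∃ i, 1 / 4 < |x i - a i|) → ψ x = 0 := fun x ⟨i, hi⟩ => by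
    by_contra h
    have := hψs (subset_tsupport ψ h) i
    linarith
  obtain ⟨φ, hφ, hφe⟩ := exists_periodization hψ hs
  have hφx : ∀ x ∈ cube (a + corner) 1, φ x = ψ x := fun x hx => (hφe x hx).eq_of_nhds
  have hsupp : ∀ x, φ x ≠ 0 → ‖toTorus (x - a)‖ < 2 * r := fun x hx => by
    obtain ⟨n, hn⟩ := exists_add_latticeVec_mem_cube a x
    have h1 : ψ (x + latticeVec n) ≠ 0 := by
      rw [← hφx _ hn, hφ.periodic.latticePeriodic n x]; exact hx
    have h2 := hψs (subset_tsupport ψ h1)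
    rw [← toTorus_add_latticeVec n, pi_norm_lt_iff (by positivity)]
    intro i
    refine (norm_coe_le_abs _).trans_lt ?_
    have := h2 i
    simp only [PiLp.add_apply, PiLp.sub_apply] at this ⊢
    rwa [sub_add_eq_add_sub]
  obtain ⟨C, hC⟩ := hφ.isBddPeriodic
  have i1 : Integrable (fun x => g x * φ x) torusMeasure :=
    hC.integrable_mul hg.integrable_torus
  have h1 := hg.integral_eq φ hφ
  rw [integral_torusConv_farPart hP hf k hr hφ hsupp] at h1
  have h2 := integral_torus_eq_integral (F := fun x =>
    g x - torusConv (truncKernel (pderiv k P) r) (farPart f a (4 * r)) x)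
    (hgp.comp₂ hG.periodic fun s t => s - t) hφ.periodic hs hφx
  simp only [smul_eq_mul, mul_comm (ψ _)]
  rw [← h2]
  simp only [sub_mul]
  rw [integral_sub i1 (hC.integrable_mul hG.integrable)]
  linarith

/-! ### Mean oscillation and the bound in BMO. -/

lemma isCompact_cube (a : Plane) (r : ℝ) : IsCompact (cube a r) := by
  refine (isCompact_closedBall a (2 * |r|)).of_isClosed_subset (isClosed_cube a r) fun x hx => ?_
  rw [Metric.mem_closedBall, dist_eq_norm]
  refine norm_le_of_abs_le fun i => ?_
  have := hx i
  rw [PiLp.sub_apply, abs_le]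
  constructor <;> linarith [this.1, this.2, le_abs_self r, abs_nonneg r]

instance isFiniteMeasure_restrict_cube (a : Plane) (r : ℝ) :
    IsFiniteMeasure (volume.restrict (cube a r)) :=
  ⟨by rw [Measure.restrict_apply_univ]; exact (isCompact_cube a r).measure_lt_top⟩

/-- The mean oscillation is controlled by the distance to any constant. -/
lemma integral_sub_average_le {g : Plane → ℝ} {a : Plane} {r : ℝ} (hr : 0 < r)
    (hg : IntegrableOn g (cube a r)) (c : ℝ) :
    ∫ x in cube a r, |g x - (volume (cube a r)).toReal⁻¹ * ∫ y in cube a r, g y| ≤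
      2 * ∫ x in cube a r, |g x - c| := by
  have hv : (volume (cube a r)).toReal = r ^ 2 := measureReal_cube a hr.le
  have hr2 : 0 < r ^ 2 := by positivity
  rw [hv]
  set m := (r ^ 2)⁻¹ * ∫ y in cube a r, g y with hm
  have hgc : IntegrableOn (fun x => g x - c) (cube a r) := hg.sub (integrable_const c)
  have h1 : m - c = (r ^ 2)⁻¹ * ∫ y in cube a r, (g y - c) := by
    rw [integral_sub hg (integrable_const c), setIntegral_const, measureReal_cube a hr.le, smul_eq_mul,
      hm]
    field_simp
  have h2 : r ^ 2 * |m - c| ≤ ∫ y in cube a r, |g y - c| := by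
    rw [h1, abs_mul, abs_of_pos (by positivity : 0 < (r ^ 2)⁻¹), ← mul_assoc,
      mul_inv_cancel₀ hr2.ne', one_mul]
    exact abs_integral_le_integral_abs
  calc ∫ x in cube a r, |g x - m| ≤ ∫ x in cube a r, (|g x - c| + |m - c|) := by
        refine integral_mono_of_nonneg (ae_of_all _ fun _ => abs_nonneg _)
          (hgc.abs.add (integrable_const _)) (ae_of_all _ fun x => ?_)
        simp only []
        rw [show g x - m = (g x - c) - (m - c) by ring]
        exact abs_sub _ _
    _ = (∫ x in cube a r, |g x - c|) + r ^ 2 * |m - c| := by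
        rw [integral_add hgc.abs (integrable_const _), setIntegral_const, measureReal_cube a hr.le,
          smul_eq_mul]
    _ ≤ _ := by linarith

lemma bmoNorm_le {g : Plane → ℝ} (hg : LocallyIntegrable g) {B : ℝ}
    (h : ∀ (a : Plane) (r : ℝ), 0 < r → r ≤ 1 → ∃ c, ∫ x in cube a r, |g x - c| ≤ B * r ^ 2) :
    bmoNorm g ≤ ENNReal.ofReal (2 * B) := by
  refine iSup_le fun a => iSup_le fun r => iSup_le fun hr => iSup_le fun hr1 => ?_
  obtain ⟨c, hc⟩ := h a r hr hr1
  have hgi : IntegrableOn g (cube a r) := hg.integrableOn_isCompact (isCompact_cube a r)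
  have h1 := integral_sub_average_le hr hgi c
  set m := (volume (cube a r)).toReal⁻¹ * ∫ y in cube a r, g y
  have hi : IntegrableOn (fun x => g x - m) (cube a r) := hgi.sub (integrable_const m)
  rw [← ofReal_integral_norm_eq_lintegral_enorm hi, volume_cube, ← ENNReal.ofReal_pow hr.le,
    ← ENNReal.ofReal_inv_of_pos (by positivity), ← ENNReal.ofReal_mul (by positivity)]
  refine ENNReal.ofReal_le_ofReal ?_
  rw [inv_mul_le_iff₀ (by positivity)]
  simp only [Real.norm_eq_abs]
  linarith

lemma bmoNorm_neg (g : Plane → ℝ) : bmoNorm (fun x => -g x) = bmoNorm g := by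
  simp only [bmoNorm]
  congr! 9 with a r _ _ x
  rw [integral_neg, mul_neg, sub_neg_eq_add, ← enorm_neg]
  congr 1
  ring

lemma LatticePeriodic.integrableOn_cube {g : Plane → ℝ} (hg : LatticePeriodic g)
    (hi : Integrable g torusMeasure) (a : Plane) (r : ℝ) : IntegrableOn g (cube a r) :=
  (hg.locallyIntegrable hi).integrableOn_isCompact (isCompact_cube a r)

lemma setIntegral_cube_le {g : Plane → ℝ} (hg : LatticePeriodic g)
    (hi : Integrable g torusMeasure) (h0 : ∀ x, 0 ≤ g x) (a : Plane) {r : ℝ} (hr : r ≤ 1) :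
    ∫ x in cube a r, g x ≤ ∫ x, g x ∂torusMeasure := by
  rw [← setIntegral_cube_one hg a]
  exact setIntegral_mono_set (hg.integrableOn_cube hi a 1) (ae_of_all _ h0)
    (cube_subset_cube (fun _ => le_rfl) fun _ => by linarith).eventuallyLE

/-- Cauchy–Schwarz on the cube, the factor r being the square root of its area. -/
lemma setIntegral_abs_le {g : Plane → ℝ} (hg : LatticePeriodic g)
    (hi : MemLp g 2 torusMeasure) (a : Plane) {r B : ℝ} (hr : 0 < r) (hr1 : r ≤ 1) (hB : 0 ≤ B)
    (h : ∫ x, g x ^ 2 ∂torusMeasure ≤ B ^ 2) : ∫ x in cube a r, |g x| ≤ r * B := by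
  have h2p : LatticePeriodic fun x => g x ^ 2 := hg.comp fun t => t ^ 2
  have hm : MemLp g 2 (volume.restrict (cube a r)) :=
    (memLp_two_iff_integrable_sq (hg.aestronglyMeasurable hi.1).restrict).2
      (h2p.integrableOn_cube hi.integrable_sq a r)
  have h1 := sq_integral_abs_le hm
  have h2 := setIntegral_cube_le h2p hi.integrable_sq (fun x => sq_nonneg _) a hr1
  rw [measureReal_restrict_apply_univ, measureReal_cube a hr.le] at h1
  refine abs_le_of_sq_le_sq' ?_ (by positivity) |>.2
  calc _ ≤ _ := h1
    _ ≤ r ^ 2 * B ^ 2 := by gcongr; exact h2.trans h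
    _ = _ := by ring

lemma IsBddPeriodic.integral_sq_le {f : Plane → ℝ} {M : ℝ} (hf : IsBddPeriodic f M) :
    ∫ x, f x ^ 2 ∂torusMeasure ≤ M ^ 2 := by
  have h := integral_mono_of_nonneg (μ := torusMeasure) (f := fun x => f x ^ 2)
    (g := fun _ => M ^ 2) (ae_of_all _ fun _ => sq_nonneg _) (integrable_const _)
    (ae_of_all _ fun x => by
      simp only []
      rw [← sq_abs]
      exact pow_le_pow_left₀ (abs_nonneg _) (hf.bound x) 2)
  simpa using h

/-- Boundedness of the singular integrals from `L^∞` to `BMO`. -/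
theorem exists_bmoNorm_le {V : Plane → ℝ} (hV : IsCoulombPotential V) :
    ∃ A : ℝ, 0 < A ∧ ∀ (f : Plane → ℝ) (M : ℝ), IsBddPeriodic f M → ∀ k j : Fin 2,
      ∃ g, IsCZ V k j f g ∧ bmoNorm g ≤ ENNReal.ofReal (A * M) := by
  have hS := fun j => hV.isLogKernel.hasSing_perpGrad j
  choose C hC0 hC using fun k j => ((hS j).pderiv k).exists_oscillation_bound
  set D := ∑ k, ∑ j, C k j with hD
  have hDle : ∀ k j, C k j ≤ D := fun k j =>
    (Finset.single_le_sum (f := fun j => C k j) (fun j _ => hC0 k j) (Finset.mem_univ j)).trans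
      (Finset.single_le_sum (f := fun k => ∑ j, C k j)
        (fun k _ => Finset.sum_nonneg fun j _ => hC0 k j) (Finset.mem_univ k))
  have hD0 : 0 ≤ D := Finset.sum_nonneg fun k _ => Finset.sum_nonneg fun j _ => hC0 k j
  -- The factor 2 pays for replacing the mean by another constant. Instead of 256 the estimates need
  -- only 8 for small cubes and 16 for large ones.
  refine ⟨2 * (256 + D), by positivity, fun f M hf k j => ?_⟩
  have hM := hf.nonneg
  obtain ⟨g, hg2, hg, hgc, hgle⟩ := exists_weakDeriv hV hf k j
  have hgp : LatticePeriodic g := hg.periodic_right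
  refine ⟨g, hg, ?_⟩
  rw [mul_assoc]
  refine bmoNorm_le hg.integrable_right fun a r hr hr1 => ?_
  have hfle := hf.integral_sq_le
  rcases le_or_gt r (1 / 16) with hr' | hr'
  · obtain ⟨g₁, hg₁2, hg₁, hg₁c, hg₁le⟩ := exists_weakDeriv hV (hf.nearPart a (4 * r)) k j
    obtain ⟨g₂, hg₂2, hg₂, hg₂c, -⟩ := exists_weakDeriv hV (hf.farPart a (4 * r)) k j
    have hg₁p : LatticePeriodic g₁ := hg₁.periodic_right
    have hg₂p : LatticePeriodic g₂ := hg₂.periodic_right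
    -- The three derivatives are chosen independently; their Fourier coefficients force additivity
    -- almost everywhere.
    have hsum : g =ᵐ[torusMeasure] fun x => g₁ x + g₂ x := by
      refine ae_eq_of_coef_eq hg2 (hg₁2.add hg₂2) fun n => ?_
      have e : f = fun x => nearPart f a (4 * r) x + farPart f a (4 * r) x :=
        funext fun x => (nearPart_add_farPart f a (4 * r) x).symm
      have e' : coef f n = coef (nearPart f a (4 * r)) n + coef (farPart f a (4 * r)) n := by
        conv_lhs => rw [e]
        exact coef_add (hf.nearPart a _).integrable (hf.farPart a _).integrable n
      have e2 := coef_add (hg₁2.integrable (by norm_num)) (hg₂2.integrable (by norm_num)) n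
      refine Eq.trans ?_ e2.symm
      rw [hgc, hg₁c, hg₂c, e']
      ring
    have hsumv : ∀ᵐ x, g x = g₁ x + g₂ x :=
      ae_volume_of_ae_torus (hgp.comp₂ (hg₁p.comp₂ hg₂p fun s t => s + t) fun s t => s = t) hsum
    have hfar := ae_eq_torusConv_farPart (hS j) hf k hr hr' hg₂
    set G := torusConv (truncKernel (pderiv k (perpGrad V j)) r) (farPart f a (4 * r)) with hGdef
    refine ⟨G a, ?_⟩
    -- The near part is at most M on a cube of side 8r, hence has L² norm at most 8Mr.
    have hnear := setIntegral_abs_le hg₁p hg₁2 a hr hr1 (B := 8 * M * r) (by positivity)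
      (hg₁le.trans ((integral_sq_nearPart_le hf a (by positivity)).trans_eq (by ring)))
    calc ∫ x in cube a r, |g x - G a| ≤ ∫ x in cube a r, (|g₁ x| + D * M) := by
          refine integral_mono_of_nonneg (ae_of_all _ fun _ => abs_nonneg _)
            (((hg₁p.integrableOn_cube (hg₁2.integrable (by norm_num)) a r).abs).add
              (integrable_const _)) ?_
          filter_upwards [ae_restrict_of_ae hsumv, ae_restrict_of_ae hfar,
            ae_restrict_mem (measurableSet_cube a r)] with x h1 h2 hx
          have h3 := h2 fun i => by
            have := hx i
            rw [abs_lt]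
            constructor <;> linarith [this.1, this.2]
          have h4 := (hC k j f M hf a r hr hr' x hx).trans
            (mul_le_mul_of_nonneg_right (hDle k j) hM)
          rw [h1, h3, add_sub_assoc]
          exact (abs_add_le _ _).trans (add_le_add le_rfl h4)
      _ = (∫ x in cube a r, |g₁ x|) + r ^ 2 * (D * M) := by
          rw [integral_add (hg₁p.integrableOn_cube (hg₁2.integrable (by norm_num)) a r).abs
            (integrable_const _), setIntegral_const, measureReal_cube a hr.le, smul_eq_mul]
      _ ≤ r * (8 * M * r) + r ^ 2 * (D * M) := by gcongr
      _ ≤ (256 + D) * M * r ^ 2 := by nlinarith [mul_nonneg hM (sq_nonneg r)]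
  · refine ⟨0, ?_⟩
    simp only [sub_zero]
    -- For r > 1/16 the bound rM is at most 16 r²M, so no splitting is needed.
    have h1 := setIntegral_abs_le hgp hg2 a hr hr1 hM (hgle.trans hfle)
    nlinarith [mul_nonneg hM hr.le, mul_nonneg (mul_nonneg hM hD0) (sq_nonneg r),
      mul_nonneg (mul_nonneg hM hr.le) (sub_pos.2 hr').le]

/-! ### Incompressibility, mollification and the commutator. -/

/-- The fields `∇^⊥ V ⋆ f` are divergence free. -/
lemma sum_integral_torusConv_mul_pderiv {V f ψ : Plane → ℝ} {M B : ℝ} (hV : IsLogKernel V)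
    (hf : IsBddPeriodic f M) (hψ : IsBddPeriodic ψ B) (hd : Differentiable ℝ ψ)
    (hψ' : ∀ j, ∃ C, IsBddPeriodic (pderiv j ψ) C) :
    ∑ j, ∫ x, torusConv (perpGrad V j) f x * pderiv j ψ x ∂torusMeasure = 0 := by
  have hS := fun j => hV.hasSing_perpGrad j
  have hh := fun j => isBddPeriodic_torusConv (hS j).periodic (hS j).integrable hf
  choose C hC using hψ'
  have h := hasSum_sum (s := Finset.univ) fun j _ => hasSum_coef_mul ((hh j).memLp 2) ((hC j).memLp 2)
  -- Each frequency is orthogonal to its rotation by a right angle.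
  have e : ∀ n, ∑ j, (starRingEnd ℂ) (coef (torusConv (perpGrad V j) f) n) * coef (pderiv j ψ) n =
      0 := fun n => by
    simp only [coef_torusConv (hS _).periodic (hS _).integrable hf, coef_perpGrad hV,
      coef_pderiv _ hψ.periodic (fun x _ => hd x) hψ.integrable (hC _).integrable,
      Fin.sum_univ_two, perpVec, Matrix.cons_val_zero, Matrix.cons_val_one, map_mul]
    push_cast
    simp only [map_neg, map_intCast]
    ring
  simp only [e] at h
  have := h.unique hasSum_zero
  exact_mod_cast this

section Mollification

variable {ρ f : Plane → ℝ} {M : ℝ}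

lemma IsTest.exists_fderiv_bound (hρ : IsTest ρ) : ∃ C, 0 ≤ C ∧ ∀ x, ‖fderiv ℝ ρ x‖ ≤ C := by
  obtain ⟨C0, h0⟩ := (hρ.partialDeriv 0).exists_bound
  obtain ⟨C1, h1⟩ := (hρ.partialDeriv 1).exists_bound
  exact ⟨C0 + C1, add_nonneg ((abs_nonneg _).trans (h0 0)) ((abs_nonneg _).trans (h1 0)),
    fun z => (norm_fderiv_le_abs_pderiv ρ z).trans (add_le_add (h0 z) (h1 z))⟩

/-- The derivative falls on the smooth factor, so f need only be integrable; this is all that is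
known at first about the vorticity at an individual time. -/
lemma hasFDerivAt_torusConv_left (hρ : IsTest ρ) (hf : Integrable f torusMeasure) (x : Plane) :
    HasFDerivAt (torusConv ρ f) (∫ y, f y • fderiv ℝ ρ (x - y) ∂torusMeasure) x := by
  obtain ⟨C, hC0, hC⟩ := hρ.exists_fderiv_bound
  obtain ⟨B, hB⟩ := hρ.exists_bound
  have hc : ∀ x, Continuous fun y => ρ (x - y) := fun x =>
    hρ.smooth.continuous.comp (continuous_const.sub continuous_id)
  have hc' : Continuous fun y => fderiv ℝ ρ (x - y) :=
    (hρ.smooth.continuous_fderiv (by simp)).comp (continuous_const.sub continuous_id)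
  refine hasFDerivAt_integral_of_dominated_of_fderiv_le (F := fun x y => ρ (x - y) * f y)
    (F' := fun x y => f y • fderiv ℝ ρ (x - y)) (bound := fun y => |f y| * C) univ_mem
    (Eventually.of_forall fun z => (hc z).aestronglyMeasurable.mul hf.1)
    (hf.bdd_mul (c := B) (hc x).aestronglyMeasurable (ae_of_all _ fun y => hB _))
    (hf.1.smul hc'.aestronglyMeasurable) (ae_of_all _ fun y z _ => ?_) (hf.abs.mul_const C)
    (ae_of_all _ fun y z _ => ?_)
  · rw [norm_smul]
    exact mul_le_mul_of_nonneg_left (hC _) (norm_nonneg _)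
  · have h1 : HasFDerivAt (fun z => ρ (z - y)) (fderiv ℝ ρ (z - y)) z :=
      HasFDerivAt.comp (g := ρ) z (hρ.differentiable (z - y)).hasFDerivAt
        ((hasFDerivAt_id z).sub_const y)
    exact h1.mul_const (f y)

lemma pderiv_torusConv_left (hρ : IsTest ρ) (hf : Integrable f torusMeasure) (j : Fin 2) :
    pderiv j (torusConv ρ f) = torusConv (pderiv j ρ) f := by
  funext x
  obtain ⟨C, hC0, hC⟩ := hρ.exists_fderiv_bound
  have hc' : Continuous fun y => fderiv ℝ ρ (x - y) :=
    (hρ.smooth.continuous_fderiv (by simp)).comp (continuous_const.sub continuous_id)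
  have hi : Integrable (fun y => f y • fderiv ℝ ρ (x - y)) torusMeasure :=
    (hf.abs.mul_const C).mono' (hf.1.smul hc'.aestronglyMeasurable) (ae_of_all _ fun y => by
      rw [norm_smul]
      exact mul_le_mul_of_nonneg_left (hC _) (norm_nonneg _))
  rw [pderiv, (hasFDerivAt_torusConv_left hρ hf x).fderiv, ContinuousLinearMap.integral_apply hi]
  refine integral_congr_ae (ae_of_all _ fun y => ?_)
  simp [pderiv, mul_comm]

end Mollification

section Commutator

variable {V W ρ : Plane → ℝ} {M : ℝ}

/-- The mollified transport term `Σ_j ∂_jρ ⋆ ((∇^⊥_j V ⋆ W) W)`. -/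
def mollifiedFlux (V ρ W : Plane → ℝ) (x : Plane) : ℝ :=
  ∑ j, torusConv (pderiv j ρ) (fun y => torusConv (perpGrad V j) W y * W y) x

/-- The commutator of mollification and transport. -/
def commutator (V ρ W : Plane → ℝ) (x : Plane) : ℝ :=
  mollifiedFlux V ρ W x - ∑ j, torusConv (perpGrad V j) W x * torusConv (pderiv j ρ) W x

lemma IsBddPeriodic.mul {f g : Plane → ℝ} {A B : ℝ} (hf : IsBddPeriodic f A)
    (hg : IsBddPeriodic g B) : IsBddPeriodic (fun x => f x * g x) (A * B) :=
  ⟨hf.periodic.comp₂ hg.periodic fun s t => s * t, hf.aesm.mul hg.aesm, fun x => by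
    rw [abs_mul]
    exact mul_le_mul (hf.bound x) (hg.bound x) (abs_nonneg _) hf.nonneg⟩

lemma IsBddPeriodic.add {f g : Plane → ℝ} {A B : ℝ} (hf : IsBddPeriodic f A)
    (hg : IsBddPeriodic g B) : IsBddPeriodic (fun x => f x + g x) (A + B) :=
  ⟨hf.periodic.comp₂ hg.periodic fun s t => s + t, hf.aesm.add hg.aesm, fun x =>
    (abs_add_le _ _).trans (add_le_add (hf.bound x) (hg.bound x))⟩

/-- Expanding the double difference gives the commutator and two extra terms: one vanishes because
the velocity is divergence free, the other because ∂_jρ has mean zero. With both factors written as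
differences, the velocity increment can pay for the size of ∂_jρ. -/
lemma commutator_eq (hV : IsLogKernel V) (hW : IsBddPeriodic W M) (hρ : IsTest ρ) (x : Plane) :
    commutator V ρ W x = ∑ j, ∫ z, pderiv j ρ z *
      ((torusConv (perpGrad V j) W (x - z) - torusConv (perpGrad V j) W x) *
        (W (x - z) - W x)) ∂torusMeasure := by
  have hS := fun j => hV.hasSing_perpGrad j
  have hh := fun j => isBddPeriodic_torusConv (hS j).periodic (hS j).integrable hW
  choose C hC using fun j => (hρ.partialDeriv j).isBddPeriodic
  have hdiv : ∑ j, torusConv (pderiv j ρ) (torusConv (perpGrad V j) W) x = 0 := by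
    set ψ : Plane → ℝ := fun y => ρ (x - y) with hψ
    obtain ⟨B, hB⟩ := hρ.isBddPeriodic
    have hd : ∀ y, HasFDerivAt ψ (-(fderiv ℝ ρ (x - y))) y := fun y => by
      have h1 := (hρ.differentiable (x - y)).hasFDerivAt
      have h2 : HasFDerivAt (fun y : Plane => x - y) (-(ContinuousLinearMap.id ℝ Plane)) y :=
        (hasFDerivAt_id y).const_sub x
      have h3 : HasFDerivAt ψ ((fderiv ℝ ρ (x - y)).comp (-(ContinuousLinearMap.id ℝ Plane))) y :=
        HasFDerivAt.comp (g := ρ) y h1 h2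
      rwa [ContinuousLinearMap.comp_neg, ContinuousLinearMap.comp_id] at h3
    have hdj : ∀ j, pderiv j ψ = fun y => -pderiv j ρ (x - y) := fun j => by
      funext y
      rw [pderiv, (hd y).fderiv]
      rfl
    have h := sum_integral_torusConv_mul_pderiv hV hW (hB.sub_left x)
      (fun y => (hd y).differentiableAt) fun j => ⟨C j, by
        rw [show pderiv j (fun y => ρ (x - y)) = pderiv j ψ from rfl, hdj]
        exact ((hC j).sub_left x).neg⟩
    rw [← neg_eq_zero, ← h, ← Finset.sum_neg_distrib]
    refine Finset.sum_congr rfl fun j _ => ?_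
    rw [torusConv, ← integral_neg, show (fun y => ρ (x - y)) = ψ from rfl, hdj]
    refine integral_congr_ae (ae_of_all _ fun y => ?_)
    simp only []
    ring
  have hmean : ∀ j, ∫ z, pderiv j ρ z ∂torusMeasure = 0 := fun j => by
    have := coef_pderiv j hρ.periodic (fun x _ => hρ.differentiable x)
      hρ.isBddPeriodic.choose_spec.integrable (hC j).integrable 0
    simp only [coef, neg_zero, char_zero_left, one_mul, Pi.zero_apply, Int.cast_zero, mul_zero,
      zero_mul] at this
    rw [integral_complex_ofReal] at this
    exact_mod_cast this
  have key : ∀ j, ∫ z, pderiv j ρ z *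
      ((torusConv (perpGrad V j) W (x - z) - torusConv (perpGrad V j) W x) *
        (W (x - z) - W x)) ∂torusMeasure =
      torusConv (pderiv j ρ) (fun y => torusConv (perpGrad V j) W y * W y) x -
        torusConv (perpGrad V j) W x * torusConv (pderiv j ρ) W x -
        W x * torusConv (pderiv j ρ) (torusConv (perpGrad V j) W) x := fun j => by
    rw [torusConv_eq (hC j).periodic ((hh j).mul hW).periodic, torusConv_eq (hC j).periodic hW.periodic,
      torusConv_eq (hC j).periodic (hh j).periodic]
    set h := torusConv (perpGrad V j) W
    have i1 := (((hh j).mul hW).sub_left x).integrable_mul (hC j).integrable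
    have i2 := (hW.sub_left x).integrable_mul (hC j).integrable
    have i3 := ((hh j).sub_left x).integrable_mul (hC j).integrable
    have e : ∀ z, pderiv j ρ z * ((h (x - z) - h x) * (W (x - z) - W x)) =
        ((pderiv j ρ z * (h (x - z) * W (x - z)) - h x * (pderiv j ρ z * W (x - z))) -
          W x * (pderiv j ρ z * h (x - z))) + (h x * W x) * pderiv j ρ z := fun z => by ring
    simp only [e]
    have i12 := i1.sub (i2.const_mul (h x))
    have i123 := i12.sub (i3.const_mul (W x))
    simp only [Pi.sub_def] at i12 i123
    rw [integral_add i123 ((hC j).integrable.const_mul _),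
      integral_sub i12 (i3.const_mul _), integral_sub i1 (i2.const_mul _)]
    simp only [integral_const_mul]
    rw [hmean]
    ring
  simp only [key, commutator, mollifiedFlux]
  rw [Finset.sum_sub_distrib, Finset.sum_sub_distrib, ← Finset.mul_sum, hdiv, mul_zero, sub_zero]

lemma integral_abs_mul_le {f g : Plane → ℝ} {A B : ℝ} (hf : IsBddPeriodic f A)
    (hg : IsBddPeriodic g B) {a b : ℝ} (ha : 0 ≤ a) (hb : 0 ≤ b)
    (h1 : ∫ x, f x ^ 2 ∂torusMeasure ≤ a ^ 2) (h2 : ∫ x, g x ^ 2 ∂torusMeasure ≤ b ^ 2) :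
    ∫ x, |f x| * |g x| ∂torusMeasure ≤ a * b := by
  have h := integral_mul_le_Lp_mul_Lq_of_nonneg (μ := torusMeasure) Real.HolderConjugate.two_two
    (ae_of_all _ fun x => abs_nonneg (f x)) (ae_of_all _ fun x => abs_nonneg (g x))
    (by simpa using! (hf.memLp 2).abs) (by simpa using! (hg.memLp 2).abs)
  refine h.trans ?_
  simp only [Real.rpow_two, sq_abs, ← Real.sqrt_eq_rpow]
  gcongr
  · exact Real.sqrt_le_iff.2 ⟨ha, h1⟩
  · exact Real.sqrt_le_iff.2 ⟨hb, h2⟩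

/-- For a fixed shift of length at most ε, Cauchy–Schwarz in x bounds the product of the increments
by 2εM·η. Integration against |∂_jρ|, of mass C/ε, cancels ε, and the sum over two components gives
4CMη. Smallness comes only from the modulus of continuity η of W. -/
theorem integral_abs_commutator_le (hV : IsCoulombPotential V) (hW : IsBddPeriodic W M)
    (hρ : IsTest ρ) {ε C η : ℝ} (hε : 0 < ε) (hη : 0 ≤ η)
    (hs : ∀ j, ∀ z ∈ unitSquare, pderiv j ρ z ≠ 0 → ‖z‖ ≤ ε)
    (hC : ∀ j, ∫ z, |pderiv j ρ z| ∂torusMeasure ≤ C / ε)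
    (hW2 : ∀ z : Plane, ‖z‖ ≤ ε → ∫ x, (W (x + z) - W x) ^ 2 ∂torusMeasure ≤ η ^ 2) :
    ∫ x, |commutator V ρ W x| ∂torusMeasure ≤ 4 * C * M * η := by
  have hM := hW.nonneg
  have hS := fun j => hV.isLogKernel.hasSing_perpGrad j
  have hh := fun j => isBddPeriodic_torusConv (hS j).periodic (hS j).integrable hW
  set h := fun j => torusConv (perpGrad V j) W with hdef
  choose D hD using fun j => (hρ.partialDeriv j).isBddPeriodic
  set q : Fin 2 → Plane × Plane → ℝ := fun j p =>
    pderiv j ρ p.2 * ((h j (p.1 - p.2) - h j p.1) * (W (p.1 - p.2) - W p.1)) with hq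
  have hqi : ∀ j, Integrable (q j) (torusMeasure.prod torusMeasure) := fun j => by
    have hWm : AEStronglyMeasurable (fun p : Plane × Plane => W (p.1 - p.2))
        (torusMeasure.prod torusMeasure) := by
      have := (aestronglyMeasurable_sub_mul (f := fun _ => 1) hW.aesm
        aestronglyMeasurable_const).mono_ac
        (show torusMeasure.prod torusMeasure ≪ volume.prod torusMeasure from
          Measure.restrict_le_self.absolutelyContinuous.prod Measure.AbsolutelyContinuous.rfl)
      simpa only [mul_one] using this
    have hhc : Continuous (h j) := continuous_torusConv (hS j).periodic (hS j).integrable hW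
    have hm : AEStronglyMeasurable (q j) (torusMeasure.prod torusMeasure) :=
      ((hρ.partialDeriv j).smooth.continuous.comp continuous_snd).aestronglyMeasurable.mul
        ((((hhc.comp (continuous_fst.sub continuous_snd)).sub
          (hhc.comp continuous_fst)).aestronglyMeasurable).mul (hWm.sub hW.aesm.restrict.comp_fst))
    obtain ⟨H, hH⟩ : ∃ H, IsBddPeriodic (h j) H := ⟨_, hh j⟩
    refine Integrable.of_bound (C := D j * ((H + H) * (M + M))) hm (ae_of_all _ fun p => ?_)
    simp only [hq, Real.norm_eq_abs, abs_mul]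
    exact mul_le_mul ((hD j).bound _) (mul_le_mul ((abs_sub _ _).trans
        (add_le_add (hH.bound _) (hH.bound _)))
        ((abs_sub _ _).trans (add_le_add (hW.bound _) (hW.bound _))) (abs_nonneg _)
        (add_nonneg hH.nonneg hH.nonneg)) (by positivity) (hD j).nonneg
  have hinner : ∀ j, ∀ᵐ z ∂torusMeasure, ∫ x, |q j (x, z)| ∂torusMeasure ≤
      |pderiv j ρ z| * (2 * ε * M * η) := fun j => by
    filter_upwards [ae_torus_mem_unitSquare] with z hz
    simp only [hq, abs_mul]
    rw [integral_const_mul]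
    by_cases h0 : pderiv j ρ z = 0
    · simp [h0]
    have hzn := hs j z hz h0
    gcongr
    simp only [sub_eq_add_neg _ z]
    refine integral_abs_mul_le (((hh j).add_right (-z)).sub (hh j)) ((hW.add_right (-z)).sub hW)
      (by positivity) hη ?_ (hW2 (-z) (by rwa [norm_neg]))
    refine (integral_sq_torusConv_sub_le hV hW j (-z)).trans ?_
    rw [norm_neg, mul_pow (2 * ε)]
    gcongr
    exact hW.integral_sq_le
  have hmono : ∫ x, |commutator V ρ W x| ∂torusMeasure ≤
      ∫ x, ∑ j, ∫ z, |q j (x, z)| ∂torusMeasure ∂torusMeasure := by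
    refine integral_mono_of_nonneg (ae_of_all _ fun _ => abs_nonneg _)
      (integrable_finsetSum _ fun j _ => (hqi j).abs.integral_prod_left) (ae_of_all _ fun x => ?_)
    simp only []
    rw [commutator_eq hV.isLogKernel hW hρ x]
    exact (Finset.abs_sum_le_sum_abs _ _).trans
      (Finset.sum_le_sum fun j _ => abs_integral_le_integral_abs)
  refine hmono.trans ?_
  rw [integral_finsetSum _ fun j _ => (hqi j).abs.integral_prod_left]
  have hj : ∀ j, ∫ x, ∫ z, |q j (x, z)| ∂torusMeasure ∂torusMeasure ≤ 2 * C * M * η := fun j => by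
    rw [integral_integral_swap (f := fun x z => |q j (x, z)|) (hqi j).abs]
    calc ∫ z, ∫ x, |q j (x, z)| ∂torusMeasure ∂torusMeasure
        ≤ ∫ z, |pderiv j ρ z| * (2 * ε * M * η) ∂torusMeasure :=
          integral_mono_of_nonneg (ae_of_all _ fun _ => integral_nonneg fun _ => abs_nonneg _)
            ((hD j).integrable.abs.mul_const _) (hinner j)
      _ ≤ C / ε * (2 * ε * M * η) := by
          rw [integral_mul_const]
          gcongr
          exact hC j
      _ = 2 * C * M * η := by field_simp
  calc _ ≤ ∑ _j : Fin 2, 2 * C * M * η := Finset.sum_le_sum fun j _ => hj j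
    _ = _ := by simp; ring

/-- The bound depends on W only through M, so it is uniform in time for a bounded vorticity. -/
lemma exists_mollifiedFlux_bound (hV : IsLogKernel V) (hρ : IsTest ρ) (M : ℝ) :
    ∃ B, ∀ W, IsBddPeriodic W M → IsBddPeriodic (mollifiedFlux V ρ W) B := by
  have hS := fun j => hV.hasSing_perpGrad j
  choose C hC using fun j => (hρ.partialDeriv j).isBddPeriodic
  have h := fun j W (hW : IsBddPeriodic W M) => isBddPeriodic_torusConv (hC j).periodic
    (hC j).integrable ((isBddPeriodic_torusConv (hS j).periodic (hS j).integrable hW).mul hW)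
  have h' : ∀ j, ∃ B, ∀ W, IsBddPeriodic W M →
      IsBddPeriodic (torusConv (pderiv j ρ) fun y => torusConv (perpGrad V j) W y * W y) B :=
    fun j => ⟨_, h j⟩
  choose B hB using h'
  refine ⟨B 0 + B 1, fun W hW => ?_⟩
  have e : mollifiedFlux V ρ W = fun x =>
      torusConv (pderiv 0 ρ) (fun y => torusConv (perpGrad V 0) W y * W y) x +
      torusConv (pderiv 1 ρ) (fun y => torusConv (perpGrad V 1) W y * W y) x := by
    funext x; simp [mollifiedFlux]
  rw [e]
  exact (hB 0 W hW).add (hB 1 W hW)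

/-- The renormalised transport term is controlled by the commutator. -/
theorem abs_integral_deriv_mul_mollifiedFlux_le (hV : IsLogKernel V) (hW : IsBddPeriodic W M)
    (hρ : IsTest ρ) {β : ℝ → ℝ} (hβ : ContDiff ℝ 1 β) {L : ℝ}
    (hL : ∀ x, |deriv β (torusConv ρ W x)| ≤ L) :
    |∫ x, deriv β (torusConv ρ W x) * mollifiedFlux V ρ W x ∂torusMeasure| ≤
      L * ∫ x, |commutator V ρ W x| ∂torusMeasure := by
  have hS := fun j => hV.hasSing_perpGrad j
  have hh := fun j => isBddPeriodic_torusConv (hS j).periodic (hS j).integrable hW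
  choose C hC using fun j => (hρ.partialDeriv j).isBddPeriodic
  obtain ⟨R, hR⟩ := hρ.isBddPeriodic
  have hf := isBddPeriodic_torusConv hR.periodic hR.integrable hW
  have hg := fun j => isBddPeriodic_torusConv (hC j).periodic (hC j).integrable hW
  set f := torusConv ρ W with hfdef
  have hfc : Continuous f := continuous_torusConv hR.periodic hR.integrable hW
  have hfd : Differentiable ℝ f := fun x =>
    (hasFDerivAt_torusConv_left hρ hW.integrable x).differentiableAt
  have hβd : Differentiable ℝ β := hβ.differentiable (by simp)
  have hβ'c : Continuous (deriv β) := hβ.continuous_deriv le_rfl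
  have hb : IsBddPeriodic (fun x => deriv β (f x)) L :=
    ⟨hf.periodic.comp (deriv β), (hβ'c.comp hfc).aestronglyMeasurable, hL⟩
  obtain ⟨Q, hQ⟩ := (isCompact_Icc (a := -((∫ z, |ρ z| ∂torusMeasure) * M))
    (b := (∫ z, |ρ z| ∂torusMeasure) * M)).exists_bound_of_continuousOn hβ.continuous.continuousOn
  have hψ : IsBddPeriodic (fun x => β (f x)) Q :=
    ⟨hf.periodic.comp β, (hβ.continuous.comp hfc).aestronglyMeasurable,
      fun x => hQ _ (abs_le.1 (hf.bound x))⟩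
  have hψd : ∀ j, pderiv j (fun x => β (f x)) = fun x => deriv β (f x) * torusConv (pderiv j ρ) W x :=
    fun j => by
      funext x
      have h1 := (hβd (f x)).hasDerivAt.comp_hasFDerivAt x (hfd x).hasFDerivAt
      rw [pderiv, show (fun x => β (f x)) = β ∘ f from rfl, h1.fderiv,
        ← pderiv_torusConv_left hρ hW.integrable j]
      rfl
  -- By the chain rule β'(f)∂_jf is a gradient, hence orthogonal to the divergence-free field;
  -- subtracting it replaces the flux by the commutator.
  have hdiv := sum_integral_torusConv_mul_pderiv hV hW hψ (hβd.comp hfd) fun j => ⟨L * _, by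
    rw [hψd]; exact hb.mul (hg j)⟩
  simp only [hψd] at hdiv
  obtain ⟨B, hB⟩ := exists_mollifiedFlux_bound hV hρ M
  have hN := hB W hW
  have hi := fun j => ((hh j).mul (hb.mul (hg j))).integrable
  obtain ⟨S, hsum⟩ : ∃ S, IsBddPeriodic (fun x => ∑ j, torusConv (perpGrad V j) W x *
      torusConv (pderiv j ρ) W x) S := by
    simp only [Fin.sum_univ_two]
    exact ⟨_, ((hh 0).mul (hg 0)).add ((hh 1).mul (hg 1))⟩
  have hcomm : IsBddPeriodic (commutator V ρ W) (B + S) := hN.sub hsum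
  have e : ∫ x, deriv β (f x) * mollifiedFlux V ρ W x ∂torusMeasure =
      ∫ x, deriv β (f x) * commutator V ρ W x ∂torusMeasure := by
    rw [← integral_finsetSum _ fun j _ => hi j] at hdiv
    rw [← sub_eq_zero, ← integral_sub (hb.mul hN).integrable (hb.mul hcomm).integrable, ← hdiv]
    refine integral_congr_ae (ae_of_all _ fun x => ?_)
    simp only [commutator, Fin.sum_univ_two]
    ring
  rw [e, ← integral_const_mul]
  refine abs_integral_le_integral_abs.trans (integral_mono_of_nonneg
    (ae_of_all _ fun _ => abs_nonneg _) (hcomm.integrable.abs.const_mul L) (ae_of_all _ fun x => ?_))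
  simp only [abs_mul]
  exact mul_le_mul_of_nonneg_right (hL x) (abs_nonneg _)

end Commutator

/-! ### Mollifiers. -/

/-- The bump functions used for mollification. -/
def mollBump (n : ℕ) : ContDiffBump (0 : Plane) where
  -- The outer radius is at most 1/8, small enough for periodisation, and the ratio of the radii is
  -- always 2, as the almost-everywhere convergence of the mollifications requires.
  rIn := 1 / (16 * (n + 1))
  rOut := 1 / (8 * (n + 1))
  rIn_pos := by positivity
  rIn_lt_rOut := by
    rw [div_lt_div_iff₀ (by positivity) (by positivity)]
    have : (0 : ℝ) < n + 1 := by positivity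
    linarith

/-- All bumps are dilates of one, so the L¹ norms of the derivatives of the mollifiers grow exactly
like n + 1, the inverse of the radius up to a constant. -/
lemma mollBump_apply (n : ℕ) (x : Plane) : mollBump n x = mollBump 0 (((n : ℝ) + 1) • x) := by
  have h : (0 : ℝ) < n + 1 := by positivity
  rw [ContDiffBump.apply, ContDiffBump.apply]
  simp only [mollBump, sub_zero, smul_smul, CharP.cast_eq_zero]
  have h1 : (1 / (8 * ((n : ℝ) + 1))) / (1 / (16 * ((n : ℝ) + 1))) =
      (1 / (8 * ((0 : ℝ) + 1))) / (1 / (16 * ((0 : ℝ) + 1))) := by field_simp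
  have h2 : (1 / (16 * ((n : ℝ) + 1)))⁻¹ = (1 / (16 * ((0 : ℝ) + 1)))⁻¹ * ((n : ℝ) + 1) := by
    field_simp; norm_num
  rw [h1, h2]

lemma integral_mollBump (n : ℕ) :
    ∫ x, mollBump n x = (((n : ℝ) + 1) ^ 2)⁻¹ * ∫ x, mollBump 0 x := by
  simp_rw [mollBump_apply n]
  rw [Measure.integral_comp_smul volume (fun x => mollBump 0 x)]
  simp [abs_of_pos (by positivity : (0 : ℝ) < n + 1)]

/-- The mollifiers on the plane. -/
def moll (n : ℕ) : Plane → ℝ := (mollBump n).normed volume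

lemma moll_eq (n : ℕ) (x : Plane) : moll n x = ((n : ℝ) + 1) ^ 2 * moll 0 (((n : ℝ) + 1) • x) := by
  rw [moll, moll, ContDiffBump.normed_def, ContDiffBump.normed_def, integral_mollBump n,
    mollBump_apply n]
  field_simp

lemma contDiff_moll (n : ℕ) : ContDiff ℝ (⊤ : ℕ∞) (moll n) := ContDiffBump.contDiff_normed _

lemma tsupport_moll (n : ℕ) : tsupport (moll n) = Metric.closedBall 0 (1 / (8 * (n + 1))) :=
  ContDiffBump.tsupport_normed_eq _

lemma pderiv_moll (n : ℕ) (j : Fin 2) (x : Plane) :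
    pderiv j (moll n) x = ((n : ℝ) + 1) ^ 3 * pderiv j (moll 0) (((n : ℝ) + 1) • x) := by
  have hd : HasFDerivAt (moll 0) (fderiv ℝ (moll 0) (((n : ℝ) + 1) • x)) (((n : ℝ) + 1) • x) :=
    ((contDiff_moll 0).differentiable (by simp) _).hasFDerivAt
  have h1 := (hd.comp x ((hasFDerivAt_id x).const_smul ((n : ℝ) + 1))).const_mul (((n : ℝ) + 1) ^ 2)
  have e : moll n = fun x => ((n : ℝ) + 1) ^ 2 * (moll 0 ∘ fun x => ((n : ℝ) + 1) • x) x :=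
    funext fun x => moll_eq n x
  rw [pderiv, e]
  erw [h1.fderiv]
  simp [pderiv]
  ring

lemma integral_abs_pderiv_moll (n : ℕ) (j : Fin 2) :
    ∫ x, |pderiv j (moll n) x| = ((n : ℝ) + 1) * ∫ x, |pderiv j (moll 0) x| := by
  have h : (0 : ℝ) < n + 1 := by positivity
  simp_rw [pderiv_moll n, abs_mul, abs_of_pos (pow_pos h 3)]
  rw [integral_const_mul, Measure.integral_comp_smul volume (fun x => |pderiv j (moll 0) x|)]
  simp [abs_of_pos h]
  field_simp

lemma integrable_pderiv_moll (n : ℕ) (j : Fin 2) : Integrable (pderiv j (moll n)) := by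
  have hc : HasCompactSupport (moll n) := ContDiffBump.hasCompactSupport_normed _
  exact (((contDiff_moll n).continuous_fderiv (by simp)).clm_apply
    continuous_const).integrable_of_hasCompactSupport (hc.fderiv_apply ℝ _)

/-- Mollifiers on the torus. -/
theorem exists_mollifiers : ∃ (ρ : ℕ → Plane → ℝ) (ε : ℕ → ℝ) (C : ℝ),
    (∀ n, IsTest (ρ n)) ∧ (∀ n x, 0 ≤ ρ n x) ∧ (∀ n, ∫ x, ρ n x ∂torusMeasure = 1) ∧
    (∀ n, 0 < ε n) ∧ Tendsto ε atTop (𝓝 0) ∧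
    (∀ n j, ∀ z ∈ unitSquare, pderiv j (ρ n) z ≠ 0 → ‖z‖ ≤ ε n) ∧
    (∀ n j, ∫ z, |pderiv j (ρ n) z| ∂torusMeasure ≤ C / ε n) ∧
    ∀ w : Plane → ℝ, LatticePeriodic w → Integrable w torusMeasure →
      ∀ᵐ x, Tendsto (fun n => torusConv (ρ n) w x) atTop (𝓝 (w x)) := by
  have hs : ∀ (n : ℕ) (x : Plane), (∃ i, 1 / 4 < |x i - (0 : Plane) i|) → moll n x = 0 :=
    fun n x ⟨i, hi⟩ => by
      by_contra h
      have h1 : x ∈ tsupport (moll n) := subset_tsupport _ h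
      rw [tsupport_moll, mem_closedBall_zero_iff] at h1
      have h2 := (PiLp.norm_apply_le x i).trans h1
      have h3 : 1 / (8 * ((n : ℝ) + 1)) ≤ 1 / 8 := by
        rw [div_le_div_iff₀ (by positivity) (by norm_num)]
        have : (0 : ℝ) ≤ n := Nat.cast_nonneg n
        linarith
      rw [Real.norm_eq_abs] at h2
      simp only [PiLp.zero_apply, sub_zero] at hi
      linarith
  choose ρ hρ hρe using fun n => exists_periodization (contDiff_moll n) (hs n)
  have hsq : unitSquare = cube (0 + corner) 1 := by rw [zero_add, unitSquare_eq_cube]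
  have hρx : ∀ n, ∀ x ∈ cube (0 + corner) 1, ρ n x = moll n x := fun n x hx =>
    (hρe n x hx).eq_of_nhds
  have hρd : ∀ n j, ∀ x ∈ unitSquare, pderiv j (ρ n) x = pderiv j (moll n) x := fun n j x hx =>
    pderiv_congr (hρe n x (hsq ▸ hx)) j
  refine ⟨ρ, fun n => 1 / (8 * (n + 1)), (∑ j, ∫ x, |pderiv j (moll 0) x|) / 8, hρ, fun n x => ?_,
    fun n => ?_, fun n => by positivity, ?_, fun n j z hz h => ?_, fun n j => ?_, fun w hw hwi => ?_⟩
  · obtain ⟨m, hm⟩ := exists_add_latticeVec_mem_cube 0 x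
    rw [← (hρ n).periodic.latticePeriodic m x, hρx n _ hm]
    exact ContDiffBump.nonneg_normed _ _
  · have h := integral_torus_eq_integral (F := fun _ => (1 : ℝ)) (fun _ _ => rfl)
      (hρ n).periodic (hs n) (hρx n)
    simp only [one_mul] at h
    rw [h]
    exact ContDiffBump.integral_normed _
  · have h := (tendsto_one_div_add_atTop_nhds_zero_nat (𝕜 := ℝ)).const_mul (1 / 8)
    rw [mul_zero] at h
    refine h.congr fun n => ?_
    field_simp
  · rw [hρd n j z hz] at h
    have h1 : z ∈ tsupport (moll n) := by
      refine tsupport_fderiv_subset ℝ (subset_tsupport _ fun h0 => h ?_)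
      rw [pderiv, h0]; rfl
    rwa [tsupport_moll, mem_closedBall_zero_iff] at h1
  · have h1 : ∫ z, |pderiv j (ρ n) z| ∂torusMeasure = ∫ z in unitSquare, |pderiv j (moll n) z| :=
      setIntegral_congr_fun measurableSet_unitSquare fun x hx => by simp only [hρd n j x hx]
    rw [h1]
    refine (setIntegral_le_integral (integrable_pderiv_moll n j).abs
      (ae_of_all _ fun _ => abs_nonneg _)).trans ?_
    rw [integral_abs_pderiv_moll, div_div_eq_mul_div, div_one]
    have h2 := Finset.single_le_sum (f := fun j => ∫ x, |pderiv j (moll 0) x|)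
      (fun j _ => integral_nonneg fun _ => abs_nonneg _) (Finset.mem_univ j)
    rw [show (∑ j, ∫ x, |pderiv j (moll 0) x|) / 8 * (8 * ((n : ℝ) + 1)) =
      ((n : ℝ) + 1) * ∑ j, ∫ x, |pderiv j (moll 0) x| by ring]
    gcongr
  · have h := ContDiffBump.ae_convolution_tendsto_right_of_locallyIntegrable (μ := volume)
      (φ := mollBump) (l := atTop) (K := 2) (g := w) ?_ ?_ (hw.locallyIntegrable hwi)
    · filter_upwards [h] with x hx
      refine hx.congr fun n => ?_
      have h1 := integral_torus_eq_integral (hw.sub_left x) (hρ n).periodic (hs n) (hρx n)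
      rw [torusConv_eq (hρ n).periodic hw, convolution_def]
      simp only [mul_comm (ρ n _)]
      rw [h1]
      refine integral_congr_ae (ae_of_all _ fun z => ?_)
      exact mul_comm _ _
    · have h := (tendsto_one_div_add_atTop_nhds_zero_nat (𝕜 := ℝ)).const_mul (1 / 8)
      rw [mul_zero] at h
      refine h.congr fun n => ?_
      simp only [mollBump]
      field_simp
    · refine Eventually.of_forall fun n => le_of_eq ?_
      simp only [mollBump]
      field_simp
      norm_num

/-! ### The renormalised mollified equation. -/

/-- The chain rule for the composition of a `C¹` function with an indefinite integral. -/
lemma comp_integral_sub_eq {N β : ℝ → ℝ} {B : ℝ} (hN : Measurable N) (hB : ∀ s, |N s| ≤ B)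
    (hβ : ContDiff ℝ 1 β) (c t : ℝ) :
    β (c + ∫ s in (0 : ℝ)..t, N s) - β c =
      ∫ s in (0 : ℝ)..t, deriv β (c + ∫ r in (0 : ℝ)..s, N r) * N s := by
  have hB0 : 0 ≤ B := (abs_nonneg _).trans (hB 0)
  have hloc : LocallyIntegrable N := by
    refine (locallyIntegrable_const B).mono hN.aestronglyMeasurable (ae_of_all _ fun s => ?_)
    rw [Real.norm_eq_abs, Real.norm_of_nonneg hB0]
    exact hB s
  have hii : ∀ a b, IntervalIntegrable N volume a b := fun a b =>
    hloc.integrableOn_isCompact isCompact_uIcc |>.intervalIntegrable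
  set F : ℝ → ℝ := fun s => c + ∫ r in (0 : ℝ)..s, N r with hF
  have hFlip : LipschitzWith B.toNNReal F := LipschitzWith.of_dist_le_mul fun x y => by
    rw [Real.dist_eq, Real.dist_eq, Real.coe_toNNReal _ hB0]
    have : F x - F y = ∫ r in y..x, N r := by
      simp only [hF]
      rw [← intervalIntegral.integral_add_adjacent_intervals (hii 0 y) (hii y x)]
      ring
    rw [this]
    exact intervalIntegral.norm_integral_le_of_norm_le_const (f := N) fun s _ => hB s
  -- The integrand is only bounded and measurable, so F is Lipschitz rather than C¹; absolute
  -- continuity together with Lebesgue differentiation replaces the classical chain rule.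
  have hac : AbsolutelyContinuousOnInterval (fun s => β (F s)) 0 t := by
    obtain ⟨K, hK⟩ := (hβ.contDiffOn (s := Metric.closedBall c (B * |t|))).exists_lipschitzOnWith
      one_ne_zero (convex_closedBall _ _) (isCompact_closedBall _ _)
    have hmaps : MapsTo F (uIcc 0 t) (Metric.closedBall c (B * |t|)) := fun s hs => by
      have h1 := hFlip.dist_le_mul s 0
      rw [Real.coe_toNNReal _ hB0, Real.dist_0_eq_abs, show F 0 = c by simp [hF]] at h1
      exact h1.trans (mul_le_mul_of_nonneg_left (by simpa using abs_sub_left_of_mem_uIcc hs) hB0)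
    exact (hK.comp (hFlip.lipschitzOnWith (s := uIcc 0 t)) hmaps).absolutelyContinuousOnInterval
  have h1 := hac.integral_deriv_eq_sub
  have h0 : F 0 = c := by simp [hF]
  rw [h0] at h1
  rw [← h1]
  refine intervalIntegral.integral_congr_ae ?_
  filter_upwards [LocallyIntegrable.ae_hasDerivAt_integral hloc] with s hs _
  have h2 := ((hβ.differentiable (by simp)) (F s)).hasDerivAt.comp s ((hs 0).const_add c)
  exact h2.deriv

lemma measurable_perpGrad (V : Plane → ℝ) (j : Fin 2) : Measurable (perpGrad V j) := by
  fin_cases j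
  · exact (measurable_pderiv 1 V).neg
  · exact measurable_pderiv 0 V

lemma measurable_torusConv {K : Plane → ℝ} (hK : Measurable K) {W : ℝ → Plane → ℝ}
    (hW : Measurable (Function.uncurry W)) :
    Measurable fun p : ℝ × Plane => torusConv K (W p.1) p.2 := by
  have h : Measurable (Function.uncurry fun (p : ℝ × Plane) (y : Plane) =>
      K (p.2 - y) * W p.1 y) := by
    have h1 : Measurable fun q : (ℝ × Plane) × Plane => q.1.2 - q.2 :=
      (measurable_snd.comp measurable_fst).sub measurable_snd
    have h2 : Measurable fun q : (ℝ × Plane) × Plane => (q.1.1, q.2) :=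
      (measurable_fst.comp measurable_fst).prodMk measurable_snd
    have h3 : Measurable fun q : (ℝ × Plane) × Plane => W q.1.1 q.2 := hW.comp h2
    exact (hK.comp h1).mul h3
  exact h.stronglyMeasurable.integral_prod_right.measurable

lemma measurable_mollifiedFlux (V ρ : Plane → ℝ) {W : ℝ → Plane → ℝ}
    (hW : Measurable (Function.uncurry W)) :
    Measurable fun p : ℝ × Plane => mollifiedFlux V ρ (W p.1) p.2 := by
  unfold mollifiedFlux
  refine Finset.measurable_sum _ fun j _ => ?_
  exact measurable_torusConv (W := fun s y => torusConv (perpGrad V j) (W s) y * W s y)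
    (measurable_pderiv j ρ) ((measurable_torusConv (measurable_perpGrad V j) hW).mul hW)

section Solution

variable {V ω₀ : Plane → ℝ} {T : ℝ} {ω : ℝ → Plane → ℝ}

/-- A jointly measurable, bounded, periodic version of the vorticity. -/
lemma IsYudovichSolution.exists_version (h : IsYudovichSolution V T ω₀ ω) :
    ∃ (W : ℝ → Plane → ℝ) (M : ℝ), Measurable (Function.uncurry W) ∧
      (∀ s, IsBddPeriodic (W s) M) ∧
      ∀ᵐ s ∂(volume.restrict (Icc 0 T)), W s =ᵐ[torusMeasure] ω s := by
  obtain ⟨M, hM⟩ := h.bounded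
  set w := h.measurable.mk _ with hw
  have hwm : Measurable w := h.measurable.stronglyMeasurable_mk.measurable
  have hwe := Measure.ae_ae_of_ae_prod h.measurable.ae_eq_mk
  -- Reading the measurable representative in the fundamental domain makes it periodic, and clamping
  -- bounds it at every time and point.
  set W : ℝ → Plane → ℝ := fun s x => max (-(M : ℝ)) (min (w (s, ofTorus (toTorus x))) M) with hW
  have hWm : Measurable (Function.uncurry W) := by
    have h1 : Measurable fun p : ℝ × Plane => w (p.1, ofTorus (toTorus p.2)) :=
      hwm.comp (measurable_fst.prodMk ((measurable_ofTorus.comp measurable_toTorus).comp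
        measurable_snd))
    exact measurable_const.max (h1.min measurable_const)
  refine ⟨W, M, hWm, fun s => ⟨fun n x => ?_, (hWm.comp measurable_prodMk_left).aestronglyMeasurable,
    fun x => ?_⟩, ?_⟩
  · have := toTorus_add_latticeVec n x
    simp only [hW, this]
  · rw [abs_le]
    exact ⟨le_max_left _ _, max_le (by linarith [M.2]) (min_le_right _ _)⟩
  · filter_upwards [hwe, hM, ae_restrict_mem measurableSet_Icc] with s h1 h2 hs
    have hb : ∀ᵐ x ∂torusMeasure, ‖ω s x‖ₑ ≤ linfNorm (ω s) := by
      have := ae_le_eLpNormEssSup (f := ω s) (μ := torusMeasure)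
      rwa [← eLpNorm_exponent_top] at this
    have hP : LatticePeriodic (ω s) := h.periodic s hs
    have h3 := (measurePreserving_toTorus.quasiMeasurePreserving.ae
      (measurePreserving_ofTorus.quasiMeasurePreserving.ae h1))
    filter_upwards [h3, hb] with x hx hx2
    have h4 : |ω s x| ≤ M := by
      have := hx2.trans h2
      rw [enorm_le_coe] at this
      exact_mod_cast this
    rw [abs_le] at h4
    simp only [hW, hw]
    rw [← hx, hP.apply_ofTorus, min_eq_left h4.2, max_eq_right h4.1]

/-- The mollified equation. -/
lemma IsYudovichSolution.torusConv_eq (h : IsYudovichSolution V T ω₀ ω) {W : ℝ → Plane → ℝ}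
    (hW : ∀ᵐ s ∂(volume.restrict (Icc 0 T)), W s =ᵐ[torusMeasure] ω s) {ρ : Plane → ℝ}
    (hρ : IsTest ρ) (x : Plane) {M : ℝ} (hWb : ∀ s, IsBddPeriodic (W s) M)
    (hV : IsLogKernel V) {t : ℝ} (ht : t ∈ Icc 0 T) :
    torusConv ρ (ω t) x =
      torusConv ρ ω₀ x + ∫ s in (0 : ℝ)..t, mollifiedFlux V ρ (W s) x := by
  have hsm : ContDiff ℝ (⊤ : ℕ∞) fun y => ρ (x - y) := hρ.smooth.comp (contDiff_const.sub contDiff_id)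
  have hd : ∀ j y, pderiv j (fun y => ρ (x - y)) y = -pderiv j ρ (x - y) := fun j y => by
    have h1 : HasFDerivAt (fun y => ρ (x - y)) ((fderiv ℝ ρ (x - y)).comp
        (-(ContinuousLinearMap.id ℝ Plane))) y :=
      HasFDerivAt.comp (g := ρ) y (hρ.differentiable (x - y)).hasFDerivAt
        ((hasFDerivAt_id y).const_sub x)
    rw [pderiv, h1.fderiv]
    simp [pderiv]
  -- The test function is constant in time, so its time derivative drops out; the sign from
  -- differentiating ρ(x − y) cancels that of the velocity.
  have hw := h.weak_form (fun _ y => ρ (x - y)) (hsm.comp contDiff_snd)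
    (fun _ => LatticePeriodic.sub_left hρ.periodic x) t ht
  simp only [deriv_const, mul_zero, integral_zero, intervalIntegral.integral_zero, add_zero] at hw
  simp only [torusConv, mul_comm (ρ _)]
  rw [hw]
  congr 1
  refine intervalIntegral.integral_congr_ae ?_
  have hW' := (ae_restrict_iff' measurableSet_Icc).1 hW
  filter_upwards [hW'] with s hs hst
  rw [uIoc_of_le ht.1] at hst
  have hs' := hs ⟨hst.1.le, hst.2.trans ht.2⟩
  choose C hC using fun j => (hρ.partialDeriv j).isBddPeriodic
  have hS := fun j => hV.hasSing_perpGrad j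
  have hh := fun j => isBddPeriodic_torusConv (hS j).periodic (hS j).integrable (hWb s)
  rw [mollifiedFlux]
  simp only [torusConv.eq_1 (pderiv _ ρ)]
  rw [← integral_finsetSum]
  · refine integral_congr_ae ?_
    filter_upwards [hs'] with y hy
    simp only [hd, velocity, hy, torusConv_congr_ae hs', Finset.sum_mul]
    refine Finset.sum_congr rfl fun j _ => by ring
  · intro j _
    exact ((hh j).mul (hWb s)).integrable_mul (K := fun y => pderiv j ρ (x - y))
      ((hC j).sub_left x).integrable

lemma continuous_torusConv_left {ρ f : Plane → ℝ} (hρ : IsTest ρ)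
    (hf : Integrable f torusMeasure) : Continuous (torusConv ρ f) :=
  continuous_iff_continuousAt.2 fun x => (hasFDerivAt_torusConv_left hρ hf x).continuousAt

lemma _root_.Continuous.integrable_torus {f : Plane → ℝ} (hf : Continuous f) :
    Integrable f torusMeasure :=
  (hf.continuousOn.integrableOn_compact isCompact_bigSquare).mono_set unitSquare_subset_bigSquare

/-- The renormalised mollified equation. -/
lemma IsYudovichSolution.integral_comp_torusConv (h : IsYudovichSolution V T ω₀ ω)
    {W : ℝ → Plane → ℝ} (hWm : Measurable (Function.uncurry W))
    (hW : ∀ᵐ s ∂(volume.restrict (Icc 0 T)), W s =ᵐ[torusMeasure] ω s) {ρ : Plane → ℝ}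
    (hρ : IsTest ρ) {M : ℝ} (hWb : ∀ s, IsBddPeriodic (W s) M)
    (hV : IsLogKernel V) {β : ℝ → ℝ} (hβ : ContDiff ℝ 1 β) {t : ℝ} (ht : t ∈ Icc 0 T) :
    ∫ x, β (torusConv ρ (ω t) x) ∂torusMeasure = ∫ x, β (torusConv ρ ω₀ x) ∂torusMeasure +
      ∫ s in (0 : ℝ)..t, ∫ x, deriv β (torusConv ρ (W s) x) * mollifiedFlux V ρ (W s) x
        ∂torusMeasure := by
  obtain ⟨B, hB⟩ := exists_mollifiedFlux_bound hV hρ M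
  obtain ⟨R, hR⟩ := hρ.isBddPeriodic
  have hβ'c : Continuous (deriv β) := hβ.continuous_deriv le_rfl
  have hNm := measurable_mollifiedFlux V ρ hWm
  have hfm := measurable_torusConv hρ.smooth.continuous.measurable hWm
  obtain ⟨L, hL⟩ := (isCompact_Icc (a := -((∫ z, |ρ z| ∂torusMeasure) * M))
    (b := (∫ z, |ρ z| ∂torusMeasure) * M)).exists_bound_of_continuousOn hβ'c.continuousOn
  have hLb : ∀ s x, |deriv β (torusConv ρ (W s) x)| ≤ L := fun s x =>
    hL _ (abs_le.1 (abs_torusConv_le hR.periodic hR.integrable (hWb s) x))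
  have hL0 : 0 ≤ L := (abs_nonneg _).trans (hLb 0 0)
  -- For fixed x the mollified vorticity is an indefinite integral in time, so the chain rule
  -- applies pointwise; Fubini's theorem then integrates in x.
  have hx : ∀ x, β (torusConv ρ (ω t) x) - β (torusConv ρ ω₀ x) =
      ∫ s in (0 : ℝ)..t, deriv β (torusConv ρ (W s) x) * mollifiedFlux V ρ (W s) x := fun x => by
    have hNx : Measurable fun s => mollifiedFlux V ρ (W s) x :=
      Measurable.of_uncurry_right (f := fun s x => mollifiedFlux V ρ (W s) x) hNm
    have e : ∀ s ∈ Icc 0 T, torusConv ρ ω₀ x + ∫ r in (0 : ℝ)..s, mollifiedFlux V ρ (W r) x =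
        torusConv ρ (ω s) x := fun s hs => (h.torusConv_eq hW hρ x hWb hV hs).symm
    have h1 := comp_integral_sub_eq hNx (fun s => (hB _ (hWb s)).bound x) hβ (torusConv ρ ω₀ x) t
    rw [e t ht] at h1
    refine h1.trans (intervalIntegral.integral_congr_ae ?_)
    filter_upwards [(ae_restrict_iff' measurableSet_Icc).1 hW] with s hs hst
    rw [uIoc_of_le ht.1] at hst
    have hsT : s ∈ Icc 0 T := ⟨hst.1.le, hst.2.trans ht.2⟩
    rw [e s hsT, torusConv_congr_ae (hs hsT)]
  have hi1 : Integrable (fun x => β (torusConv ρ (ω t) x)) torusMeasure :=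
    (hβ.continuous.comp (continuous_torusConv_left hρ (h.integrable t ht))).integrable_torus
  have hi2 : Integrable (fun x => β (torusConv ρ ω₀ x)) torusMeasure :=
    (hβ.continuous.comp (continuous_torusConv_left hρ
      (h.initial.memLp.integrable le_top))).integrable_torus
  have hm : Measurable fun p : Plane × ℝ =>
      deriv β (torusConv ρ (W p.2) p.1) * mollifiedFlux V ρ (W p.2) p.1 := by
    have h1 : Measurable fun p : ℝ × Plane =>
        deriv β (torusConv ρ (W p.1) p.2) * mollifiedFlux V ρ (W p.1) p.2 :=
      (hβ'c.measurable.comp hfm).mul hNm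
    exact h1.comp measurable_swap
  have hint : Integrable (fun p : Plane × ℝ =>
      deriv β (torusConv ρ (W p.2) p.1) * mollifiedFlux V ρ (W p.2) p.1)
      (torusMeasure.prod (volume.restrict (Ioc 0 t))) := by
    refine Integrable.of_bound (C := L * B) hm.aestronglyMeasurable (ae_of_all _ fun p => ?_)
    rw [Real.norm_eq_abs, abs_mul]
    exact mul_le_mul (hLb _ _) ((hB _ (hWb _)).bound _) (abs_nonneg _) hL0
  have hswap := integral_integral_swap
    (f := fun x s => deriv β (torusConv ρ (W s) x) * mollifiedFlux V ρ (W s) x) hint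
  have hsub := integral_sub hi1 hi2
  rw [integral_congr_ae (ae_of_all _ hx)] at hsub
  simp only [intervalIntegral.integral_of_le ht.1] at hsub ⊢
  rw [hswap] at hsub
  linarith

end Solution

/-! ### Removal of the mollification and the maximum principle. -/

section Limit

variable {V ω₀ : Plane → ℝ} {T : ℝ} {ω : ℝ → Plane → ℝ}

lemma integral_sq_sub_le {W : Plane → ℝ} {M : ℝ} (hW : IsBddPeriodic W M) (z : Plane) :
    ∫ x, (W (x + z) - W x) ^ 2 ∂torusMeasure ≤ (2 * M) ^ 2 := by
  rw [two_mul]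
  exact ((hW.add_right z).sub hW).integral_sq_le

/-- Conservation of the integrals of functions of the vorticity, in the limit of the mollification. -/
theorem tendsto_integral_deriv_mul_mollifiedFlux (hV : IsCoulombPotential V)
    {W : ℝ → Plane → ℝ} (hWm : Measurable (Function.uncurry W)) {M : ℝ}
    (hWb : ∀ s, IsBddPeriodic (W s) M) {β : ℝ → ℝ} (hβ : ContDiff ℝ 1 β)
    {ρ : ℕ → Plane → ℝ} {ε : ℕ → ℝ} {C : ℝ} (hρ : ∀ n, IsTest (ρ n)) (hρ0 : ∀ n x, 0 ≤ ρ n x)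
    (hρ1 : ∀ n, ∫ x, ρ n x ∂torusMeasure = 1) (hε : ∀ n, 0 < ε n) (hε0 : Tendsto ε atTop (𝓝 0))
    (hs : ∀ n j, ∀ z ∈ unitSquare, pderiv j (ρ n) z ≠ 0 → ‖z‖ ≤ ε n)
    (hC : ∀ n j, ∫ z, |pderiv j (ρ n) z| ∂torusMeasure ≤ C / ε n) (t : ℝ) :
    Tendsto (fun n => ∫ s in (0 : ℝ)..t, ∫ x, deriv β (torusConv (ρ n) (W s) x) *
      mollifiedFlux V (ρ n) (W s) x ∂torusMeasure) atTop (𝓝 0) := by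
  have hM : 0 ≤ M := (hWb 0).nonneg
  have hC0 : 0 ≤ C := by
    have h1 := (integral_nonneg fun z => abs_nonneg (pderiv 0 (ρ 0) z)).trans (hC 0 0)
    by_contra! hlt
    exact absurd h1 (not_le.2 (div_neg_of_neg_of_pos hlt (hε 0)))
  have hβ'c : Continuous (deriv β) := hβ.continuous_deriv le_rfl
  obtain ⟨L, hL⟩ := (isCompact_Icc (a := -M) (b := M)).exists_bound_of_continuousOn
    hβ'c.continuousOn
  have hLb : ∀ n s x, |deriv β (torusConv (ρ n) (W s) x)| ≤ L := fun n s x => by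
    obtain ⟨R, hR⟩ := (hρ n).isBddPeriodic
    have h1 := abs_torusConv_le hR.periodic hR.integrable (hWb s) x
    simp only [abs_of_nonneg (hρ0 n _), hρ1, one_mul] at h1
    exact hL _ (abs_le.1 h1)
  have hL0 : 0 ≤ L := (abs_nonneg _).trans (hLb 0 0 0)
  have hD : ∀ n s η, 0 ≤ η →
      (∀ z : Plane, ‖z‖ ≤ ε n → ∫ x, (W s (x + z) - W s x) ^ 2 ∂torusMeasure ≤ η ^ 2) →
      |∫ x, deriv β (torusConv (ρ n) (W s) x) * mollifiedFlux V (ρ n) (W s) x ∂torusMeasure| ≤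
        L * (4 * C * M) * η := fun n s η hη h => by
    refine (abs_integral_deriv_mul_mollifiedFlux_le hV.isLogKernel (hWb s) (hρ n) hβ
      (hLb n s)).trans ?_
    rw [mul_assoc L]
    exact mul_le_mul_of_nonneg_left
      (integral_abs_commutator_le hV (hWb s) (hρ n) (hε n) hη (hs n) (hC n) h) hL0
  have hm : ∀ n, Measurable fun s => ∫ x, deriv β (torusConv (ρ n) (W s) x) *
      mollifiedFlux V (ρ n) (W s) x ∂torusMeasure := fun n => by
    have h1 := measurable_torusConv (hρ n).smooth.continuous.measurable hWm
    have h2 : Measurable fun p : ℝ × Plane => deriv β (torusConv (ρ n) (W p.1) p.2) *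
        mollifiedFlux V (ρ n) (W p.1) p.2 :=
      (hβ'c.measurable.comp h1).mul (measurable_mollifiedFlux V (ρ n) hWm)
    exact (StronglyMeasurable.integral_prod_right' h2.stronglyMeasurable).measurable
  have hzero : ∫ _ in (0 : ℝ)..t, (0 : ℝ) = 0 := intervalIntegral.integral_zero
  suffices h : Tendsto (fun n => ∫ s in (0 : ℝ)..t, ∫ x, deriv β (torusConv (ρ n) (W s) x) *
      mollifiedFlux V (ρ n) (W s) x ∂torusMeasure) atTop (𝓝 (∫ _ in (0 : ℝ)..t, (0 : ℝ))) by
    rwa [hzero] at h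
  -- The crude modulus 2M supplies the majorant, so the continuity of translations is needed only at
  -- each fixed time, not uniformly in time.
  refine intervalIntegral.tendsto_integral_filter_of_dominated_convergence
    (fun _ => L * (4 * C * M) * (2 * M)) (Eventually.of_forall fun n => (hm n).aestronglyMeasurable)
    (Eventually.of_forall fun n => ae_of_all _ fun s _ =>
      hD n s (2 * M) (by positivity) fun z _ => integral_sq_sub_le (hWb s) z)
    intervalIntegrable_const (ae_of_all _ fun s _ => ?_)
  rw [Metric.tendsto_atTop]
  intro δ hδ
  set K := L * (4 * C * M) with hK
  have hK0 : 0 ≤ K := by positivity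
  set η := δ / (K + 1) with hη
  have hη0 : 0 < η := by positivity
  obtain ⟨r, hr, hball⟩ := Metric.mem_nhds_iff.1
    ((tendsto_integral_sq_sub (hWb s)).eventually (gt_mem_nhds (show 0 < η ^ 2 by positivity)))
  obtain ⟨n₀, hn₀⟩ := eventually_atTop.1 (hε0.eventually (gt_mem_nhds hr))
  refine ⟨n₀, fun n hn => ?_⟩
  rw [Real.dist_eq, sub_zero]
  refine (hD n s η hη0.le fun z hz => ?_).trans_lt ?_
  · refine le_of_lt (hball ?_)
    rw [mem_ball_zero_iff]
    exact hz.trans_lt (hn₀ n hn)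
  · rw [hη, mul_div_assoc', div_lt_iff₀ (by positivity)]
    nlinarith

/-- The essential supremum of the vorticity does not increase. -/
theorem IsYudovichSolution.ae_abs_le (hV : IsCoulombPotential V)
    (h : IsYudovichSolution V T ω₀ ω) {t : ℝ} (ht : t ∈ Icc 0 T) :
    ∀ᵐ x ∂torusMeasure, |ω t x| ≤ (linfNorm ω₀).toReal := by
  obtain ⟨W, M, hWm, hWb, hW⟩ := h.exists_version
  obtain ⟨ρ, ε, C, hρ, hρ0, hρ1, hε, hε0, hs, hC, hconv⟩ := exists_mollifiers
  obtain ⟨g, hg, hge⟩ := h.initial.exists_isBddPeriodic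
  set M₀ := (linfNorm ω₀).toReal with hM₀
  -- A smooth nonnegative function whose zero set is exactly [−M₀, M₀].
  set β : ℝ → ℝ := fun v => expNegInvGlue (v ^ 2 - M₀ ^ 2) with hβdef
  have hβ : ContDiff ℝ 1 β :=
    expNegInvGlue.contDiff.comp ((contDiff_id.pow 2).sub contDiff_const)
  have hβ0 : ∀ v, 0 ≤ β v := fun v => expNegInvGlue.nonneg _
  have hβz : ∀ v, |v| ≤ M₀ → β v = 0 := fun v hv => by
    refine expNegInvGlue.zero_of_nonpos ?_
    rw [sub_nonpos, ← sq_abs v]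
    exact pow_le_pow_left₀ (abs_nonneg _) hv 2
  have hβp : ∀ v, β v = 0 → |v| ≤ M₀ := fun v hv => by
    by_contra! hlt
    refine (expNegInvGlue.pos_of_pos ?_).ne' hv
    rw [sub_pos, ← sq_abs v]
    exact pow_lt_pow_left₀ hlt hg.nonneg two_ne_zero
  -- Averaging against a probability density does not increase the bound M₀.
  have hinit : ∀ n x, β (torusConv (ρ n) ω₀ x) = 0 := fun n x => by
    obtain ⟨R, hR⟩ := (hρ n).isBddPeriodic
    refine hβz _ ?_
    rw [← torusConv_congr_ae hge]
    have h1 := abs_torusConv_le hR.periodic hR.integrable hg x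
    simpa only [abs_of_nonneg (hρ0 n _), hρ1, one_mul] using h1
  have hωi := h.integrable t ht
  have hfc : ∀ n, Continuous fun x => β (torusConv (ρ n) (ω t) x) := fun n =>
    hβ.continuous.comp (continuous_torusConv_left (hρ n) hωi)
  have hlim : Tendsto (fun n => ∫ x, β (torusConv (ρ n) (ω t) x) ∂torusMeasure) atTop (𝓝 0) := by
    refine (tendsto_integral_deriv_mul_mollifiedFlux hV hWm hWb hβ hρ hρ0 hρ1 hε hε0 hs hC t).congr
      fun n => ?_
    rw [h.integral_comp_torusConv hWm hW (hρ n) hWb hV.isLogKernel hβ ht]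
    simp only [hinit, integral_zero, zero_add]
  have hpt : ∀ᵐ x ∂torusMeasure,
      Tendsto (fun n => β (torusConv (ρ n) (ω t) x)) atTop (𝓝 (β (ω t x))) := by
    filter_upwards [ae_torus_of_ae_volume (hconv (ω t) (h.periodic t ht) hωi)] with x hx
    exact (hβ.continuous.tendsto _).comp hx
  -- No bound on ω(t) at this individual time is known yet, so dominated convergence is unavailable;
  -- positivity of β permits Fatou's lemma.
  have hfatou := lintegral_liminf_le (μ := torusMeasure) (u := atTop)
    (f := fun n x => ENNReal.ofReal (β (torusConv (ρ n) (ω t) x)))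
    fun n => (ENNReal.measurable_ofReal.comp (hfc n).measurable)
  have hr : ∀ n, ∫⁻ x, ENNReal.ofReal (β (torusConv (ρ n) (ω t) x)) ∂torusMeasure =
      ENNReal.ofReal (∫ x, β (torusConv (ρ n) (ω t) x) ∂torusMeasure) := fun n =>
    (ofReal_integral_eq_lintegral_ofReal (hfc n).integrable_torus (ae_of_all _ fun x => hβ0 _)).symm
  simp only [hr] at hfatou
  have hlim' := (ENNReal.continuous_ofReal.tendsto 0).comp hlim
  rw [ENNReal.ofReal_zero] at hlim'
  rw [show liminf (fun n => ENNReal.ofReal (∫ x, β (torusConv (ρ n) (ω t) x) ∂torusMeasure)) atTop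
    = 0 from hlim'.liminf_eq, nonpos_iff_eq_zero] at hfatou
  have hmeas : Measurable fun x => liminf (fun n => ENNReal.ofReal (β (torusConv (ρ n) (ω t) x)))
      atTop := Measurable.liminf fun n => ENNReal.measurable_ofReal.comp (hfc n).measurable
  have h0 := (lintegral_eq_zero_iff hmeas).1 hfatou
  filter_upwards [h0, hpt] with x h1 h2
  have h3 := ((ENNReal.continuous_ofReal.tendsto _).comp h2).liminf_eq
  have h4 : ENNReal.ofReal (β (ω t x)) = 0 := h3.symm.trans h1
  exact hβp _ (le_antisymm (ENNReal.ofReal_eq_zero.1 h4) (hβ0 _))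

/-- The initial datum is attained. -/
lemma IsYudovichSolution.initial_ae_eq (hV : IsCoulombPotential V)
    (h : IsYudovichSolution V T ω₀ ω) (hT : (0 : ℝ) ∈ Icc 0 T) : ω 0 =ᵐ[torusMeasure] ω₀ := by
  obtain ⟨W, M, hWm, hWb, hW⟩ := h.exists_version
  obtain ⟨ρ, ε, C, hρ, -, -, -, -, -, -, hconv⟩ := exists_mollifiers
  filter_upwards [ae_torus_of_ae_volume (hconv (ω 0) (h.periodic 0 hT) (h.integrable 0 hT)),
    ae_torus_of_ae_volume (hconv ω₀ h.initial.periodic (h.initial.memLp.integrable le_top))]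
    with x h1 h2
  refine tendsto_nhds_unique h1 (h2.congr fun n => ?_)
  -- At time zero the time integral is empty, so both functions have the same mollifications.
  rw [h.torusConv_eq hW (hρ n) x hWb hV.isLogKernel hT]
  simp

/-- The definition gives boundedness only for almost every time; the maximum principle extends it to
every time, and `initial_ae_eq` replaces ω₀ by ω(0). -/
lemma IsYudovichSolution.memLinf (hV : IsCoulombPotential V)
    (h : IsYudovichSolution V T ω₀ ω) {t : ℝ} (ht : t ∈ Icc 0 T) :
    MemLinf (ω t) ∧ linfNorm (ω t) ≤ linfNorm (ω 0) := by
  have h0 : (0 : ℝ) ∈ Icc 0 T := ⟨le_rfl, ht.1.trans ht.2⟩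
  have hle := h.ae_abs_le hV ht
  refine ⟨⟨h.periodic t ht, memLp_top_of_bound (h.integrable t ht).1 _ hle⟩, ?_⟩
  rw [show linfNorm (ω 0) = linfNorm ω₀ from eLpNorm_congr_ae (h.initial_ae_eq hV h0)]
  rw [← ENNReal.ofReal_toReal (show linfNorm ω₀ ≠ ⊤ from h.initial.memLp.2.ne)]
  rw [linfNorm, eLpNorm_exponent_top]
  exact eLpNormEssSup_le_of_ae_bound hle

end Limit

/-! ### Passage to essentially bounded densities and conclusion. -/

theorem exists_isCZ_bmoNorm_le {V : Plane → ℝ} (hV : IsCoulombPotential V) :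
    ∃ A : ℝ, 0 < A ∧ ∀ (k j : Fin 2) (ω : Plane → ℝ), MemLinf ω →
      ∃ g, IsCZ V k j ω g ∧ bmoNorm g ≤ ENNReal.ofReal A * linfNorm ω := by
  obtain ⟨A, hA, h⟩ := exists_bmoNorm_le hV
  refine ⟨A, hA, fun k j ω hω => ?_⟩
  obtain ⟨f, hf, hfe⟩ := hω.exists_isBddPeriodic
  obtain ⟨g, hg, hgb⟩ := h f _ hf k j
  refine ⟨g, ?_, hgb.trans_eq ?_⟩
  · rw [IsCZ, ← torusConv_congr_ae hfe]
    exact hg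
  · rw [ENNReal.ofReal_mul hA.le, ENNReal.ofReal_toReal (show linfNorm ω ≠ ⊤ from hω.memLp.2.ne)]

lemma IsWeakDeriv.neg {k : Fin 2} {h g : Plane → ℝ} (hg : IsWeakDeriv k h g) :
    IsWeakDeriv k (fun x => -h x) (fun x => -g x) where
  periodic_left := hg.periodic_left.latticePeriodic.comp fun t => -t
  periodic_right := hg.periodic_right.latticePeriodic.comp fun t => -t
  integrable_left := hg.integrable_left.neg
  integrable_right := hg.integrable_right.neg
  integral_eq φ hφ := by
    simp only [neg_mul, integral_neg, hg.integral_eq φ hφ]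

end TorusEuler

end

theorem mainTheorem4 :
    (∃ V : TorusEuler.Plane → ℝ, TorusEuler.IsCoulombPotential V) ∧
    ∀ V : TorusEuler.Plane → ℝ, TorusEuler.IsCoulombPotential V →
      ∃ A : ℝ, 0 < A ∧
        (∀ (k j : Fin 2) (ω : TorusEuler.Plane → ℝ), TorusEuler.MemLinf ω →
          ∃ g : TorusEuler.Plane → ℝ, TorusEuler.IsCZ V k j ω g ∧
            TorusEuler.bmoNorm g ≤ ENNReal.ofReal A * TorusEuler.linfNorm ω) ∧
        (∀ (T : ℝ) (ω₀ : TorusEuler.Plane → ℝ) (ω : ℝ → TorusEuler.Plane → ℝ),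
          TorusEuler.IsYudovichSolution V T ω₀ ω →
          ∀ t ∈ Set.Icc 0 T, ∀ k j : Fin 2,
            ∃ g : TorusEuler.Plane → ℝ,
              TorusEuler.IsWeakDeriv k (TorusEuler.velocity V (ω t) j) g ∧
              TorusEuler.bmoNorm g ≤ ENNReal.ofReal A * TorusEuler.linfNorm (ω 0)) := by
  refine ⟨⟨_, TorusEuler.isCoulombPotential_thetaPotential⟩, fun V hV => ?_⟩
  obtain ⟨A, hA, h⟩ := TorusEuler.exists_isCZ_bmoNorm_le hV
  refine ⟨A, hA, h, fun T ω₀ ω hω t ht k j => ?_⟩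
  obtain ⟨hm, hle⟩ := hω.memLinf hV ht
  obtain ⟨g, hg, hgb⟩ := h k j (ω t) hm
  -- The velocity is minus the convolution; the BMO norm does not see the sign.
  refine ⟨fun x => -g x, TorusEuler.IsWeakDeriv.neg hg, ?_⟩
  rw [TorusEuler.bmoNorm_neg]
  exact hgb.trans (mul_le_mul_right hle _)
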